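/- Let $\mathbb H^2\times\mathbb R\subset\mathbb L^4$ ($\mathbb H^2$ of curvature $-1$). For a positive $\varphi\in C^\infty([0,1])$ let $\mathcal W_\varphi$ be the class of smooth immersed oriented surfaces in $\mathbb H^2\times\mathbb R$ whose principal curvatures $\kappa_1,\kappa_2$ and angle function $\nu$ (the product of the unit normal with the vertical unit field) satisfy $$(\kappa_1-\varphi(\nu^2))(\kappa_2-\varphi(\nu^2))=1,\qquad \kappa_1,\kappa_2>\varphi(\nu^2).$$ A canonical rotational example of $\mathcal W_\varphi$ is an inextendible rotational surface of $\mathcal W_\varphi$ that meets its rotation axis orthogonally. Let its profile curve, starting at the axis, be parametrized by arc length $s$, let $r(s)$ be the hyperbolic distance to the axis and $h(s)$ the height. Let $\varphi_0\in C^\infty([0,1])$ be positive with $\varphi_0(v)>\sqrt{1-v}$ for all $v\in[0,1]$. Then $\mathcal W_{\varphi_0}$ has a canonical rotational example. Let $S_0$ be one, with function $r_0$ as above. For all sufficiently small $\varepsilon>0$, the profile curve of $S_0$ is defined at $\varepsilon$ and $r_0'(\varepsilon)>0$. Let $\varepsilon>0$ be any parameter in the domain of the profile curve with $y:=r_0'(\varepsilon)>0$,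 and put $x:=r_0(\varepsilon)$. Then there are functions $\varphi\in C^\infty([0,1])$ such that 1. $\varphi=\varphi_0$ on $[y^2,1]$ and $\varphi>\varphi_0$ on $[0,y^2)$; 2. $\varphi(y^2/4)>\sqrt{1-y^2/4}\,\coth x$. Every such $\varphi$ is positive, the function $W(k_1,k_2,v)=(k_1-\varphi(v))(k_2-\varphi(v))-1$ defines a general elliptic Weingarten class (it is smooth on $\mathbb R^2\times[0,1]$, symmetric in $k_1,k_2$, and $W_{k_1}W_{k_2}>0$ wherever $W=0$), $\mathcal W_\varphi$ has a canonical rotational example, and every canonical rotational example of $\mathcal W_\varphi$ is a non-complete rotational vertical graph with unbounded second fundamental form. In particular, there exist positive $\varphi\in C^\infty([0,1])$ for which $\mathcal W_\varphi$ has these properties. -/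

import Mathlib

open Filter Topology
open scoped ENNReal ContDiff

noncomputable section

namespace HypProd

/-! ## The ambient space `H² × ℝ` inside Minkowski space `L⁴` -/

/-- The vector space underlying Minkowski 4-space; coordinate `0` is the timelike one and
coordinate `3` is the height. -/
abbrev L4 : Type := Fin 4 → ℝ

/-- The Lorentzian inner product of signature `(-,+,+,+)`. -/
def mink (p q : L4) : ℝ := -(p 0 * q 0) + p 1 * q 1 + p 2 * q 2 + p 3 * q 3

/-- `H² × ℝ` (with `H²` of curvature `-1`), as a submanifold of `L⁴`; its Riemannian metric is the
restriction of `mink`. -/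
def space : Set L4 := {p | -(p 0) ^ 2 + (p 1) ^ 2 + (p 2) ^ 2 = -1 ∧ 0 < p 0}

/-- The normal vector of `H² × ℝ` in `L⁴` at the point `p`. -/
def ambientNormal (p : L4) : L4 := ![p 0, p 1, p 2, 0]

/-! ## Parametrized oriented surfaces in `H² × ℝ`

A parametrized surface is a map `X : ℂ → L⁴` considered on an open subset of the plane `ℂ = ℝ²`.
-/

/-- The first fundamental form at `z`. -/
def firstForm (X : ℂ → L4) (z v w : ℂ) : ℝ := mink (fderiv ℝ X z v) (fderiv ℝ X z w)

/-- `N` is a unit normal vector at `z` of the surface `X`, inside `H² × ℝ`: it is tangent to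
`H² × ℝ`, has length one, and is orthogonal to the surface. -/
def IsUnitNormal (X : ℂ → L4) (z : ℂ) (N : L4) : Prop :=
  mink N (ambientNormal (X z)) = 0 ∧ mink N N = 1 ∧ ∀ v : ℂ, mink (fderiv ℝ X z v) N = 0

/-- The second fundamental form at `z` with respect to the unit normal `N`. As `N` is tangent to
`H² × ℝ` and `L⁴` is flat, `⟨∇_v dX(w), N⟩` is the product of the second derivative of `X`
with `N`. -/
def secondForm (X : ℂ → L4) (N : L4) (z v w : ℂ) : ℝ :=
  mink (fderiv ℝ (fun y => fderiv ℝ X y w) z v) N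

/-- `k₁, k₂` are the principal curvatures at `z`: the eigenvalues, with multiplicity, of the second
fundamental form with respect to the first one. -/
def ArePrincipalCurvatures (X : ℂ → L4) (N : L4) (z : ℂ) (k₁ k₂ : ℝ) : Prop :=
  ∃ v₁ v₂ : ℂ, LinearIndependent ℝ ![v₁, v₂] ∧
    (∀ w, secondForm X N z v₁ w = k₁ * firstForm X z v₁ w) ∧
    (∀ w, secondForm X N z v₂ w = k₂ * firstForm X z v₂ w)

/-- Length of a curve `c : [0,1] → ℂ` in the metric induced by `X`. -/
def curveLength (X : ℂ → L4) (c : ℝ → ℂ) : ℝ≥0∞ :=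
  ∫⁻ t in Set.Icc (0 : ℝ) 1, ENNReal.ofReal (√(firstForm X (c t) (deriv c t) (deriv c t)))

/-- Distance on the domain `D` induced by `X`: infimum of the lengths of the `C¹` curves in `D`. -/
def inducedDist (X : ℂ → L4) (D : Set ℂ) (z w : ℂ) : ℝ≥0∞ :=
  ⨅ (c : ℝ → ℂ) (_ : ContDiff ℝ 1 c) (_ : Set.MapsTo c (Set.Icc 0 1) D) (_ : c 0 = z)
    (_ : c 1 = w), curveLength X c

/-- Every Cauchy sequence of `D` for the induced distance converges in `D`. -/
def CompleteOn (X : ℂ → L4) (D : Set ℂ) : Prop :=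
  ∀ z : ℕ → ℂ, (∀ n, z n ∈ D) →
    (∀ δ : ℝ≥0∞, 0 < δ → ∃ n₀, ∀ m ≥ n₀, ∀ n ≥ n₀, inducedDist X D (z m) (z n) < δ) →
    ∃ w ∈ D, Tendsto (fun n => inducedDist X D (z n) w) atTop (𝓝 0)

/-! ## Rotational surfaces touching their axis -/

/-- The open disk of radius `ℓ ∈ [0,∞]` about the origin. -/
def disk (ℓ : ℝ≥0∞) : Set ℂ := {z | ‖z‖ₑ < ℓ}

/-- The map obtained by rotating the profile curve `s ↦ (r(s), h(s))` about the vertical axis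
`{(1,0,0)} × ℝ`: it sends `s e^{iθ}` to
`(cosh r(s), sinh r(s) cos θ, sinh r(s) sin θ, h(s))`. -/
def rotMap (r h : ℝ → ℝ) (z : ℂ) : L4 :=
  ![Real.cosh (r ‖z‖), Real.sinh (r ‖z‖) * (z.re / ‖z‖), Real.sinh (r ‖z‖) * (z.im / ‖z‖), h ‖z‖]

/-- The rotated curve lies in `H² × ℝ`. -/
theorem rotMap_mem_space (r h : ℝ → ℝ) (h0 : r 0 = 0) (z : ℂ) : rotMap r h z ∈ space := by
  refine ⟨?_, Real.cosh_pos _⟩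
  simp only [rotMap, Matrix.cons_val]
  rcases eq_or_ne z 0 with rfl | hz
  · simp [h0]
  · have h1 : ‖z‖ ≠ 0 := norm_ne_zero_iff.mpr hz
    have h2 : z.re ^ 2 + z.im ^ 2 = ‖z‖ ^ 2 := by
      rw [← Complex.normSq_eq_norm_sq, Complex.normSq_apply]; ring
    have h3 : (z.re / ‖z‖) ^ 2 + (z.im / ‖z‖) ^ 2 = 1 := by
      rw [div_pow, div_pow, ← add_div, h2, div_self (pow_ne_zero 2 h1)]
    linear_combination (Real.sinh (r ‖z‖)) ^ 2 * h3 - Real.cosh_sq (r ‖z‖)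

/-- A smooth immersed oriented rotational surface of `H² × ℝ` that meets its rotation axis
orthogonally at a pole. Its profile curve is parametrized by arc length `s ∈ [0,ℓ)`, starting at
the pole, and does not meet the axis for `0 < s < ℓ`; so the surface is parametrized by the disk of
radius `ℓ`. (A rotational sphere is represented by the complement of its second pole; see
`ClosesUp`.) -/
structure RotSurface where
  /-- length of the profile curve -/
  ℓ : ℝ≥0∞
  /-- hyperbolic distance to the axis along the profile curve -/
  r : ℝ → ℝ
  /-- height along the profile curve -/
  h : ℝ → ℝ
  /-- unit normal -/
  N : ℂ → L4
  ℓ_pos : 0 < ℓ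
  r_zero : r 0 = 0
  r_pos : ∀ s : ℝ, 0 < s → ENNReal.ofReal s < ℓ → 0 < r s
  smooth : ContDiffOn ℝ ∞ (rotMap r h) (disk ℓ)
  immersed : ∀ z ∈ disk ℓ, Function.Injective (fderiv ℝ (rotMap r h) z)
  /-- the profile curve (every meridian) has unit speed -/
  unit_speed : ∀ z ∈ disk ℓ, ∀ u : ℂ, ‖u‖ = 1 → z = (‖z‖ : ℂ) * u →
    firstForm (rotMap r h) z u u = 1
  /-- at the pole the tangent plane is horizontal -/
  orthogonal : ∀ v : ℂ, (fderiv ℝ (rotMap r h) 0 v) 3 = 0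
  normal_cont : ContinuousOn N (disk ℓ)
  normal : ∀ z ∈ disk ℓ, IsUnitNormal (rotMap r h) z (N z)

namespace RotSurface

/-- The domain of the parametrization. -/
def dom (S : RotSurface) : Set ℂ := disk S.ℓ

/-- The immersion. -/
def X (S : RotSurface) : ℂ → L4 := rotMap S.r S.h

/-- The angle function: product of the unit normal with the vertical unit Killing field. -/
def angle (S : RotSurface) (z : ℂ) : ℝ := mink (S.N z) ![0, 0, 0, 1]

/-- `k₁, k₂` are the principal curvatures of `S` at `z`. -/
def Principal (S : RotSurface) (z : ℂ) (k₁ k₂ : ℝ) : Prop :=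
  ArePrincipalCurvatures S.X (S.N z) z k₁ k₂

/-- The second fundamental form, of squared norm `k₁² + k₂²`, is bounded. -/
def BoundedSecondForm (S : RotSurface) : Prop :=
  ∃ C : ℝ, ∀ z ∈ S.dom, ∀ k₁ k₂ : ℝ, S.Principal z k₁ k₂ → k₁ ^ 2 + k₂ ^ 2 ≤ C

/-- `S` is a vertical graph over a domain of `H²`: it projects injectively to `H²`, and is nowhere
vertical. -/
def IsGraph (S : RotSurface) : Prop :=
  Set.InjOn (fun z => (S.X z 0, S.X z 1, S.X z 2)) S.dom ∧ ∀ z ∈ S.dom, S.angle z ≠ 0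

/-- The profile curve returns to the axis and `S` becomes a smooth rotational sphere after adding a
second pole: the reversed profile curve also defines a rotational surface, with the same normal. -/
def ClosesUp (S : RotSurface) : Prop :=
  S.ℓ ≠ ⊤ ∧ ∃ T : RotSurface, T.ℓ = S.ℓ ∧
    ∀ s : ℝ, 0 < s → ENNReal.ofReal s < S.ℓ →
      T.r s = S.r (S.ℓ.toReal - s) ∧ T.h s = S.h (S.ℓ.toReal - s) ∧
      ∀ u : ℂ, ‖u‖ = 1 → T.N ((s : ℂ) * u) = S.N (((S.ℓ.toReal - s : ℝ) : ℂ) * u)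

/-- Completeness of the surface (of the sphere, if the surface closes up). -/
def IsComplete (S : RotSurface) : Prop := S.ClosesUp ∨ CompleteOn S.X S.dom

/-- `T` extends `S`. -/
def Extends (T S : RotSurface) : Prop :=
  S.ℓ ≤ T.ℓ ∧ (∀ s : ℝ, 0 ≤ s → ENNReal.ofReal s < S.ℓ → T.r s = S.r s ∧ T.h s = S.h s) ∧
    ∀ z ∈ S.dom, T.N z = S.N z

end RotSurface

/-! ## Weingarten classes -/

/-- `W(k₁,k₂,v)` is the left side of a general (elliptic) Weingarten relation: it is smooth on
`ℝ² × [0,1]`, symmetric in `k₁, k₂`, and elliptic at its zeros. -/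
def IsGeneralWeingarten (W : ℝ → ℝ → ℝ → ℝ) : Prop :=
  ContDiffOn ℝ ∞ (fun p : ℝ × ℝ × ℝ => W p.1 p.2.1 p.2.2) {p | p.2.2 ∈ Set.Icc (0 : ℝ) 1} ∧
  (∀ k₁ k₂, ∀ v ∈ Set.Icc (0 : ℝ) 1, W k₁ k₂ v = W k₂ k₁ v) ∧
  ∀ k₁ k₂, ∀ v ∈ Set.Icc (0 : ℝ) 1, W k₁ k₂ v = 0 →
    0 < deriv (fun k => W k k₂ v) k₁ * deriv (fun k => W k₁ k v) k₂

/-- The function `(k₁ - φ(v)) (k₂ - φ(v)) - 1`. -/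
def weingartenFn (φ : ℝ → ℝ) (k₁ k₂ v : ℝ) : ℝ := (k₁ - φ v) * (k₂ - φ v) - 1

/-- `S` belongs to the Weingarten class of `φ`: its principal curvatures and angle function satisfy
`(κ₁ - φ(ν²)) (κ₂ - φ(ν²)) = 1`, on the component `κ₁, κ₂ > φ(ν²)` of this relation. -/
def InClass (φ : ℝ → ℝ) (S : RotSurface) : Prop :=
  ∀ z ∈ S.dom, ∃ k₁ k₂ : ℝ, S.Principal z k₁ k₂ ∧
    weingartenFn φ k₁ k₂ (S.angle z ^ 2) = 0 ∧
    φ (S.angle z ^ 2) < k₁ ∧ φ (S.angle z ^ 2) < k₂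

/-- `S` is a canonical rotational example of the class of `φ`: a rotational surface of the class
that meets its axis orthogonally and is inextendible. -/
def IsCanonicalExample (φ : ℝ → ℝ) (S : RotSurface) : Prop :=
  InClass φ S ∧ ∀ T : RotSurface, InClass φ T → T.Extends S → T.ℓ = S.ℓ

/-- `φ` is a positive smooth function on `[0,1]`. -/
def SmoothPos (φ : ℝ → ℝ) : Prop :=
  ContDiffOn ℝ ∞ φ (Set.Icc 0 1) ∧ ∀ v ∈ Set.Icc (0 : ℝ) 1, 0 < φ v

/-- The functions `φ ∈ C^∞([0,1])` obtained by modifying `φ₀` on `[0,y²)` with a sufficiently large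
value at `y²/4`; here `x, y` will be the values of `r` and `r'` at some parameter of the profile
curve of the canonical example of `φ₀`. -/
def IsModification (φ₀ φ : ℝ → ℝ) (x y : ℝ) : Prop :=
  ContDiffOn ℝ ∞ φ (Set.Icc 0 1) ∧
  (∀ v ∈ Set.Icc (y ^ 2) 1, φ v = φ₀ v) ∧
  (∀ v ∈ Set.Ico 0 (y ^ 2), φ₀ v < φ v) ∧
  √(1 - y ^ 2 / 4) * (Real.cosh x / Real.sinh x) < φ (y ^ 2 / 4)

/-- The class of `φ` is a general Weingarten class, it has a canonical rotational example, and its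
canonical rotational examples are non-complete graphs with unbounded second fundamental form. -/
def HasIncompleteUnboundedExample (φ : ℝ → ℝ) : Prop :=
  IsGeneralWeingarten (weingartenFn φ) ∧ (∃ S, IsCanonicalExample φ S) ∧
    ∀ S, IsCanonicalExample φ S → S.IsGraph ∧ ¬ S.IsComplete ∧ ¬ S.BoundedSecondForm

end HypProd

end

noncomputable section

namespace HypProd

/-! ## Singular scalar differential equations `t y' = G(t, y)` -/

/-! Put w = |h'|. The parallels have curvature l = w coth r, the squared angle is ν² = r'² = 1 - w²,
and the Weingarten relation gives the meridian curvature κ = φ(ν²) + 1/(l - φ(ν²)). The profile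
therefore solves w' = r' κ and r'' = -w κ. Since κ > φ > 0, the slope r' decreases strictly from its
value 1 at the pole, and membership in the class forces φ(r'²) < √(1 - r'²) coth r at every
parameter.

This inequality is a barrier. As far as it is defined, a canonical example of the modified class
agrees with S₀ up to the parameter ε: there r₀'² ≥ y², where φ = φ₀, and the solution leaving the
pole is unique. If r' ever fell to y/2, this would happen after ε, at a radius at least x, and the
inequality would give φ(y²/4) < √(1 - y²/4) coth x, against condition 2. Hence r' > y/2 everywhere
(`IsModification.half_lt_deriv`).

Everything else follows from this lower bound. Since r increases and ν ≠ 0, the surface is a graph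
(`ClassProfile.isGraph`). Since w' ≥ (y/2) min φ while w ≤ 1, the profile has finite length
(`ClassProfile.exists_length`). The meridian thus runs out at finite distance, and no point of the
surface can be its limit because the height is strictly monotone along it and 1-Lipschitz for the
induced distance (`ClassProfile.not_completeOn`). If the curvature were bounded, l - φ would stay
away from zero and the profile system could be continued beyond the endpoint
(`ClassProfile.exists_extension`), contradicting inextendibility; so the second fundamental form is
unbounded.

The technical weight lies at the pole, where the system is singular. In variables that are even in s
it splits into scalar equations t y' = G(t, y) with negative ∂G/∂y at the singular point. Such an
equation has a local solution (`singular_exists`), smooth up to t = 0 (`singular_contDiffOn`), which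
makes the rotated surface smooth at the pole; monotonicity of G in y yields uniqueness
(`ProfileSol.eventually_unique`). Inextendible surfaces then come from Zorn's lemma
(`exists_canonicalExample`). -/

theorem nonpos_of_antitone_of_tendsto_zero {f : ℝ → ℝ} {δ : ℝ}
    (hf : AntitoneOn f (Set.Ioo 0 δ)) (h0 : Tendsto f (𝓝[>] 0) (𝓝 0)) :
    ∀ t ∈ Set.Ioo 0 δ, f t ≤ 0 := by
  intro t ht
  refine ge_of_tendsto h0 ?_
  filter_upwards [Ioo_mem_nhdsGT ht.1] with s hs
  exact hf ⟨hs.1, hs.2.trans ht.2⟩ ht hs.2.le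

theorem antitoneOn_Ioo_of_hasDerivAt {f f' : ℝ → ℝ} {a b : ℝ}
    (hf : ∀ t ∈ Set.Ioo a b, HasDerivAt f (f' t) t) (h' : ∀ t ∈ Set.Ioo a b, f' t ≤ 0) :
    AntitoneOn f (Set.Ioo a b) := by
  refine antitoneOn_of_deriv_nonpos (convex_Ioo _ _)
    (fun t ht => (hf t ht).continuousAt.continuousWithinAt)
    (fun t ht => (hf t (interior_subset ht)).differentiableAt.differentiableWithinAt) ?_
  intro t ht
  rw [interior_Ioo] at ht
  rw [(hf t ht).deriv]
  exact h' t ht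

/-- A function with nonnegative decay rate that tends to `0` at the left end vanishes. -/
theorem eq_zero_of_mul_deriv_nonpos {d d' : ℝ → ℝ} {δ : ℝ}
    (hd : ∀ t ∈ Set.Ioo 0 δ, HasDerivAt d (d' t) t) (hs : ∀ t ∈ Set.Ioo 0 δ, d t * d' t ≤ 0)
    (h0 : Tendsto d (𝓝[>] 0) (𝓝 0)) : ∀ t ∈ Set.Ioo 0 δ, d t = 0 := by
  intro t ht
  have h1 : AntitoneOn (fun t => d t ^ 2) (Set.Ioo 0 δ) :=
    antitoneOn_Ioo_of_hasDerivAt (fun t ht => (hd t ht).pow 2)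
      (fun t ht => by have := hs t ht; norm_num; nlinarith)
  have h2 : d t ^ 2 ≤ 0 :=
    nonpos_of_antitone_of_tendsto_zero h1 (by simpa using h0.pow 2) t ht
  exact pow_eq_zero_iff (two_ne_zero) |>.1 (le_antisymm h2 (sq_nonneg _))

/-- The bounded solution of a linear singular equation has the expected limit. -/
theorem tendsto_of_singular_linear {δ : ℝ} {a b u : ℝ → ℝ} (hδ : 0 < δ)
    (ha : ContinuousOn a (Set.Ico 0 δ)) (hb : ContinuousOn b (Set.Ico 0 δ)) (ha0 : a 0 < -1)
    (hu : ∀ t ∈ Set.Ioo 0 δ, HasDerivAt u ((a t * u t + b t) / t) t)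
    (hlim : Tendsto (fun t => t * u t) (𝓝[>] 0) (𝓝 0)) :
    Tendsto u (𝓝[>] 0) (𝓝 (-b 0 / a 0)) := by
  set u0 := -b 0 / a 0 with hu0
  have hle : 𝓝[>] (0:ℝ) ≤ 𝓝[Set.Ico 0 δ] 0 := by
    rw [← nhdsWithin_Ioo_eq_nhdsGT hδ]
    exact nhdsWithin_mono _ Set.Ioo_subset_Ico_self
  have hta : Tendsto a (𝓝[>] 0) (𝓝 (a 0)) := (ha 0 ⟨le_rfl, hδ⟩).mono_left hle
  have htb : Tendsto b (𝓝[>] 0) (𝓝 (b 0)) := (hb 0 ⟨le_rfl, hδ⟩).mono_left hle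
  set ν := (-1 - a 0) / 2 with hν
  have hνpos : 0 < ν := by rw [hν]; linarith
  have hbeta : Tendsto (fun t => b t + a t * u0) (𝓝[>] 0) (𝓝 0) := by
    have h := htb.add (hta.mul_const u0)
    have h0 : b 0 + a 0 * u0 = 0 := by
      have : a 0 ≠ 0 := by linarith
      rw [hu0]; field_simp; ring
    rwa [h0] at h
  have ht0 : Tendsto (fun t : ℝ => t) (𝓝[>] 0) (𝓝 0) := tendsto_id.mono_left nhdsWithin_le_nhds
  rw [Metric.tendsto_nhds]
  intro ε' hε'
  obtain ⟨ε, hε, hεε⟩ := exists_between hε'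
  have e1 : ∀ᶠ t in 𝓝[>] 0, a t < -1 - ν := hta.eventually_lt_const (by rw [hν]; linarith)
  -- The bound 4νε² is what Young's inequality needs below: βv ≤ νv² + β²/(4ν) ≤ νv² + ε².
  have e2 : ∀ᶠ t in 𝓝[>] 0, (b t + a t * u0) ^ 2 < 4 * ν * ε ^ 2 := by
    have := hbeta.pow 2
    exact this.eventually_lt_const (by norm_num; positivity)
  obtain ⟨δ', hδ', hE⟩ := (nhdsGT_basis (0:ℝ)).eventually_iff.1
    (e1.and (e2.and (Ioo_mem_nhdsGT hδ)))
  -- The weight t² has two effects: the quantity tends to 0 at the singular point, as t u → 0, and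
  -- its derivative is nonpositive because a < -1 - ν.
  have key : ∀ t ∈ Set.Ioo 0 δ', t ^ 2 * ((u t - u0) ^ 2 - ε ^ 2) ≤ 0 := by
    apply nonpos_of_antitone_of_tendsto_zero
    · apply antitoneOn_Ioo_of_hasDerivAt (f' := fun t =>
        2 * t * ((u t - u0) ^ 2 - ε ^ 2) +
          t ^ 2 * (2 * (u t - u0) * ((a t * u t + b t) / t)))
      · intro t ht
        have h1 := hu t (hE ht).2.2
        have h2 := ((hasDerivAt_id t).pow 2).mul (((h1.sub_const u0).pow 2).sub_const (ε ^ 2))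
        refine h2.congr_deriv ?_
        simp
      · intro t ht
        obtain ⟨h1, h2, h3⟩ := hE ht
        have htp : 0 < t := ht.1
        have e : 2 * t * ((u t - u0) ^ 2 - ε ^ 2) +
          t ^ 2 * (2 * (u t - u0) * ((a t * u t + b t) / t)) =
          2 * t * ((u t - u0) ^ 2 - ε ^ 2 +
            (u t - u0) * (a t * (u t - u0) + (b t + a t * u0))) := by
          field_simp; ring
        rw [e]
        refine mul_nonpos_of_nonneg_of_nonpos (by positivity) ?_
        set v := u t - u0
        set β := b t + a t * u0
        have h4 : a t * v ^ 2 ≤ (-1 - ν) * v ^ 2 := by gcongr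
        have h5 : β * v ≤ ν * v ^ 2 + ε ^ 2 := by
          have h6 : 4 * ν * (β * v) ≤ 4 * ν * (ν * v ^ 2 + ε ^ 2) := by
            nlinarith [sq_nonneg (β - 2 * ν * v)]
          exact le_of_mul_le_mul_left h6 (by positivity)
        nlinarith
    · have h1 : Tendsto (fun t => (t * u t - t * u0) ^ 2 - t ^ 2 * ε ^ 2) (𝓝[>] 0) (𝓝 0) := by
        have := ((hlim.sub (ht0.mul_const u0)).pow 2).sub ((ht0.pow 2).mul_const (ε ^ 2))
        simpa using this
      refine h1.congr fun t => by ring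
  filter_upwards [Ioo_mem_nhdsGT hδ'] with t ht
  have h1 := key t ht
  have h2 : (u t - u0) ^ 2 ≤ ε ^ 2 := by
    have := nonpos_of_mul_nonpos_right h1 (by have := ht.1; positivity)
    linarith
  rw [Real.dist_eq]
  exact (abs_le_of_sq_le_sq h2 hε.le).trans_lt hεε

theorem mem_nhds_Ico_zero {δ t : ℝ} (ht : t ∈ Set.Ioo 0 δ) : Set.Ico 0 δ ∈ 𝓝 t :=
  mem_of_superset (isOpen_Ioo.mem_nhds ht) Set.Ioo_subset_Ico_self

/-- A function with a smooth one-sided derivative. -/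
theorem contDiffOn_Ico_succ {δ : ℝ} {n : ℕ} {u v : ℝ → ℝ} (hδ : 0 < δ)
    (hu : ContinuousOn u (Set.Ico 0 δ)) (hd : ∀ t ∈ Set.Ioo 0 δ, HasDerivAt u (v t) t)
    (hv : ContDiffOn ℝ n v (Set.Ico 0 δ)) : ContDiffOn ℝ (n + 1 : ℕ) u (Set.Ico 0 δ) := by
  have hle : 𝓝[>] (0:ℝ) ≤ 𝓝[Set.Ico 0 δ] 0 := by
    rw [← nhdsWithin_Ioo_eq_nhdsGT hδ]
    exact nhdsWithin_mono _ Set.Ioo_subset_Ico_self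
  have hD : ∀ t ∈ Set.Ico 0 δ, HasDerivWithinAt u (v t) (Set.Ico 0 δ) t := by
    intro t ht
    rcases ht.1.eq_or_lt with rfl | h
    · have h1 : HasDerivWithinAt u (v 0) (Set.Ici 0) 0 := by
        refine hasDerivWithinAt_Ici_of_tendsto_deriv (s := Set.Ioo 0 δ)
          (fun t ht => (hd t ht).differentiableAt.differentiableWithinAt)
          ((hu 0 ht).mono Set.Ioo_subset_Ico_self) (Ioo_mem_nhdsGT hδ) ?_
        refine ((hv.continuousOn 0 ht).mono_left hle).congr' ?_
        filter_upwards [Ioo_mem_nhdsGT hδ] with t ht using (hd t ht).deriv.symm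
      exact h1.mono Set.Ico_subset_Ici_self
    · exact (hd t ⟨h, ht.2⟩).hasDerivWithinAt
  have hU : UniqueDiffOn ℝ (Set.Ico (0:ℝ) δ) := uniqueDiffOn_Ico _ _
  push_cast
  rw [contDiffOn_succ_iff_derivWithin hU]
  refine ⟨fun t ht => (hD t ht).differentiableWithinAt, by simp, ?_⟩
  exact hv.congr fun t ht => (hD t ht).derivWithin (hU t ht)

/-- The bounded solution of a linear singular equation is smooth up to the singular point. -/
theorem contDiffOn_of_singular_linear {δ : ℝ} (hδ : 0 < δ) (n : ℕ) : ∀ {a b u : ℝ → ℝ},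
    ContDiffOn ℝ n a (Set.Ico 0 δ) → ContDiffOn ℝ n b (Set.Ico 0 δ) → a 0 < -1 →
    (∀ t ∈ Set.Ioo 0 δ, HasDerivAt u ((a t * u t + b t) / t) t) →
    Tendsto (fun t => t * u t) (𝓝[>] 0) (𝓝 0) →
    ContDiffOn ℝ n (Function.update u 0 (-b 0 / a 0)) (Set.Ico 0 δ) := by
  have hle : 𝓝[>] (0:ℝ) ≤ 𝓝[Set.Ico 0 δ] 0 := by
    rw [← nhdsWithin_Ioo_eq_nhdsGT hδ]
    exact nhdsWithin_mono _ Set.Ioo_subset_Ico_self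
  have h0mem : (0:ℝ) ∈ Set.Ico 0 δ := ⟨le_rfl, hδ⟩
  have hcont : ∀ {a b u : ℝ → ℝ},
    ContinuousOn a (Set.Ico 0 δ) → ContinuousOn b (Set.Ico 0 δ) → a 0 < -1 →
    (∀ t ∈ Set.Ioo 0 δ, HasDerivAt u ((a t * u t + b t) / t) t) →
    Tendsto (fun t => t * u t) (𝓝[>] 0) (𝓝 0) →
    ContinuousOn (Function.update u 0 (-b 0 / a 0)) (Set.Ico 0 δ) := by
    intro a b u ha hb ha0 hu hlim
    rw [continuousOn_update_iff]
    refine ⟨fun t ht => ?_, fun _ => ?_⟩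
    · have : t ∈ Set.Ioo 0 δ := ⟨lt_of_le_of_ne ht.1.1 (Ne.symm ht.2), ht.1.2⟩
      exact (hu t this).continuousAt.continuousWithinAt
    · refine (tendsto_of_singular_linear hδ ha hb ha0 hu hlim).mono_left ?_
      refine nhdsWithin_mono _ fun t ht => ?_
      exact lt_of_le_of_ne ht.1.1 (Ne.symm ht.2)
  induction n with
  | zero =>
    intro a b u ha hb ha0 hu hlim
    exact contDiffOn_zero.2 (hcont ha.continuousOn hb.continuousOn ha0 hu hlim)
  | succ n ih =>
    intro a b u ha hb ha0 hu hlim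
    set ut := Function.update u 0 (-b 0 / a 0) with hut
    have hU : UniqueDiffOn ℝ (Set.Ico (0:ℝ) δ) := uniqueDiffOn_Ico _ _
    have huc := ih (ha.of_le (by norm_cast; omega)) (hb.of_le (by norm_cast; omega)) ha0 hu hlim
    have hcu := hcont ha.continuousOn hb.continuousOn ha0 hu hlim
    rw [← hut] at huc hcu
    have hute : ∀ t ∈ Set.Ioo 0 δ, ut t = u t := fun t ht =>
      Function.update_of_ne ht.1.ne' _ _
    have ha' : ContDiffOn ℝ n (derivWithin a (Set.Ico 0 δ)) (Set.Ico 0 δ) :=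
      ha.derivWithin hU (by norm_cast)
    have hb' : ContDiffOn ℝ n (derivWithin b (Set.Ico 0 δ)) (Set.Ico 0 δ) :=
      hb.derivWithin hU (by norm_cast)
    have hder : ∀ {f : ℝ → ℝ}, ContDiffOn ℝ (n + 1 : ℕ) f (Set.Ico 0 δ) → ∀ t ∈ Set.Ioo 0 δ,
        HasDerivAt f (derivWithin f (Set.Ico 0 δ) t) t := by
      intro f hf t ht
      have := (hf.differentiableOn (by simp) t (Set.Ioo_subset_Ico_self ht)).hasDerivWithinAt
      exact this.hasDerivAt (mem_nhds_Ico_zero ht)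
    set v : ℝ → ℝ := fun t => (a t * u t + b t) / t with hv
    have hlimu := tendsto_of_singular_linear hδ ha.continuousOn hb.continuousOn ha0 hu hlim
    -- Differentiating t u' = a u + b shows that v = u' solves t v' = (a - 1) v + (a' u + b'). This
    -- has the same form, its coefficient at 0 is still below -1, and t v = a u + b → 0 by the limit
    -- already found for u.
    have key := ih (a := fun t => a t - 1)
      (b := fun t => derivWithin a (Set.Ico 0 δ) t * ut t + derivWithin b (Set.Ico 0 δ) t) (u := v)
      ((ha.of_le (by norm_cast; omega)).sub contDiffOn_const) ((ha'.mul huc).add hb')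
      (by linarith) ?_ ?_
    · have := contDiffOn_Ico_succ (n := n) (u := ut) hδ hcu ?_ key
      · exact this
      · intro t ht
        have h1 : HasDerivAt ut (v t) t := by
          refine (hu t ht).congr_of_eventuallyEq ?_
          filter_upwards [isOpen_Ioo.mem_nhds ht] with s hs using hute s hs
        rwa [Function.update_of_ne ht.1.ne']
    · intro t ht
      have h1 := (((hder ha t ht).mul (hu t ht)).add (hder hb t ht)).div (hasDerivAt_id t) ht.1.ne'
      refine h1.congr_deriv ?_
      simp only [hute t ht, hv, id, Pi.mul_apply, Pi.add_apply]
      have := ht.1.ne'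
      field_simp
      ring
    · have h1 : Tendsto (fun t => a t * u t + b t) (𝓝[>] 0) (𝓝 (a 0 * (-b 0 / a 0) + b 0)) :=
        (((ha.continuousOn 0 h0mem).mono_left hle).mul hlimu).add
          ((hb.continuousOn 0 h0mem).mono_left hle)
      have h2 : a 0 * (-b 0 / a 0) + b 0 = 0 := by
        have : a 0 ≠ 0 := by linarith
        field_simp; ring
      rw [h2] at h1
      refine h1.congr' ?_
      filter_upwards [self_mem_nhdsWithin] with t ht
      have : t ≠ 0 := ne_of_gt ht
      rw [hv]
      field_simp

/-! ### Nonlinear singular equations: regularity, monotonicity and existence -/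

section Singular

variable {G : ℝ × ℝ → ℝ} {δ : ℝ} {V : Set ℝ}

theorem uniqueDiffOn_Ico_prod (hV : IsOpen V) : UniqueDiffOn ℝ (Set.Ico 0 δ ×ˢ V) :=
  (uniqueDiffOn_Ico _ _).prod hV.uniqueDiffOn

/-- The partial derivative in the second variable on `[0,δ) × V`. -/
theorem hasDerivAt_snd (hV : IsOpen V) (hG : ContDiffOn ℝ ∞ G (Set.Ico 0 δ ×ˢ V)) {t y : ℝ}
    (ht : t ∈ Set.Ico 0 δ) (hy : y ∈ V) :
    HasDerivAt (fun y => G (t, y)) (fderivWithin ℝ G (Set.Ico 0 δ ×ˢ V) (t, y) (0, 1)) y := by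
  have h1 := (hG.differentiableOn (by simp) (t, y) ⟨ht, hy⟩).hasFDerivWithinAt
  have h2 : HasDerivWithinAt (fun y : ℝ => (t, y)) ((0 : ℝ), (1 : ℝ)) V y :=
    ((hasDerivAt_const y t).prodMk (hasDerivAt_id y)).hasDerivWithinAt
  exact (h1.comp_hasDerivWithinAt y h2 (fun z hz => ⟨ht, hz⟩)).hasDerivAt (hV.mem_nhds hy)

/-- Bootstrapping: u = y' solves the linear singular equation t u' = (∂G/∂y - 1) u + ∂G/∂t along the
solution, whose leading coefficient at 0 is g - 1 < -1. If y is of class n, so are the coefficients,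
hence so is u, and y gains one derivative. -/
theorem singular_contDiffOn (hδ : 0 < δ) (hV : IsOpen V)
    (hG : ContDiffOn ℝ ∞ G (Set.Ico 0 δ ×ˢ V)) {y : ℝ → ℝ}
    (hy : ContinuousOn y (Set.Ico 0 δ)) (hyV : ∀ t ∈ Set.Ico 0 δ, y t ∈ V)
    (hd : ∀ t ∈ Set.Ioo 0 δ, HasDerivAt y (G (t, y t) / t) t) (h0 : G (0, y 0) = 0) {g : ℝ}
    (hg : HasDerivAt (fun z => G (0, z)) g (y 0)) (hg0 : g < 0) :
    ContDiffOn ℝ ∞ y (Set.Ico 0 δ) := by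
  set S := Set.Ico 0 δ ×ˢ V with hS
  have hU : UniqueDiffOn ℝ S := uniqueDiffOn_Ico_prod hV
  have hG' : ContDiffOn ℝ ∞ (fderivWithin ℝ G S) S := hG.fderivWithin hU (by simp)
  have h0mem : (0:ℝ) ∈ Set.Ico 0 δ := ⟨le_rfl, hδ⟩
  have hle : 𝓝[>] (0:ℝ) ≤ 𝓝[Set.Ico 0 δ] 0 := by
    rw [← nhdsWithin_Ioo_eq_nhdsGT hδ]
    exact nhdsWithin_mono _ Set.Ioo_subset_Ico_self
  have hmaps : Set.MapsTo (fun t => (t, y t)) (Set.Ico 0 δ) S := fun t ht => ⟨ht, hyV t ht⟩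
  rw [contDiffOn_infty]
  intro n
  induction n with
  | zero => exact contDiffOn_zero.2 hy
  | succ n ih =>
    have hp : ContDiffOn ℝ n (fun t => (t, y t)) (Set.Ico 0 δ) := contDiffOn_id.prodMk ih
    have hF : ContDiffOn ℝ n (fun t => fderivWithin ℝ G S (t, y t)) (Set.Ico 0 δ) :=
      (hG'.of_le (by exact_mod_cast le_top)).comp hp hmaps
    have ha : ContDiffOn ℝ n (fun t => fderivWithin ℝ G S (t, y t) (0, 1) - 1) (Set.Ico 0 δ) :=
      (hF.clm_apply contDiffOn_const).sub contDiffOn_const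
    have hb : ContDiffOn ℝ n (fun t => fderivWithin ℝ G S (t, y t) (1, 0)) (Set.Ico 0 δ) :=
      hF.clm_apply contDiffOn_const
    have hg1 : fderivWithin ℝ G S (0, y 0) (0, 1) = g :=
      (hasDerivAt_snd hV hG h0mem (hyV 0 h0mem)).unique hg
    have key := contDiffOn_of_singular_linear (u := fun t => G (t, y t) / t) hδ n ha hb
      (by rw [hg1]; linarith) ?_ ?_
    · refine contDiffOn_Ico_succ hδ hy (fun t ht => ?_) key
      rw [Function.update_of_ne ht.1.ne']
      exact hd t ht
    · intro t ht
      have hm := hmaps (Set.Ioo_subset_Ico_self ht)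
      have h1 := (hG.differentiableOn (by simp) (t, y t) hm).hasFDerivWithinAt
      have hn : S ∈ 𝓝 (t, y t) := prod_mem_nhds (mem_nhds_Ico_zero ht) (hV.mem_nhds hm.2)
      have h2 := (h1.hasFDerivAt hn).comp_hasDerivAt t ((hasDerivAt_id t).prodMk (hd t ht))
      have h3 := h2.div (hasDerivAt_id t) ht.1.ne'
      refine h3.congr_deriv ?_
      have e : ((1:ℝ), G (t, y t) / t) = (1, 0) + (G (t, y t) / t) • ((0:ℝ), (1:ℝ)) := by simp
      rw [e, map_add, map_smul]
      simp only [id, Function.comp, smul_eq_mul]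
      have := ht.1.ne'
      field_simp
      ring
    · have h1 : Tendsto (fun t => G (t, y t)) (𝓝[>] 0) (𝓝 0) := by
        have := (hG.continuousOn.comp (continuousOn_id.prodMk hy) hmaps) 0 h0mem
        have h2 : Tendsto (fun t => G (t, y t)) (𝓝[>] 0) (𝓝 (G (0, y 0))) := this.mono_left hle
        rwa [h0] at h2
      refine h1.congr' ?_
      filter_upwards [self_mem_nhdsWithin] with t ht
      have : t ≠ 0 := ne_of_gt ht
      field_simp

/-- Near the singular point, `y ↦ G(t,y) + y` is a contraction. -/
theorem singular_contraction (hδ : 0 < δ) (hV : IsOpen V)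
    (hG : ContDiffOn ℝ ∞ G (Set.Ico 0 δ ×ˢ V)) {y₀ g : ℝ} (hy₀ : y₀ ∈ V)
    (hg : HasDerivAt (fun z => G (0, z)) g y₀) (hg0 : g < 0) (hg2 : -2 < g) :
    ∃ δ₁ > 0, δ₁ < δ ∧ ∃ η > 0, Metric.closedBall y₀ η ⊆ V ∧ ∃ c : ℝ, 0 ≤ c ∧ c < 1 ∧
      ∀ t ∈ Set.Icc 0 δ₁, ∀ a ∈ Metric.closedBall y₀ η, ∀ b ∈ Metric.closedBall y₀ η,
        |(G (t, a) + a) - (G (t, b) + b)| ≤ c * |a - b| := by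
  set S := Set.Ico 0 δ ×ˢ V with hS
  have hU : UniqueDiffOn ℝ S := uniqueDiffOn_Ico_prod hV
  have hG' : ContDiffOn ℝ ∞ (fderivWithin ℝ G S) S := hG.fderivWithin hU (by simp)
  have h0mem : (0:ℝ) ∈ Set.Ico 0 δ := ⟨le_rfl, hδ⟩
  have hg1 : fderivWithin ℝ G S (0, y₀) (0, 1) = g := (hasDerivAt_snd hV hG h0mem hy₀).unique hg
  -- The derivative of y ↦ G(t, y) + y at the singular point is g + 1, and -2 < g < 0 makes its
  -- absolute value less than 1.
  obtain ⟨c, hc1, hc2⟩ := exists_between (show |g + 1| < 1 by rw [abs_lt]; constructor <;> linarith)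
  have hcw : ContinuousWithinAt (fun p => |fderivWithin ℝ G S p (0, 1) + 1|) S (0, y₀) :=
    (((hG'.continuousOn (0, y₀) ⟨h0mem, hy₀⟩).clm_apply continuousWithinAt_const).add
      continuousWithinAt_const).abs
  have hev : ∀ᶠ p in 𝓝[S] (0, y₀), |fderivWithin ℝ G S p (0, 1) + 1| < c :=
    hcw.eventually_lt_const (by simpa only [hg1] using hc1)
  rw [hS, nhdsWithin_prod_eq] at hev
  rw [hV.nhdsWithin_eq hy₀] at hev
  obtain ⟨P, hP, Q, hQ, hPQ⟩ := eventually_prod_iff.1 hev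
  obtain ⟨ε₁, hε₁, hB₁⟩ := Metric.nhdsWithin_basis_ball.eventually_iff.1 hP
  obtain ⟨ε₂, hε₂, hB₂⟩ := Metric.nhds_basis_closedBall.eventually_iff.1
    (hQ.and (hV.mem_nhds hy₀))
  refine ⟨min (ε₁ / 2) (δ / 2), by positivity, (min_le_right _ _).trans_lt (by linarith), ε₂, hε₂,
    fun z hz => (hB₂ hz).2, c, (abs_nonneg _).trans hc1.le, hc2, ?_⟩
  intro t ht a ha b hb
  have ht1 : t ∈ Set.Ico 0 δ := ⟨ht.1, (ht.2.trans (min_le_right _ _)).trans_lt (by linarith)⟩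
  have ht2 : P t := hB₁ ⟨by
    rw [Metric.mem_ball, Real.dist_eq, sub_zero, abs_of_nonneg ht.1]
    exact (ht.2.trans (min_le_left _ _)).trans_lt (by linarith), ht1⟩
  have := (convex_closedBall y₀ ε₂).norm_image_sub_le_of_norm_hasDerivWithin_le
    (f := fun z => G (t, z) + z) (f' := fun z => fderivWithin ℝ G S (t, z) (0, 1) + 1) (C := c)
    (fun z hz => ((hasDerivAt_snd hV hG ht1 (hB₂ hz).2).add (hasDerivAt_id z)).hasDerivWithinAt)
    (fun z hz => (hPQ ht2 (hB₂ hz).1).le) hb ha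
  simpa [Real.norm_eq_abs] using this

/-- The contraction property of G + id makes G itself decreasing in y. This is the sign condition
that turns two solutions into one via `eq_zero_of_mul_deriv_nonpos`. -/
theorem contraction_monotone {c a b A B : ℝ} (hc : c < 1)
    (h : |(A + a) - (B + b)| ≤ c * |a - b|) : (a - b) * (A - B) ≤ 0 := by
  have h1 : (a - b) * ((A + a) - (B + b)) ≤ |a - b| * (c * |a - b|) :=
    (le_abs_self _).trans (by rw [abs_mul]; gcongr)
  have h2 : |a - b| * |a - b| = (a - b) * (a - b) := abs_mul_abs_self _
  nlinarith [mul_self_nonneg (a - b)]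

open scoped BoundedContinuousFunction in
/-- Existence for singular integral equations. -/
theorem exists_integral_fixedPoint {R : ℝ × ℝ → ℝ} (hR : Continuous R) {M c : ℝ}
    (hM : ∀ p, |R p| ≤ M) (hc0 : 0 ≤ c) (hc : c < 1)
    (hL : ∀ t a b, |R (t, a) - R (t, b)| ≤ c * |a - b|) :
    ∃ y : ℝ → ℝ, Continuous y ∧ ∀ t, y t = ∫ σ in (0:ℝ)..1, R (σ * t, y (σ * t)) := by
  have hcont : ∀ y : ℝ →ᵇ ℝ, Continuous (Function.uncurry fun t σ => R (σ * t, y (σ * t))) := by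
    intro y
    have := y.continuous
    fun_prop
  -- The equation (t y)' = R(t, y), integrated from 0, reads t y(t) = ∫₀ᵗ R. Rescaling to [0,1]
  -- removes the division by t, so this operator is contracting with the constant c of R.
  let A : (ℝ →ᵇ ℝ) → (ℝ →ᵇ ℝ) := fun y =>
    BoundedContinuousFunction.ofNormedAddCommGroup
      (fun t => ∫ σ in (0:ℝ)..1, R (σ * t, y (σ * t)))
      (intervalIntegral.continuous_parametric_intervalIntegral_of_continuous' (hcont y) 0 1) M
      (by
        intro t
        have := intervalIntegral.norm_integral_le_of_norm_le_const (a := (0:ℝ)) (b := 1) (C := M)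
          (f := fun σ => R (σ * t, y (σ * t))) (fun σ _ => hM _)
        simpa using this)
  have hA : ContractingWith ⟨c, hc0⟩ A := by
    refine ⟨by exact_mod_cast hc, LipschitzWith.of_dist_le_mul fun y z => ?_⟩
    rw [BoundedContinuousFunction.dist_le (by positivity)]
    intro t
    have hi : ∀ y : ℝ →ᵇ ℝ, IntervalIntegrable (fun σ => R (σ * t, y (σ * t)))
        MeasureTheory.volume 0 1 := fun y =>
      ((hcont y).comp (Continuous.prodMk_right t)).intervalIntegrable _ _
    change dist (∫ σ in (0:ℝ)..1, R (σ * t, y (σ * t))) (∫ σ in (0:ℝ)..1, R (σ * t, z (σ * t))) ≤ _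
    rw [dist_eq_norm, ← intervalIntegral.integral_sub (hi y) (hi z)]
    have := intervalIntegral.norm_integral_le_of_norm_le_const (a := (0:ℝ)) (b := 1)
      (C := c * dist y z) (f := fun σ => R (σ * t, y (σ * t)) - R (σ * t, z (σ * t)))
      (fun σ _ => by
        refine (hL _ _ _).trans ?_
        gcongr
        exact y.dist_coe_le_dist (σ * t))
    rw [sub_zero, abs_one, mul_one] at this
    exact this
  refine ⟨hA.fixedPoint, (hA.fixedPoint).continuous, fun t => ?_⟩
  have := hA.fixedPoint_isFixedPt
  conv_lhs => rw [← this]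
  rfl

/-- Local solution of a singular equation, smooth up to the singular point. -/
theorem singular_exists (hδ : 0 < δ) (hV : IsOpen V)
    (hG : ContDiffOn ℝ ∞ G (Set.Ico 0 δ ×ˢ V)) {y₀ g : ℝ} (hy₀ : y₀ ∈ V) (h0 : G (0, y₀) = 0)
    (hg : HasDerivAt (fun z => G (0, z)) g y₀) (hg0 : g < 0) (hg2 : -2 < g) :
    ∃ δ' > 0, δ' ≤ δ ∧ ∃ y : ℝ → ℝ, y 0 = y₀ ∧ (∀ t ∈ Set.Ico 0 δ', y t ∈ V) ∧
      ContDiffOn ℝ ∞ y (Set.Ico 0 δ') ∧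
      ∀ t ∈ Set.Ioo 0 δ', HasDerivAt y (G (t, y t) / t) t := by
  obtain ⟨δ₁, hδ₁, hδ₁δ, η, hη, hηV, c, hc0, hc1, hL⟩ :=
    singular_contraction hδ hV hG hy₀ hg hg0 hg2
  -- Clamping both variables to the rectangle of the contraction estimate makes R bounded and
  -- Lipschitz in y on the whole plane. The clamps do nothing on the rectangle itself, so the fixed
  -- point solves the original equation near t = 0.
  let ct : ℝ → ℝ := fun t => max 0 (min t δ₁)
  let cy : ℝ → ℝ := fun y => max (y₀ - η) (min y (y₀ + η))
  have hct : ∀ t, ct t ∈ Set.Icc 0 δ₁ := fun t =>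
    ⟨le_max_left _ _, max_le hδ₁.le (min_le_right _ _)⟩
  have hcy : ∀ y, cy y ∈ Metric.closedBall y₀ η := fun y => by
    rw [Real.closedBall_eq_Icc]
    exact ⟨le_max_left _ _, max_le (by linarith) (min_le_right _ _)⟩
  have hct' : ∀ t ∈ Set.Icc 0 δ₁, ct t = t := fun t ht => by
    simp only [ct]; rw [min_eq_left ht.2, max_eq_right ht.1]
  have hcy' : ∀ y ∈ Metric.closedBall y₀ η, cy y = y := fun y hy => by
    rw [Real.closedBall_eq_Icc] at hy
    simp only [cy]; rw [min_eq_left hy.2, max_eq_right hy.1]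
  have hcyL : ∀ a b, |cy a - cy b| ≤ |a - b| := fun a b => by
    refine (abs_max_sub_max_le_max _ _ _ _).trans ?_
    rw [sub_self, abs_zero, max_eq_right (abs_nonneg _)]
    refine (abs_min_sub_min_le_max _ _ _ _).trans ?_
    rw [sub_self, abs_zero, max_eq_left (abs_nonneg _)]
  let R : ℝ × ℝ → ℝ := fun p => G (ct p.1, cy p.2) + cy p.2
  have hsub : Set.Icc 0 δ₁ ×ˢ Metric.closedBall y₀ η ⊆ Set.Ico 0 δ ×ˢ V :=
    Set.prod_mono (fun t ht => ⟨ht.1, ht.2.trans_lt hδ₁δ⟩) hηV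
  have hcc : Continuous (fun p : ℝ × ℝ => (ct p.1, cy p.2)) := by fun_prop
  have hmp : ∀ p : ℝ × ℝ, (ct p.1, cy p.2) ∈ Set.Icc 0 δ₁ ×ˢ Metric.closedBall y₀ η :=
    fun p => ⟨hct _, hcy _⟩
  have hGc : ContinuousOn (fun p : ℝ × ℝ => G p + p.2) (Set.Icc 0 δ₁ ×ˢ Metric.closedBall y₀ η) :=
    (hG.continuousOn.mono hsub).add continuousOn_snd
  have hRc : Continuous R := hGc.comp_continuous hcc hmp
  obtain ⟨M, hM⟩ := (isCompact_Icc.prod (isCompact_closedBall y₀ η)).exists_bound_of_continuousOn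
    hGc
  obtain ⟨y, hyc, hy⟩ := exists_integral_fixedPoint hRc (M := M) (c := c)
    (fun p => hM _ (hmp p)) hc0 hc1 (fun t a b =>
      (hL _ (hct t) _ (hcy a) _ (hcy b)).trans (mul_le_mul_of_nonneg_left (hcyL a b) hc0))
  have hy0 : y 0 = y₀ := by
    have h1 : y 0 = R (0, y 0) := by
      have := hy 0
      simpa using this
    have hm : y₀ ∈ Metric.closedBall y₀ η := Metric.mem_closedBall_self hη.le
    have h2 : R (0, y₀) = y₀ := by
      simp only [R]
      rw [hct' 0 ⟨le_rfl, hδ₁.le⟩, hcy' _ hm, h0, zero_add]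
    -- At t = 0 the integral equation says that y 0 is a fixed point of R(0, ·); so is y₀, and c < 1
    -- leaves only one.
    have h3 : |y 0 - y₀| ≤ c * |y 0 - y₀| := by
      conv_lhs => rw [h1, ← h2]
      exact (hL _ (hct 0) _ (hcy _) _ (hcy _)).trans (mul_le_mul_of_nonneg_left (hcyL _ _) hc0)
    have h4 : |y 0 - y₀| = 0 := by nlinarith [abs_nonneg (y 0 - y₀)]
    linarith [abs_eq_zero.1 h4]
  have hev : ∀ᶠ t in 𝓝 0, y t ∈ Metric.ball y₀ η := by
    refine hyc.continuousAt.eventually_mem ?_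
    rw [hy0]
    exact Metric.ball_mem_nhds _ hη
  obtain ⟨ε, hε, hB⟩ := Metric.eventually_nhds_iff.1 hev
  have hyb : ∀ t ∈ Set.Ico 0 (min ε δ₁), y t ∈ Metric.closedBall y₀ η := fun t ht =>
    Metric.ball_subset_closedBall (hB (by
      rw [Real.dist_eq, sub_zero, abs_of_nonneg ht.1]; exact ht.2.trans_le (min_le_left _ _)))
  have hder : ∀ t ∈ Set.Ioo 0 (min ε δ₁), HasDerivAt y (G (t, y t) / t) t := by
    intro t ht
    have hgen : ∀ s, s ≠ 0 → y s = (∫ τ in (0:ℝ)..s, R (τ, y τ)) / s := by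
      intro s hs
      rw [hy s, intervalIntegral.integral_comp_mul_right (fun τ => R (τ, y τ)) hs]
      simp [div_eq_inv_mul]
    have hcR : Continuous fun τ => R (τ, y τ) := hRc.comp (continuous_id.prodMk hyc)
    have h1 : HasDerivAt (fun s => ∫ τ in (0:ℝ)..s, R (τ, y τ)) (R (t, y t)) t :=
      intervalIntegral.integral_hasDerivAt_right (hcR.intervalIntegrable _ _)
        (hcR.stronglyMeasurableAtFilter _ _) hcR.continuousAt
    have h2 := h1.div (hasDerivAt_id t) ht.1.ne'
    have h3 : HasDerivAt y ((R (t, y t) * id t - (∫ τ in (0:ℝ)..t, R (τ, y τ)) * 1) / id t ^ 2) t :=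
      h2.congr_of_eventuallyEq (by
        filter_upwards [isOpen_ne.mem_nhds ht.1.ne'] with s hs using hgen s hs)
    refine h3.congr_deriv ?_
    have h4 : (∫ τ in (0:ℝ)..t, R (τ, y τ)) = t * y t := by
      rw [hgen t ht.1.ne']; field_simp [ht.1.ne']
    have h5 : R (t, y t) = G (t, y t) + y t := by
      simp only [R]
      rw [hct' t ⟨ht.1.le, ht.2.le.trans (min_le_right _ _)⟩, hcy' _ (hyb t ⟨ht.1.le, ht.2⟩)]
    rw [h4, h5]
    have := ht.1.ne'
    simp only [id]
    field_simp
    ring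
  have hpos : 0 < min ε δ₁ := by positivity
  have hle : min ε δ₁ ≤ δ := (min_le_right _ _).trans hδ₁δ.le
  have hmV : ∀ t ∈ Set.Ico 0 (min ε δ₁), y t ∈ V := fun t ht => hηV (hyb t ht)
  refine ⟨min ε δ₁, hpos, hle, y, hy0, hmV, ?_, hder⟩
  exact singular_contDiffOn hpos hV (hG.mono (Set.prod_mono (Set.Ico_subset_Ico_right hle) le_rfl))
    hyc.continuousOn hmV hder (by rw [hy0]; exact h0) (by rw [hy0]; exact hg) hg0

end Singular

/-! ## Geometry of rotational maps away from the axis -/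

theorem mink_add_left (p q v : L4) : mink (p + q) v = mink p v + mink q v := by
  simp [mink]; ring

theorem mink_smul_left (a : ℝ) (p v : L4) : mink (a • p) v = a * mink p v := by
  simp [mink]; ring

theorem mink_comm (p v : L4) : mink p v = mink v p := by
  simp [mink]; ring

theorem mink_add_right (p q v : L4) : mink v (p + q) = mink v p + mink v q := by
  simp [mink]; ring

theorem mink_smul_right (a : ℝ) (p v : L4) : mink v (a • p) = a * mink v p := by
  simp [mink]; ring

theorem continuous_mink : Continuous fun p : L4 × L4 => mink p.1 p.2 := by
  unfold mink; fun_prop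

/-- The unit horizontal vector pointing away from the axis. -/
def eRad (ρ : ℝ) (u : ℂ) : L4 :=
  ![Real.sinh ρ, Real.cosh ρ * u.re, Real.cosh ρ * u.im, 0]

/-- The unit vector tangent to the parallels. -/
def eAng (u : ℂ) : L4 := ![0, -u.im, u.re, 0]

/-- The unit vertical vector. -/
def eVert : L4 := ![0, 0, 0, 1]

theorem re_sq_add_im_sq {u : ℂ} (hu : ‖u‖ = 1) : u.re ^ 2 + u.im ^ 2 = 1 := by
  have h : u.re ^ 2 + u.im ^ 2 = ‖u‖ ^ 2 := by
    rw [← Complex.normSq_eq_norm_sq, Complex.normSq_apply]; ring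
  rw [h, hu, one_pow]

variable {r h : ℝ → ℝ}

theorem rotMap_ray {u : ℂ} (hu : ‖u‖ = 1) {t : ℝ} (ht : 0 < t) :
    rotMap r h ((t : ℂ) * u) =
      ![Real.cosh (r t), Real.sinh (r t) * u.re, Real.sinh (r t) * u.im, h t] := by
  have h1 : ‖(t : ℂ) * u‖ = t := by
    rw [norm_mul, hu, mul_one, Complex.norm_real, Real.norm_eq_abs, abs_of_pos ht]
  have h2 : t ≠ 0 := ht.ne'
  simp only [rotMap, h1]
  simp [h2]

theorem norm_real_mul {u : ℂ} (hu : ‖u‖ = 1) {t : ℝ} (ht : 0 ≤ t) : ‖(t : ℂ) * u‖ = t := by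
  rw [norm_mul, hu, mul_one, Complex.norm_real, Real.norm_eq_abs, abs_of_nonneg ht]

theorem contDiffAt_rotMap {z : ℂ} (hz : z ≠ 0) (hr : ContDiffAt ℝ ∞ r ‖z‖)
    (hh : ContDiffAt ℝ ∞ h ‖z‖) : ContDiffAt ℝ ∞ (rotMap r h) z := by
  have hn : ContDiffAt ℝ ∞ (fun z : ℂ => ‖z‖) z := contDiffAt_norm ℝ hz
  have hr' : ContDiffAt ℝ ∞ (fun z : ℂ => r ‖z‖) z := hr.comp z hn
  have hh' : ContDiffAt ℝ ∞ (fun z : ℂ => h ‖z‖) z := hh.comp z hn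
  have hre : ContDiffAt ℝ ∞ (fun z : ℂ => z.re) z := Complex.reCLM.contDiff.contDiffAt
  have him : ContDiffAt ℝ ∞ (fun z : ℂ => z.im) z := Complex.imCLM.contDiff.contDiffAt
  have hz' : ‖z‖ ≠ 0 := norm_ne_zero_iff.2 hz
  rw [contDiffAt_pi]
  intro i
  fin_cases i
  · exact hr'.cosh
  · exact hr'.sinh.mul (hre.div hn hz')
  · exact hr'.sinh.mul (him.div hn hz')
  · exact hh'

/-- On the positive real axis the second coordinate of the surface is sinh r, so r is recovered by
`arsinh`, and h is the last coordinate. -/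
theorem contDiffAt_profile {s : ℝ} (hs : 0 < s) (hX : ContDiffAt ℝ ∞ (rotMap r h) (s : ℂ)) :
    ContDiffAt ℝ ∞ r s ∧ ContDiffAt ℝ ∞ h s := by
  have hc : ContDiffAt ℝ ∞ (fun t : ℝ => rotMap r h (t : ℂ)) s :=
    ContDiffAt.comp s hX Complex.ofRealCLM.contDiff.contDiffAt
  have he : ∀ᶠ t : ℝ in 𝓝 s, rotMap r h (t : ℂ) =
      ![Real.cosh (r t), Real.sinh (r t) * (1:ℂ).re, Real.sinh (r t) * (1:ℂ).im, h t] := by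
    filter_upwards [lt_mem_nhds hs] with t ht
    have := rotMap_ray (r := r) (h := h) (u := 1) (by simp) ht
    rwa [mul_one] at this
  rw [contDiffAt_pi] at hc
  constructor
  · refine ((hc 1).arsinh).congr_of_eventuallyEq ?_
    filter_upwards [he] with t ht
    simp [ht]
  · refine (hc 3).congr_of_eventuallyEq ?_
    filter_upwards [he] with t ht
    simp [ht]

theorem hasDerivAt_comp_path {E : Type*} [NormedAddCommGroup E] [NormedSpace ℝ E] {F : ℂ → E}
    {F' : ℂ →L[ℝ] E} {c : ℝ → ℂ} {c' : ℂ} {s : ℝ} (hF : HasFDerivAt F F' (c s))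
    (hc : HasDerivAt c c' s) : HasDerivAt (fun t => F (c t)) (F' c') s :=
  hF.comp_hasDerivAt s hc

/-! ### First derivatives along rays and circles -/

section Derivatives

variable {u : ℂ} {s : ℝ}

theorem hasDerivAt_ray (u : ℂ) (s : ℝ) : HasDerivAt (fun t : ℝ => (t : ℂ) * u) u s := by
  simpa using (Complex.ofRealCLM.hasDerivAt (x := s)).mul_const u

theorem fderiv_rotMap_radial (hu : ‖u‖ = 1) (hs : 0 < s)
    (hX : DifferentiableAt ℝ (rotMap r h) ((s : ℂ) * u))
    {r₁ h₁ : ℝ} (hr : HasDerivAt r r₁ s) (hh : HasDerivAt h h₁ s) :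
    fderiv ℝ (rotMap r h) ((s : ℂ) * u) u = r₁ • eRad (r s) u + h₁ • eVert := by
  have h1 : HasDerivAt (fun t : ℝ => rotMap r h ((t : ℂ) * u)) _ s :=
    hasDerivAt_comp_path (c := fun t : ℝ => (t : ℂ) * u) hX.hasFDerivAt (hasDerivAt_ray u s)
  have h2 : HasDerivAt (fun t : ℝ => rotMap r h ((t : ℂ) * u))
      (r₁ • eRad (r s) u + h₁ • eVert) s := by
    have h3 : HasDerivAt (fun t : ℝ =>
        (![Real.cosh (r t), Real.sinh (r t) * u.re, Real.sinh (r t) * u.im, h t] : L4))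
        (r₁ • eRad (r s) u + h₁ • eVert) s := by
      rw [hasDerivAt_pi]
      intro i
      fin_cases i
      · simpa [eRad, eVert, mul_comm] using hr.cosh
      · simpa [eRad, eVert, mul_comm, mul_left_comm, mul_assoc] using hr.sinh.mul_const u.re
      · simpa [eRad, eVert, mul_comm, mul_left_comm, mul_assoc] using hr.sinh.mul_const u.im
      · simpa [eRad, eVert] using hh
    refine h3.congr_of_eventuallyEq ?_
    filter_upwards [lt_mem_nhds hs] with t ht using rotMap_ray hu ht
  exact h1.unique h2

theorem hasDerivAt_circle (u : ℂ) (s : ℝ) :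
    HasDerivAt (fun α : ℝ => (s : ℂ) * (Complex.exp (α * Complex.I) * u))
    ((s : ℂ) * (Complex.I * u)) 0 := by
  have h1 : HasDerivAt (fun α : ℝ => Complex.exp (α * Complex.I)) Complex.I 0 := by
    have := ((Complex.ofRealCLM.hasDerivAt (x := (0:ℝ))).mul_const Complex.I).cexp
    simpa using this
  exact (h1.mul_const u).const_mul (s : ℂ)

theorem fderiv_rotMap_angular (hu : ‖u‖ = 1) (hs : 0 < s)
    (hX : DifferentiableAt ℝ (rotMap r h) ((s : ℂ) * u)) :
    fderiv ℝ (rotMap r h) ((s : ℂ) * u) (Complex.I * u) = (Real.sinh (r s) / s) • eAng u := by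
  have hc := hasDerivAt_circle u s
  have h1 : HasDerivAt (fun α : ℝ => rotMap r h ((s : ℂ) * (Complex.exp (α * Complex.I) * u))) _ 0 :=
    hasDerivAt_comp_path (c := fun α : ℝ => (s : ℂ) * (Complex.exp (α * Complex.I) * u))
      (F' := fderiv ℝ (rotMap r h) ((s : ℂ) * u)) (by
        have e : (s : ℂ) * (Complex.exp ((0 : ℝ) * Complex.I) * u) = s * u := by simp
        simp only [e]
        exact hX.hasFDerivAt) hc
  have hcs : HasDerivAt (fun α : ℝ => Complex.exp (α * Complex.I) * u) (Complex.I * u) 0 := by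
    have := ((Complex.ofRealCLM.hasDerivAt (x := (0:ℝ))).mul_const Complex.I).cexp
    simpa using this.mul_const u
  have hre : HasDerivAt (fun α : ℝ => (Complex.exp (α * Complex.I) * u).re) (-u.im) 0 :=
    (hasDerivAt_comp_path Complex.reCLM.hasFDerivAt hcs).congr_deriv (by simp)
  have him : HasDerivAt (fun α : ℝ => (Complex.exp (α * Complex.I) * u).im) (u.re) 0 :=
    (hasDerivAt_comp_path Complex.imCLM.hasFDerivAt hcs).congr_deriv (by simp)
  have h2 : HasDerivAt (fun α : ℝ => rotMap r h ((s : ℂ) * (Complex.exp (α * Complex.I) * u)))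
      (Real.sinh (r s) • eAng u) 0 := by
    have h3 : (fun α : ℝ => rotMap r h ((s : ℂ) * (Complex.exp (α * Complex.I) * u))) =
        fun α : ℝ => ![Real.cosh (r s), Real.sinh (r s) * (Complex.exp (α * Complex.I) * u).re,
          Real.sinh (r s) * (Complex.exp (α * Complex.I) * u).im, h s] := by
      funext α
      exact rotMap_ray (by rw [norm_mul, Complex.norm_exp_ofReal_mul_I, hu, one_mul]) hs
    rw [h3, hasDerivAt_pi]
    intro i
    fin_cases i
    · simpa [eAng] using hasDerivAt_const (0:ℝ) (Real.cosh (r s))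
    · simpa [eAng] using hre.const_mul (Real.sinh (r s))
    · simpa [eAng] using him.const_mul (Real.sinh (r s))
    · simpa [eAng] using hasDerivAt_const (0:ℝ) (h s)
  have h4 := h1.unique h2
  -- The circle of radius s has velocity s · iu, which accounts for the division by s in the
  -- statement.
  have h5 : (s : ℂ) * (Complex.I * u) = s • (Complex.I * u) := by simp
  rw [h5, map_smul] at h4
  rw [div_eq_inv_mul, mul_smul, ← h4, smul_smul, inv_mul_cancel₀ hs.ne', one_smul]

end Derivatives

/-- The second derivative as a bilinear map. -/
theorem hasFDerivAt_fderiv_apply {X : ℂ → L4} {z : ℂ} (hX : ContDiffAt ℝ ∞ X z) (w : ℂ) :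
    HasFDerivAt (fun y => fderiv ℝ X y w) ((fderiv ℝ (fderiv ℝ X) z).flip w) z := by
  have h1 : ContDiffAt ℝ 1 (fderiv ℝ X) z := hX.fderiv_right (by norm_cast)
  have h2 := (h1.differentiableAt (by simp)).hasFDerivAt
  exact h2.clm_apply (hasFDerivAt_const w z) |>.congr_fderiv (by ext; simp)

theorem secondForm_eq {X : ℂ → L4} {N : L4} {z : ℂ} (hX : ContDiffAt ℝ ∞ X z) (v w : ℂ) :
    secondForm X N z v w = mink (fderiv ℝ (fderiv ℝ X) z v w) N := by
  rw [secondForm, (hasFDerivAt_fderiv_apply hX w).fderiv]; rfl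

theorem eventually_contDiffAt_rotMap {z : ℂ} (hX : ContDiffAt ℝ ∞ (rotMap r h) z) (n : ℕ) :
    ∀ᶠ y in 𝓝 z, ContDiffAt ℝ n (rotMap r h) y :=
  (hX.of_le (m := (n : WithTop ℕ∞)) (by exact_mod_cast le_top)).eventually (by simp)

/-! ### Second derivatives along rays and circles -/

section SecondDerivatives

variable {u : ℂ} {s : ℝ}

theorem eventually_hasDerivAt_profile (hs : 0 < s)
    (hX : ContDiffAt ℝ ∞ (rotMap r h) (s : ℂ)) :
    (∀ᶠ t in 𝓝 s, HasDerivAt r (deriv r t) t ∧ HasDerivAt h (deriv h t) t) ∧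
    HasDerivAt (deriv r) (deriv (deriv r) s) s ∧ HasDerivAt (deriv h) (deriv (deriv h) s) s := by
  obtain ⟨hr, hh⟩ := contDiffAt_profile hs hX
  have key : ∀ {f : ℝ → ℝ}, ContDiffAt ℝ ∞ f s → (∀ᶠ t in 𝓝 s, HasDerivAt f (deriv f t) t) ∧
      HasDerivAt (deriv f) (deriv (deriv f) s) s := by
    intro f hf
    refine ⟨?_, ?_⟩
    · have h1 : ∀ᶠ t in 𝓝 s, ContDiffAt ℝ 1 f t :=
        (hf.of_le (by norm_cast)).eventually (by simp)
      filter_upwards [h1] with t ht using (ht.differentiableAt (by simp)).hasDerivAt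
    · have h1 : ContDiffAt ℝ 1 (deriv f) s := by
        have := hf.fderiv_right (m := 1) (by norm_cast)
        exact this.clm_apply contDiffAt_const
      exact (h1.differentiableAt (by simp)).hasDerivAt
  exact ⟨(key hr).1.and (key hh).1, (key hr).2, (key hh).2⟩

theorem fderiv2_rotMap_radial_radial (hu : ‖u‖ = 1) (hs : 0 < s)
    (hX : ContDiffAt ℝ ∞ (rotMap r h) ((s : ℂ) * u))
    (hX1 : ContDiffAt ℝ ∞ (rotMap r h) (s : ℂ)) :
    fderiv ℝ (fderiv ℝ (rotMap r h)) ((s : ℂ) * u) u u =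
      deriv (deriv r) s • eRad (r s) u + (deriv r s) ^ 2 •
        ![Real.cosh (r s), Real.sinh (r s) * u.re, Real.sinh (r s) * u.im, 0] +
      deriv (deriv h) s • eVert := by
  obtain ⟨he, hr2, hh2⟩ := eventually_hasDerivAt_profile hs hX1
  have h1 : HasDerivAt (fun t : ℝ => fderiv ℝ (rotMap r h) ((t : ℂ) * u) u) _ s :=
    hasDerivAt_comp_path (c := fun t : ℝ => (t : ℂ) * u) (hasFDerivAt_fderiv_apply hX u)
      (hasDerivAt_ray u s)
  have hX' : ∀ᶠ t : ℝ in 𝓝 s, ContDiffAt ℝ (1 : ℕ) (rotMap r h) ((t : ℂ) * u) :=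
    (hasDerivAt_ray u s).continuousAt.eventually (eventually_contDiffAt_rotMap hX 1)
  have h2 : HasDerivAt (fun t : ℝ => fderiv ℝ (rotMap r h) ((t : ℂ) * u) u)
      (deriv (deriv r) s • eRad (r s) u + (deriv r s) ^ 2 •
        ![Real.cosh (r s), Real.sinh (r s) * u.re, Real.sinh (r s) * u.im, 0] +
      deriv (deriv h) s • eVert) s := by
    have h3 : HasDerivAt (fun t : ℝ => deriv r t • eRad (r t) u + deriv h t • eVert)
        (deriv (deriv r) s • eRad (r s) u + (deriv r s) ^ 2 •
          ![Real.cosh (r s), Real.sinh (r s) * u.re, Real.sinh (r s) * u.im, 0] +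
        deriv (deriv h) s • eVert) s := by
      have hr1 := he.self_of_nhds.1
      rw [hasDerivAt_pi]
      intro i
      fin_cases i
      · have := hr2.mul hr1.sinh
        simp [eRad, eVert]
        refine this.congr_deriv (by ring)
      · have := hr2.mul (hr1.cosh.mul_const u.re)
        simp [eRad, eVert]
        refine this.congr_deriv (by ring)
      · have := hr2.mul (hr1.cosh.mul_const u.im)
        simp [eRad, eVert]
        refine this.congr_deriv (by ring)
      · simpa [eRad, eVert] using hh2
    refine h3.congr_of_eventuallyEq ?_
    filter_upwards [lt_mem_nhds hs, hX', he] with t ht hXt het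
    exact fderiv_rotMap_radial hu ht (hXt.differentiableAt (by simp)) het.1 het.2
  exact h1.unique h2

/-- Along a ray the angular derivative keeps the fixed direction `eAng u`; only its length varies.
The coefficient is irrelevant, since `eAng u` is tangent and the mixed term of the second form
vanishes. -/
theorem fderiv2_rotMap_radial_angular (hu : ‖u‖ = 1) (hs : 0 < s)
    (hX : ContDiffAt ℝ ∞ (rotMap r h) ((s : ℂ) * u))
    (hX1 : ContDiffAt ℝ ∞ (rotMap r h) (s : ℂ)) :
    ∃ a : ℝ, fderiv ℝ (fderiv ℝ (rotMap r h)) ((s : ℂ) * u) u (Complex.I * u) = a • eAng u := by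
  obtain ⟨he, hr2, hh2⟩ := eventually_hasDerivAt_profile hs hX1
  have h1 : HasDerivAt (fun t : ℝ => fderiv ℝ (rotMap r h) ((t : ℂ) * u) (Complex.I * u)) _ s :=
    hasDerivAt_comp_path (c := fun t : ℝ => (t : ℂ) * u)
      (hasFDerivAt_fderiv_apply hX (Complex.I * u)) (hasDerivAt_ray u s)
  have hX' : ∀ᶠ t : ℝ in 𝓝 s, ContDiffAt ℝ (1 : ℕ) (rotMap r h) ((t : ℂ) * u) :=
    (hasDerivAt_ray u s).continuousAt.eventually (eventually_contDiffAt_rotMap hX 1)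
  have h3 := ((he.self_of_nhds.1.sinh.div (hasDerivAt_id s) hs.ne').smul_const (eAng u))
  refine ⟨_, h1.unique (h3.congr_of_eventuallyEq ?_)⟩
  filter_upwards [lt_mem_nhds hs, hX'] with t ht hXt
  exact fderiv_rotMap_angular hu ht (hXt.differentiableAt (by simp))

/-- The acceleration of the circle α ↦ s e^{iα} u under the map, computed twice. The chain rule
gives the second derivative in the direction s · iu plus the first derivative along the acceleration
-s u in the plane; the explicit parallel gives a vector pointing at the axis. -/
theorem fderiv2_rotMap_angular_angular (hu : ‖u‖ = 1) (hs : 0 < s)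
    (hX : ContDiffAt ℝ ∞ (rotMap r h) ((s : ℂ) * u)) :
    s • s • fderiv ℝ (fderiv ℝ (rotMap r h)) ((s : ℂ) * u) (Complex.I * u) (Complex.I * u) =
      s • fderiv ℝ (rotMap r h) ((s : ℂ) * u) u - Real.sinh (r s) • ![0, u.re, u.im, 0] := by
  have hc := hasDerivAt_circle u s
  set c : ℝ → ℂ := fun α => (s : ℂ) * (Complex.exp (α * Complex.I) * u) with hcdef
  have hc0 : c 0 = (s : ℂ) * u := by simp [hcdef]
  have hX0 : ContDiffAt ℝ ∞ (rotMap r h) (c 0) := by rw [hc0]; exact hX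
  have h2X : HasFDerivAt (fderiv ℝ (rotMap r h)) (fderiv ℝ (fderiv ℝ (rotMap r h)) (c 0)) (c 0) :=
    ((hX0.fderiv_right (m := 1) (by norm_cast)).differentiableAt (by simp)).hasFDerivAt
  have h1 := (hasDerivAt_comp_path h2X hc).clm_apply (hc.const_mul Complex.I)
  have hX' : ∀ᶠ α : ℝ in 𝓝 0, ContDiffAt ℝ (1 : ℕ) (rotMap r h) (c α) :=
    hc.continuousAt.eventually (eventually_contDiffAt_rotMap hX0 1)
  have hcs : HasDerivAt (fun α : ℝ => Complex.exp (α * Complex.I) * u) (Complex.I * u) 0 := by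
    have := ((Complex.ofRealCLM.hasDerivAt (x := (0:ℝ))).mul_const Complex.I).cexp
    simpa using this.mul_const u
  have hre : HasDerivAt (fun α : ℝ => (Complex.exp (α * Complex.I) * u).re) (-u.im) 0 :=
    (hasDerivAt_comp_path Complex.reCLM.hasFDerivAt hcs).congr_deriv (by simp)
  have him : HasDerivAt (fun α : ℝ => (Complex.exp (α * Complex.I) * u).im) (u.re) 0 :=
    (hasDerivAt_comp_path Complex.imCLM.hasFDerivAt hcs).congr_deriv (by simp)
  have h3 : HasDerivAt (fun α : ℝ => Real.sinh (r s) • eAng (Complex.exp (α * Complex.I) * u))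
      (-(Real.sinh (r s) • ![0, u.re, u.im, 0])) 0 := by
    rw [hasDerivAt_pi]
    intro i
    fin_cases i
    · simpa [eAng] using hasDerivAt_const (0:ℝ) (0:ℝ)
    · exact (him.neg.const_mul (Real.sinh (r s))).congr_deriv (by simp)
    · exact (hre.const_mul (Real.sinh (r s))).congr_deriv (by simp)
    · simpa [eAng] using hasDerivAt_const (0:ℝ) (0:ℝ)
  have h4 := h1.unique (h3.congr_of_eventuallyEq (by
    filter_upwards [hX'] with α hα
    have hu' : ‖Complex.exp (α * Complex.I) * u‖ = 1 := by
      rw [norm_mul, Complex.norm_exp_ofReal_mul_I, hu, one_mul]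
    have := fderiv_rotMap_angular hu' hs (hα.differentiableAt (by simp))
    have e : Complex.I * c α = s • (Complex.I * (Complex.exp (α * Complex.I) * u)) := by
      simp [hcdef]; ring
    rw [e, map_smul, this, smul_smul, mul_div_cancel₀ _ hs.ne']))
  have e1 : (s : ℂ) * (Complex.I * u) = s • (Complex.I * u) := by simp
  have e2 : Complex.I * ((s : ℂ) * u) = s • (Complex.I * u) := by simp; ring
  have e3 : Complex.I * ((s : ℂ) * (Complex.I * u)) = -(s • u) := by
    have : Complex.I * ((s : ℂ) * (Complex.I * u)) = (Complex.I * Complex.I) * (s * u) := by ring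
    rw [this, Complex.I_mul_I]; simp
  rw [hc0, e3, e2, e1, map_neg, map_smul, map_smul, map_smul, smul_apply] at h4
  rw [sub_eq_add_neg, ← h4]
  abel

end SecondDerivatives

/-- The fundamental forms at `z` are diagonal in the basis `u, iu`, where `u` has length one;
`k` and `l` are the principal curvatures in the directions `u` and `iu`. -/
structure FormsAt (X : ℂ → L4) (N : L4) (z u : ℂ) (E k l : ℝ) : Prop where
  norm_u : ‖u‖ = 1
  E_pos : 0 < E
  I11 : firstForm X z u u = 1
  I12 : firstForm X z u (Complex.I * u) = 0
  I22 : firstForm X z (Complex.I * u) (Complex.I * u) = E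
  II11 : secondForm X N z u u = k
  II12 : secondForm X N z u (Complex.I * u) = 0
  II22 : secondForm X N z (Complex.I * u) (Complex.I * u) = l * E

theorem exists_decomp {u : ℂ} (hu : ‖u‖ = 1) (v : ℂ) :
    ∃ a b : ℝ, v = a • u + b • (Complex.I * u) := by
  refine ⟨(v * (starRingEnd ℂ) u).re, (v * (starRingEnd ℂ) u).im, ?_⟩
  have h1 : u * (starRingEnd ℂ) u = 1 := by
    rw [Complex.mul_conj, Complex.normSq_eq_norm_sq, hu]; simp
  have h2 := Complex.re_add_im (v * (starRingEnd ℂ) u)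
  simp only [Complex.real_smul]
  calc v = v * (u * (starRingEnd ℂ) u) := by rw [h1, mul_one]
    _ = (v * (starRingEnd ℂ) u) * u := by ring
    _ = _ := by conv_lhs => rw [← h2]
                ring

/-- Independence of u and iu over ℝ, from (a + bi) u = 0. -/
theorem basis_eq_zero {u : ℂ} (hu : ‖u‖ = 1) {a b : ℝ} (h : a • u + b • (Complex.I * u) = 0) :
    a = 0 ∧ b = 0 := by
  have hu0 : u ≠ 0 := by rintro rfl; simp at hu
  have h1 : ((a : ℂ) + b * Complex.I) * u = 0 := by
    simp only [Complex.real_smul] at h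
    linear_combination h
  have h2 := (mul_eq_zero.1 h1).resolve_right hu0
  exact ⟨by simpa using congrArg Complex.re h2, by simpa using congrArg Complex.im h2⟩

theorem firstForm_comm (X : ℂ → L4) (z v w : ℂ) : firstForm X z v w = firstForm X z w v :=
  mink_comm _ _

/-! ### Principal curvatures from diagonal fundamental forms -/

namespace FormsAt

variable {X : ℂ → L4} {N : L4} {z u : ℂ} {E k l : ℝ}

theorem firstForm_apply (F : FormsAt X N z u E k l) (a b a' b' : ℝ) :
    firstForm X z (a • u + b • (Complex.I * u)) (a' • u + b' • (Complex.I * u)) =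
      a * a' + b * b' * E := by
  have h12 := F.I12
  have h21 := F.I12
  rw [firstForm_comm] at h21
  have h11 := F.I11
  have h22 := F.I22
  simp only [firstForm] at *
  simp only [map_add, map_smul, mink_add_left, mink_add_right, mink_smul_left, mink_smul_right,
    h11, h12, h21, h22]
  ring

theorem II21 (F : FormsAt X N z u E k l) (hX : ContDiffAt ℝ ∞ X z) :
    secondForm X N z (Complex.I * u) u = 0 := by
  have hs : IsSymmSndFDerivAt ℝ X z := hX.isSymmSndFDerivAt (by simp; norm_cast)
  rw [secondForm_eq hX, hs.eq, ← secondForm_eq hX]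
  exact F.II12

theorem secondForm_apply (F : FormsAt X N z u E k l) (hX : ContDiffAt ℝ ∞ X z) (a b a' b' : ℝ) :
    secondForm X N z (a • u + b • (Complex.I * u)) (a' • u + b' • (Complex.I * u)) =
      a * a' * k + b * b' * (l * E) := by
  have h12 := F.II12
  have h21 := F.II21 hX
  have h11 := F.II11
  have h22 := F.II22
  rw [secondForm_eq hX] at *
  simp only [map_add, map_smul, _root_.add_apply, _root_.smul_apply, mink_add_left,
    mink_smul_left, h11, h12, h21, h22]
  ring

theorem principal (F : FormsAt X N z u E k l) (hX : ContDiffAt ℝ ∞ X z) :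
    ArePrincipalCurvatures X N z k l := by
  have e1 : u = (1:ℝ) • u + (0:ℝ) • (Complex.I * u) := by simp
  have e2 : Complex.I * u = (0:ℝ) • u + (1:ℝ) • (Complex.I * u) := by simp
  refine ⟨u, Complex.I * u, ?_, ?_, ?_⟩
  · rw [LinearIndependent.pair_iff]
    exact fun a b h => basis_eq_zero F.norm_u h
  · intro w
    obtain ⟨a, b, rfl⟩ := exists_decomp F.norm_u w
    conv_lhs => enter [4]; rw [e1]
    conv_rhs => enter [2, 3]; rw [e1]
    rw [F.secondForm_apply hX, F.firstForm_apply]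
    ring
  · intro w
    obtain ⟨a, b, rfl⟩ := exists_decomp F.norm_u w
    conv_lhs => enter [4]; rw [e2]
    conv_rhs => enter [2, 3]; rw [e2]
    rw [F.secondForm_apply hX, F.firstForm_apply]
    ring

/-- Testing the eigenvector equations on u and iu gives a(k - kᵢ) = 0 and b(l - kᵢ) = 0 for each
eigenvector a u + b iu. Independence of the two eigenvectors then excludes every assignment except
the two orderings, also when k = l. -/
theorem eq_of_principal (F : FormsAt X N z u E k l) (hX : ContDiffAt ℝ ∞ X z) {k₁ k₂ : ℝ}
    (h : ArePrincipalCurvatures X N z k₁ k₂) : (k₁ = k ∧ k₂ = l) ∨ (k₁ = l ∧ k₂ = k) := by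
  obtain ⟨v₁, v₂, hli, h1, h2⟩ := h
  obtain ⟨a₁, b₁, rfl⟩ := exists_decomp F.norm_u v₁
  obtain ⟨a₂, b₂, rfl⟩ := exists_decomp F.norm_u v₂
  have e1 := h1 ((1:ℝ) • u + (0:ℝ) • (Complex.I * u))
  have e2 := h1 ((0:ℝ) • u + (1:ℝ) • (Complex.I * u))
  have e3 := h2 ((1:ℝ) • u + (0:ℝ) • (Complex.I * u))
  have e4 := h2 ((0:ℝ) • u + (1:ℝ) • (Complex.I * u))
  rw [F.secondForm_apply hX, F.firstForm_apply] at e1 e2 e3 e4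
  have hE := F.E_pos.ne'
  have f1 : a₁ * (k - k₁) = 0 := by linear_combination e1
  have f3 : a₂ * (k - k₂) = 0 := by linear_combination e3
  have f2 : b₁ * (l - k₁) = 0 := by
    have : E * (b₁ * (l - k₁)) = 0 := by linear_combination e2
    exact (mul_eq_zero.1 this).resolve_left hE
  have f4 : b₂ * (l - k₂) = 0 := by
    have : E * (b₂ * (l - k₂)) = 0 := by linear_combination e4
    exact (mul_eq_zero.1 this).resolve_left hE
  have hdet : a₁ * b₂ - a₂ * b₁ ≠ 0 := by
    intro h0
    rw [LinearIndependent.pair_iff] at hli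
    have g1 := hli b₂ (-b₁) (by
      simp only [Complex.real_smul]
      have : (a₁ : ℂ) * b₂ - a₂ * b₁ = 0 := by exact_mod_cast h0
      push_cast
      linear_combination u * this)
    have g2 := hli a₂ (-a₁) (by
      simp only [Complex.real_smul]
      have : (a₁ : ℂ) * b₂ - a₂ * b₁ = 0 := by exact_mod_cast h0
      push_cast
      linear_combination (-Complex.I * u) * this)
    have z1 : b₁ = 0 := by linarith [g1.2]
    have z2 : a₁ = 0 := by linarith [g2.2]
    have := hli 1 0 (by simp [z1, z2])
    exact one_ne_zero this.1
  by_cases ha : a₁ = 0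
  · have hb : b₁ ≠ 0 := fun hb => hdet (by rw [ha, hb]; ring)
    have ha2 : a₂ ≠ 0 := fun ha2 => hdet (by rw [ha, ha2]; ring)
    right
    exact ⟨by linarith [(mul_eq_zero.1 f2).resolve_left hb],
      by linarith [(mul_eq_zero.1 f3).resolve_left ha2]⟩
  · have g1 := (mul_eq_zero.1 f1).resolve_left ha
    by_cases hb2 : b₂ = 0
    · have ha2 : a₂ ≠ 0 := fun ha2 => hdet (by rw [hb2, ha2]; ring)
      have hb1 : b₁ ≠ 0 := fun hb1 => hdet (by rw [hb2, hb1]; ring)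
      right
      exact ⟨by linarith [(mul_eq_zero.1 f2).resolve_left hb1],
        by linarith [(mul_eq_zero.1 f3).resolve_left ha2]⟩
    · left
      exact ⟨by linarith, by linarith [(mul_eq_zero.1 f4).resolve_left hb2]⟩

theorem firstForm_pos (F : FormsAt X N z u E k l) {v : ℂ} (hv : v ≠ 0) :
    0 < firstForm X z v v := by
  obtain ⟨a, b, rfl⟩ := exists_decomp F.norm_u v
  rw [F.firstForm_apply]
  have hE := F.E_pos
  by_cases ha : a = 0
  · have hb : b ≠ 0 := by rintro rfl; simp [ha] at hv
    have : 0 < b ^ 2 := by positivity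
    have := mul_pos this hE
    nlinarith [mul_self_nonneg a]
  · have : 0 < a ^ 2 := by positivity
    have h2 : 0 ≤ b * b * E := mul_nonneg (mul_self_nonneg b) hE.le
    nlinarith

theorem injective (F : FormsAt X N z u E k l) : Function.Injective (fderiv ℝ X z) := by
  rw [injective_iff_map_eq_zero]
  intro v hv
  by_contra h
  have := F.firstForm_pos h
  rw [firstForm, hv] at this
  simp [mink] at this

end FormsAt

/-- The unit normal of the surface obtained by rotating a curve with tangent `(r₁, h₁)`, up to
sign. -/
def profileNormal (ρ r₁ h₁ : ℝ) (u : ℂ) : L4 := (-h₁) • eRad ρ u + r₁ • eVert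

/-! ### Normal and curvatures of a rotated curve -/

section

variable {r h : ℝ → ℝ} {u : ℂ} {s : ℝ}

theorem formsAt_rotMap (hu : ‖u‖ = 1) (hs : 0 < s) (hr0 : 0 < r s)
    (hX : ContDiffAt ℝ ∞ (rotMap r h) ((s : ℂ) * u))
    (hX1 : ContDiffAt ℝ ∞ (rotMap r h) (s : ℂ)) (τ : ℝ)
    (hunit : deriv r s ^ 2 + deriv h s ^ 2 = 1) :
    FormsAt (rotMap r h) (τ • profileNormal (r s) (deriv r s) (deriv h s) u) ((s : ℂ) * u) u
      ((Real.sinh (r s) / s) ^ 2)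
      (τ * (deriv r s * deriv (deriv h) s - deriv h s * deriv (deriv r) s))
      (τ * deriv h s * (Real.cosh (r s) / Real.sinh (r s))) := by
  obtain ⟨he, -, -⟩ := eventually_hasDerivAt_profile hs hX1
  obtain ⟨hr1, hh1⟩ := he.self_of_nhds
  have hXd := hX.differentiableAt (by simp)
  have d1 := fderiv_rotMap_radial hu hs hXd hr1 hh1
  have d2 := fderiv_rotMap_angular hu hs hXd
  have hS : 0 < Real.sinh (r s) := Real.sinh_pos_iff.2 hr0
  have hcs := Real.cosh_sq (r s)
  have huu := re_sq_add_im_sq hu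
  refine ⟨hu, by positivity, ?_, ?_, ?_, ?_, ?_, ?_⟩
  · rw [firstForm, d1]
    simp [mink, eRad, eVert]
    linear_combination hunit + (deriv r s) ^ 2 * (Real.cosh (r s)) ^ 2 * huu + (deriv r s) ^ 2 * hcs
  · rw [firstForm, d1, d2]
    simp [mink, eRad, eVert, eAng]
    ring
  · rw [firstForm, d2]
    simp [mink, eAng]
    linear_combination (Real.sinh (r s) / s) ^ 2 * huu
  · rw [secondForm_eq hX, fderiv2_rotMap_radial_radial hu hs hX hX1]
    simp [mink, eRad, eVert, profileNormal]
    linear_combination (- τ * deriv h s * deriv (deriv r) s * Real.cosh (r s) ^ 2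
      - τ * deriv h s * deriv r s ^ 2 * Real.cosh (r s) * Real.sinh (r s)) * huu
      - τ * deriv h s * deriv (deriv r) s * hcs
  · obtain ⟨a, ha⟩ := fderiv2_rotMap_radial_angular hu hs hX hX1
    rw [secondForm_eq hX, ha]
    simp [mink, eRad, eVert, eAng, profileNormal]
    ring
  · have h2 := fderiv2_rotMap_angular_angular hu hs hX
    rw [d1] at h2
    rw [secondForm_eq hX]
    set N := τ • profileNormal (r s) (deriv r s) (deriv h s) u with hN
    have h3 : s * (s * mink (fderiv ℝ (fderiv ℝ (rotMap r h)) ((s : ℂ) * u) (Complex.I * u)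
        (Complex.I * u)) N) = τ * deriv h s * Real.cosh (r s) * Real.sinh (r s) := by
      rw [← mink_smul_left, ← mink_smul_left, h2, hN]
      simp [mink, eRad, eVert, profileNormal]
      linear_combination (τ * deriv h s * Real.cosh (r s) * Real.sinh (r s) -
        τ * s * deriv r s * deriv h s * Real.cosh (r s) ^ 2) * huu
        - τ * s * deriv r s * deriv h s * hcs
    have hs' := hs.ne'
    have hS' := hS.ne'
    generalize mink (fderiv ℝ (fderiv ℝ (rotMap r h)) ((s : ℂ) * u) (Complex.I * u)
        (Complex.I * u)) N = q at h3 ⊢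
    field_simp
    linear_combination h3

theorem isUnitNormal_rotMap (hu : ‖u‖ = 1) (hs : 0 < s)
    (hX : ContDiffAt ℝ ∞ (rotMap r h) ((s : ℂ) * u))
    (hX1 : ContDiffAt ℝ ∞ (rotMap r h) (s : ℂ)) {τ : ℝ} (hτ : τ ^ 2 = 1)
    (hunit : deriv r s ^ 2 + deriv h s ^ 2 = 1) :
    IsUnitNormal (rotMap r h) ((s : ℂ) * u)
      (τ • profileNormal (r s) (deriv r s) (deriv h s) u) := by
  obtain ⟨he, -, -⟩ := eventually_hasDerivAt_profile hs hX1
  obtain ⟨hr1, hh1⟩ := he.self_of_nhds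
  have hXd := hX.differentiableAt (by simp)
  have d1 := fderiv_rotMap_radial hu hs hXd hr1 hh1
  have d2 := fderiv_rotMap_angular hu hs hXd
  have hcs := Real.cosh_sq (r s)
  have huu := re_sq_add_im_sq hu
  refine ⟨?_, ?_, ?_⟩
  · rw [ambientNormal, rotMap_ray hu hs]
    simp [mink, eRad, eVert, profileNormal]
    linear_combination (-τ * deriv h s * Real.cosh (r s) * Real.sinh (r s)) * huu
  · simp [mink, eRad, eVert, profileNormal]
    linear_combination hτ + τ ^ 2 * hunit + τ ^ 2 * (deriv h s) ^ 2 * hcs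
      + τ ^ 2 * (deriv h s) ^ 2 * Real.cosh (r s) ^ 2 * huu
  · intro v
    obtain ⟨a, b, rfl⟩ := exists_decomp hu v
    rw [map_add, map_smul, map_smul, d1, d2]
    simp [mink, eRad, eVert, eAng, profileNormal]
    linear_combination (-a * τ * deriv r s * deriv h s) * hcs
      - a * τ * deriv r s * deriv h s * Real.cosh (r s) ^ 2 * huu

/-- The normal space inside the ambient product is a line, so only the sign τ is free. -/
theorem eq_profileNormal_of_isUnitNormal (hu : ‖u‖ = 1) (hs : 0 < s) (hr0 : 0 < r s)
    (hX : ContDiffAt ℝ ∞ (rotMap r h) ((s : ℂ) * u))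
    (hX1 : ContDiffAt ℝ ∞ (rotMap r h) (s : ℂ))
    (hunit : deriv r s ^ 2 + deriv h s ^ 2 = 1) {N : L4}
    (hN : IsUnitNormal (rotMap r h) ((s : ℂ) * u) N) :
    ∃ τ : ℝ, τ ^ 2 = 1 ∧ N = τ • profileNormal (r s) (deriv r s) (deriv h s) u := by
  obtain ⟨he, -, -⟩ := eventually_hasDerivAt_profile hs hX1
  obtain ⟨hr1, hh1⟩ := he.self_of_nhds
  have hXd := hX.differentiableAt (by simp)
  have d1 := fderiv_rotMap_radial hu hs hXd hr1 hh1
  have d2 := fderiv_rotMap_angular hu hs hXd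
  have hS : 0 < Real.sinh (r s) := Real.sinh_pos_iff.2 hr0
  have hcs := Real.cosh_sq (r s)
  have huu := re_sq_add_im_sq hu
  obtain ⟨n1, n2, n3⟩ := hN
  have m1 := n3 u
  have m2 := n3 (Complex.I * u)
  rw [d1] at m1
  rw [d2, mink_smul_left, mul_eq_zero, or_iff_right (by positivity)] at m2
  rw [ambientNormal, rotMap_ray hu hs] at n1
  simp [mink, eRad, eVert, eAng] at n1 n2 m1 m2
  set S := Real.sinh (r s)
  set C := Real.cosh (r s)
  -- Here p is the component of the planar part of N along u, and a is the coefficient of N along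
  -- `eRad`. Orthogonality to `eAng` and to the position vector leaves N = a · `eRad` + N₃ ·
  -- `eVert`, and orthogonality to the tangent (r', h') fixes (a, N₃) up to sign.
  set p := N 1 * u.re + N 2 * u.im with hp
  set a := -S * N 0 + C * p with ha
  have q1 : N 1 = p * u.re := by rw [hp]; linear_combination (-N 1) * huu + (-u.im) * m2
  have q2 : N 2 = p * u.im := by rw [hp]; linear_combination (-N 2) * huu + u.re * m2
  have q0 : N 0 * C = S * p := by rw [hp]; linear_combination -n1
  have q3 : N 0 = a * S := by rw [ha]; linear_combination (-N 0) * hcs + C * q0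
  have q4 : p = a * C := by rw [ha]; linear_combination (-p) * hcs + S * q0
  have q5 : a * deriv r s + deriv h s * N 3 = 0 := by
    rw [ha, hp]; linear_combination m1
  have q6 : a ^ 2 + N 3 ^ 2 = 1 := by
    have : -N 0 ^ 2 + p ^ 2 + N 3 ^ 2 = 1 := by
      rw [q1, q2] at n2
      linear_combination n2 - p ^ 2 * huu
    rw [q3, q4] at this
    linear_combination this - a ^ 2 * hcs
  have q7 : a = -((-a * deriv h s + N 3 * deriv r s) * deriv h s) := by
    linear_combination (-a) * hunit + deriv r s * q5
  have q8 : N 3 = (-a * deriv h s + N 3 * deriv r s) * deriv r s := by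
    linear_combination (-N 3) * hunit + deriv h s * q5
  refine ⟨-a * deriv h s + N 3 * deriv r s, ?_, ?_⟩
  · set σ := -a * deriv h s + N 3 * deriv r s
    have : a ^ 2 + N 3 ^ 2 = σ ^ 2 * (deriv r s ^ 2 + deriv h s ^ 2) := by
      conv_lhs => rw [q7, q8]
      ring
    rw [q6, hunit, mul_one] at this
    exact this.symm
  · ext i
    fin_cases i <;> simp [profileNormal, eRad, eVert]
    · rw [q3]; linear_combination S * q7
    · rw [q1, q4]; linear_combination C * u.re * q7
    · rw [q2, q4]; linear_combination C * u.im * q7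
    · linear_combination q8

end

/-! ## Solutions of the profile equation and the surfaces they generate -/

/-- The principal curvature determined by the other one, `k`, and the squared angle `v`. -/
def otherCurvature (φ : ℝ → ℝ) (k v : ℝ) : ℝ := φ v + 1 / (k - φ v)

/-- The principal curvature along the parallels; `w` is the slope `|h'|`. -/
def parallelCurvature (ρ w : ℝ) : ℝ := w * (Real.cosh ρ / Real.sinh ρ)

/-- `(r, w)` solves the profile equation on `(0,L)`, where `w = |h'|` and `r' > 0`. -/
structure ProfileSol (φ : ℝ → ℝ) (L : ℝ) (r w : ℝ → ℝ) : Prop where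
  r_pos : ∀ s ∈ Set.Ioo 0 L, 0 < r s
  w_pos : ∀ s ∈ Set.Ioo 0 L, 0 < w s
  w_lt : ∀ s ∈ Set.Ioo 0 L, w s < 1
  gap : ∀ s ∈ Set.Ioo 0 L, φ (1 - w s ^ 2) < parallelCurvature (r s) (w s)
  dr : ∀ s ∈ Set.Ioo 0 L, HasDerivAt r (√(1 - w s ^ 2)) s
  dw : ∀ s ∈ Set.Ioo 0 L, HasDerivAt w
    (√(1 - w s ^ 2) * otherCurvature φ (parallelCurvature (r s) (w s)) (1 - w s ^ 2)) s

/-- Behavior of a profile curve at the pole. -/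
structure PoleLimits (φ : ℝ → ℝ) (r w : ℝ → ℝ) : Prop where
  sinh_div : Tendsto (fun s => Real.sinh (r s) / s) (𝓝[>] 0) (𝓝 1)
  slope : Tendsto w (𝓝[>] 0) (𝓝 0)
  curvature : Tendsto (fun s => parallelCurvature (r s) (w s)) (𝓝[>] 0) (𝓝 (φ 1 + 1))

theorem tendsto_id_nhdsGT_zero : Tendsto (fun t : ℝ => t) (𝓝[>] 0) (𝓝 0) :=
  tendsto_id.mono_left nhdsWithin_le_nhds

theorem tendsto_zero_of_sinh_div {r : ℝ → ℝ}
    (h : Tendsto (fun s => Real.sinh (r s) / s) (𝓝[>] 0) (𝓝 1)) : Tendsto r (𝓝[>] 0) (𝓝 0) := by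
  have h1 : Tendsto (fun s => Real.sinh (r s)) (𝓝[>] 0) (𝓝 0) := by
    have h2 := h.mul tendsto_id_nhdsGT_zero
    rw [mul_zero] at h2
    refine h2.congr' ?_
    filter_upwards [self_mem_nhdsWithin] with s hs
    exact div_mul_cancel₀ _ (ne_of_gt hs)
  have h3 := (Real.continuous_arsinh.tendsto 0).comp h1
  simpa [Function.comp_def] using h3

theorem mem_disk_ofReal {L : ℝ} (z : ℂ) : z ∈ disk (ENNReal.ofReal L) ↔ ‖z‖ < L := by
  rw [disk, Set.mem_ofPred_eq, ← ofReal_norm]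
  exact ⟨fun h => (ENNReal.ofReal_lt_ofReal_iff'.1 h).1,
    fun h => (ENNReal.ofReal_lt_ofReal_iff ((norm_nonneg z).trans_lt h)).2 h⟩

theorem norm_div_norm {z : ℂ} (hz : z ≠ 0) : ‖z / (‖z‖ : ℂ)‖ = 1 := by
  rw [norm_div, Complex.norm_real, norm_norm, div_self (norm_ne_zero_iff.2 hz)]

theorem norm_mul_div_norm {z : ℂ} (hz : z ≠ 0) : (‖z‖ : ℂ) * (z / (‖z‖ : ℂ)) = z := by
  rw [mul_div_cancel₀]
  exact_mod_cast norm_ne_zero_iff.2 hz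

theorem isOpen_disk (ℓ : ℝ≥0∞) : IsOpen (disk ℓ) := isOpen_lt continuous_enorm continuous_const

/-- The normal field of the surface generated by a profile curve. -/
def rotNormal (τ : ℝ) (r h : ℝ → ℝ) (z : ℂ) : L4 :=
  τ • if z = 0 then eVert
    else profileNormal (r ‖z‖) (deriv r ‖z‖) (deriv h ‖z‖) (z / (‖z‖ : ℂ))

theorem rotNormal_ray (τ : ℝ) (r h : ℝ → ℝ) {u : ℂ} (hu : ‖u‖ = 1) {s : ℝ} (hs : 0 < s) :
    rotNormal τ r h ((s : ℂ) * u) = τ • profileNormal (r s) (deriv r s) (deriv h s) u := by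
  have h0 : u ≠ 0 := by rintro rfl; simp at hu
  have hs' : (s : ℂ) ≠ 0 := by exact_mod_cast hs.ne'
  rw [rotNormal, if_neg (mul_ne_zero hs' h0), norm_real_mul hu hs.le, mul_div_cancel_left₀ _ hs']

theorem continuousAt_rotNormal {τ : ℝ} {r h : ℝ → ℝ} {z : ℂ} (hz : z ≠ 0)
    (hr : ContDiffAt ℝ ∞ r ‖z‖) (hh : ContDiffAt ℝ ∞ h ‖z‖) : ContinuousAt (rotNormal τ r h) z := by
  have hn : ContinuousAt (fun z : ℂ => ‖z‖) z := continuous_norm.continuousAt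
  have key : ∀ {f : ℝ → ℝ}, ContDiffAt ℝ ∞ f ‖z‖ → ContinuousAt (fun z : ℂ => deriv f ‖z‖) z := by
    intro f hf
    have h1 : ContDiffAt ℝ 1 (deriv f) ‖z‖ :=
      (hf.fderiv_right (m := 1) (by norm_cast)).clm_apply contDiffAt_const
    exact ContinuousAt.comp (f := fun z : ℂ => ‖z‖) h1.continuousAt hn
  have h1 := key hr
  have h2 := key hh
  have h3 : ContinuousAt (fun z : ℂ => r ‖z‖) z :=
    ContinuousAt.comp (f := fun z : ℂ => ‖z‖) hr.continuousAt hn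
  have h4 : ContinuousAt (fun z : ℂ => z / (‖z‖ : ℂ)) z :=
    continuousAt_id.div (Complex.continuous_ofReal.continuousAt.comp hn)
      (by exact_mod_cast norm_ne_zero_iff.2 hz)
  have h5 : Continuous fun p : ℝ × ℝ × ℝ × ℂ => τ • profileNormal p.1 p.2.1 p.2.2.1 p.2.2.2 := by
    refine continuous_pi fun i => ?_
    fin_cases i <;> simp [profileNormal, eRad, eVert] <;> fun_prop
  have h6 : ContinuousAt (fun z : ℂ => τ • profileNormal (r ‖z‖) (deriv r ‖z‖) (deriv h ‖z‖)
      (z / (‖z‖ : ℂ))) z :=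
    ContinuousAt.comp (f := fun z : ℂ => (r ‖z‖, deriv r ‖z‖, deriv h ‖z‖, z / (‖z‖ : ℂ)))
      h5.continuousAt (h3.prodMk (h1.prodMk (h2.prodMk h4)))
  refine h6.congr ?_
  filter_upwards [isOpen_ne.mem_nhds hz] with y hy
  rw [rotNormal, if_neg hy]

/-- The direction z/‖z‖ has no limit at the pole, but it occurs only multiplied by h', which tends
to 0; the normal therefore converges to the vertical. -/
theorem continuousAt_rotNormal_zero {τ : ℝ} {r h : ℝ → ℝ} (h0 : Tendsto r (𝓝[>] 0) (𝓝 0))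
    (h1 : Tendsto (deriv r) (𝓝[>] 0) (𝓝 1)) (h2 : Tendsto (deriv h) (𝓝[>] 0) (𝓝 0)) :
    ContinuousAt (rotNormal τ r h) 0 := by
  have hn : Tendsto (fun z : ℂ => ‖z‖) (𝓝[≠] 0) (𝓝[>] 0) := tendsto_norm_nhdsNE_zero
  have t0 := h0.comp hn
  have t1 := h1.comp hn
  have t2 := h2.comp hn
  have hC : Tendsto (fun z : ℂ => Real.cosh (r ‖z‖)) (𝓝[≠] 0) (𝓝 1) := by
    have := (Real.continuous_cosh.tendsto 0).comp t0
    simpa [Function.comp_def] using this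
  have hS : Tendsto (fun z : ℂ => Real.sinh (r ‖z‖)) (𝓝[≠] 0) (𝓝 0) := by
    have := (Real.continuous_sinh.tendsto 0).comp t0
    simpa [Function.comp_def] using this
  have hb : ∀ {f : ℂ → ℝ}, (∀ z, |f z| ≤ 1) →
      Tendsto (fun z : ℂ => τ * -(deriv h ‖z‖ * (Real.cosh (r ‖z‖) * f z))) (𝓝[≠] 0) (𝓝 0) := by
    intro f hf
    have h3 : Tendsto (fun z : ℂ => |τ * deriv h ‖z‖ * Real.cosh (r ‖z‖)|) (𝓝[≠] 0) (𝓝 0) := by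
      have := ((t2.const_mul τ).mul hC).abs
      simpa using this
    refine squeeze_zero_norm (fun z => ?_) h3
    rw [Real.norm_eq_abs, show τ * -(deriv h ‖z‖ * (Real.cosh (r ‖z‖) * f z)) =
      -((τ * deriv h ‖z‖ * Real.cosh (r ‖z‖)) * f z) by ring, abs_neg, abs_mul]
    exact mul_le_of_le_one_right (abs_nonneg _) (hf z)
  have hu : ∀ z : ℂ, ‖z / (‖z‖ : ℂ)‖ ≤ 1 := fun z => by
    rw [norm_div, Complex.norm_real, norm_norm]; exact div_self_le_one _
  rw [continuousAt_iff_punctured_nhds, tendsto_pi_nhds]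
  have he : ∀ i, (fun z : ℂ => (τ • profileNormal (r ‖z‖) (deriv r ‖z‖) (deriv h ‖z‖)
      (z / (‖z‖ : ℂ))) i) =ᶠ[𝓝[≠] 0] fun z => rotNormal τ r h z i := by
    intro i
    filter_upwards [self_mem_nhdsWithin] with z hz
    rw [rotNormal, if_neg (by simpa using hz)]
  intro i
  refine Tendsto.congr' (he i) ?_
  fin_cases i <;> simp only [rotNormal, if_true] <;> simp [profileNormal, eRad, eVert]
  · have := ((t2.mul hS).neg).const_mul τ
    simpa using this
  · simpa using hb (f := fun z => (z / (‖z‖ : ℂ)).re)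
      fun z => (Complex.abs_re_le_norm _).trans (hu z)
  · simpa using hb (f := fun z => (z / (‖z‖ : ℂ)).im)
      fun z => (Complex.abs_im_le_norm _).trans (hu z)
  · simpa using t1.const_mul τ

theorem angle_sq_profileNormal (τ ρ r₁ h₁ : ℝ) (u : ℂ) :
    mink (τ • profileNormal ρ r₁ h₁ u) ![0, 0, 0, 1] = τ * r₁ := by
  simp [mink, profileNormal, eRad, eVert]

theorem weingartenFn_otherCurvature {φ : ℝ → ℝ} {k v : ℝ} (hk : φ v < k) :
    weingartenFn φ (otherCurvature φ k v) k v = 0 ∧ φ v < otherCurvature φ k v := by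
  have h1 : 0 < k - φ v := by linarith
  refine ⟨?_, ?_⟩
  · rw [weingartenFn, otherCurvature]; field_simp; ring
  · rw [otherCurvature]; have : 0 < 1 / (k - φ v) := by positivity
    linarith

theorem eq_otherCurvature {φ : ℝ → ℝ} {k l v : ℝ} (hk : φ v < k)
    (h : weingartenFn φ l k v = 0) : l = otherCurvature φ k v := by
  have h1 : k - φ v ≠ 0 := by linarith
  rw [weingartenFn] at h
  rw [otherCurvature]
  field_simp
  linear_combination h

/-! ### From solutions of the profile equation to surfaces -/

section

variable {φ : ℝ → ℝ} {L : ℝ} {r h w : ℝ → ℝ} {τ : ℝ}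

theorem ProfileSol.one_sub_pos (P : ProfileSol φ L r w) {s : ℝ} (hs : s ∈ Set.Ioo 0 L) :
    0 < 1 - w s ^ 2 := by
  have := P.w_pos s hs
  have := P.w_lt s hs
  nlinarith

theorem ProfileSol.deriv_r (P : ProfileSol φ L r w) {s : ℝ} (hs : s ∈ Set.Ioo 0 L) :
    deriv r s = √(1 - w s ^ 2) := (P.dr s hs).deriv

/-- From r' = √(1 - w²): r'' = -w w'/r', and w' contains the factor r', which cancels. -/
theorem ProfileSol.deriv2_r (P : ProfileSol φ L r w) {s : ℝ} (hs : s ∈ Set.Ioo 0 L) :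
    deriv (deriv r) s = - (w s *
      otherCurvature φ (parallelCurvature (r s) (w s)) (1 - w s ^ 2)) := by
  have he : deriv r =ᶠ[𝓝 s] fun s => √(1 - w s ^ 2) := by
    filter_upwards [isOpen_Ioo.mem_nhds hs] with t ht using P.deriv_r ht
  have hp := P.one_sub_pos hs
  have h1 : HasDerivAt (fun s => √(1 - w s ^ 2)) _ s :=
    (((P.dw s hs).fun_pow 2).const_sub 1).sqrt hp.ne'
  rw [he.deriv_eq, h1.deriv]
  have h2 : √(1 - w s ^ 2) ≠ 0 := (Real.sqrt_pos.2 hp).ne'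
  field_simp
  norm_num
  ring

/-- Forms of the surface generated by a solution of the profile equation. -/
theorem ProfileSol.formsAt (P : ProfileSol φ L r w) (hτ : τ ^ 2 = 1)
    (hh : ∀ s ∈ Set.Ioo 0 L, HasDerivAt h (τ * w s) s)
    (hrs : ∀ s ∈ Set.Ioo 0 L, ContDiffAt ℝ ∞ r s) (hhs : ∀ s ∈ Set.Ioo 0 L, ContDiffAt ℝ ∞ h s)
    {s : ℝ} (hs : s ∈ Set.Ioo 0 L) {u : ℂ} (hu : ‖u‖ = 1) :
    FormsAt (rotMap r h) (rotNormal τ r h ((s : ℂ) * u)) ((s : ℂ) * u) u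
      ((Real.sinh (r s) / s) ^ 2)
      (otherCurvature φ (parallelCurvature (r s) (w s)) (1 - w s ^ 2))
      (parallelCurvature (r s) (w s)) ∧
    IsUnitNormal (rotMap r h) ((s : ℂ) * u) (rotNormal τ r h ((s : ℂ) * u)) ∧
    mink (rotNormal τ r h ((s : ℂ) * u)) ![0, 0, 0, 1] ^ 2 = 1 - w s ^ 2 ∧
    ContDiffAt ℝ ∞ (rotMap r h) ((s : ℂ) * u) := by
  have hX : ∀ u : ℂ, ‖u‖ = 1 → ContDiffAt ℝ ∞ (rotMap r h) ((s : ℂ) * u) := by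
    intro u hu
    have h0 : u ≠ 0 := by rintro rfl; simp at hu
    have hs' : (s : ℂ) ≠ 0 := by exact_mod_cast hs.1.ne'
    refine contDiffAt_rotMap (mul_ne_zero hs' h0) ?_ ?_
    · rw [norm_real_mul hu hs.1.le]; exact hrs s hs
    · rw [norm_real_mul hu hs.1.le]; exact hhs s hs
  have hX1 : ContDiffAt ℝ ∞ (rotMap r h) (s : ℂ) := by simpa using hX 1 (by simp)
  have hp := P.one_sub_pos hs
  have hsq : √(1 - w s ^ 2) ^ 2 = 1 - w s ^ 2 := Real.sq_sqrt hp.le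
  have hunit : deriv r s ^ 2 + deriv h s ^ 2 = 1 := by
    rw [P.deriv_r hs, (hh s hs).deriv, hsq, mul_pow, hτ]; ring
  have h2 : deriv (deriv h) s = τ * (√(1 - w s ^ 2) *
      otherCurvature φ (parallelCurvature (r s) (w s)) (1 - w s ^ 2)) := by
    have he : deriv h =ᶠ[𝓝 s] fun s => τ * w s := by
      filter_upwards [isOpen_Ioo.mem_nhds hs] with t ht using (hh t ht).deriv
    rw [he.deriv_eq]
    exact ((P.dw s hs).const_mul τ).deriv
  rw [rotNormal_ray τ r h hu hs.1]
  refine ⟨?_, isUnitNormal_rotMap hu hs.1 (hX u hu) hX1 hτ hunit, ?_, hX u hu⟩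
  · convert formsAt_rotMap hu hs.1 (P.r_pos s hs) (hX u hu) hX1 τ hunit using 1
    · rw [h2, P.deriv2_r hs, P.deriv_r hs, (hh s hs).deriv]
      set κ := otherCurvature φ (parallelCurvature (r s) (w s)) (1 - w s ^ 2)
      linear_combination (-τ ^ 2 * κ) * hsq - κ * hτ
    · rw [(hh s hs).deriv, parallelCurvature]
      linear_combination (-w s * (Real.cosh (r s) / Real.sinh (r s))) * hτ
  · rw [angle_sq_profileNormal, P.deriv_r hs, mul_pow, hτ, hsq, one_mul]

set_option maxHeartbeats 1000000 in
/-- The fundamental forms at the pole. -/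
theorem PoleLimits.formsAt_zero (hL : 0 < L) (hφ : ContinuousOn φ (Set.Icc 0 1))
    (P : ProfileSol φ L r w) (Q : PoleLimits φ r w) (hτ : τ ^ 2 = 1)
    (hh : ∀ s ∈ Set.Ioo 0 L, HasDerivAt h (τ * w s) s)
    (hrs : ∀ s ∈ Set.Ioo 0 L, ContDiffAt ℝ ∞ r s) (hhs : ∀ s ∈ Set.Ioo 0 L, ContDiffAt ℝ ∞ h s)
    (hX0 : ContDiffAt ℝ ∞ (rotMap r h) 0) :
    ContinuousAt (rotNormal τ r h) 0 ∧ (∀ v : ℂ, fderiv ℝ (rotMap r h) 0 v 3 = 0) ∧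
    FormsAt (rotMap r h) (rotNormal τ r h 0) 0 1 1 (φ 1 + 1) (φ 1 + 1) := by
  have hI := Ioo_mem_nhdsGT hL
  have hr0 := tendsto_zero_of_sinh_div Q.sinh_div
  have hw2 : Tendsto (fun s => 1 - w s ^ 2) (𝓝[>] 0) (𝓝 1) := by
    have := (Q.slope.pow 2).const_sub 1
    simpa using this
  have hdr : Tendsto (deriv r) (𝓝[>] 0) (𝓝 1) := by
    have h1 := hw2.sqrt
    rw [Real.sqrt_one] at h1
    refine h1.congr' ?_
    filter_upwards [hI] with s hs using (P.deriv_r hs).symm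
  have hdh : Tendsto (deriv h) (𝓝[>] 0) (𝓝 0) := by
    have h1 := Q.slope.const_mul τ
    rw [mul_zero] at h1
    refine h1.congr' ?_
    filter_upwards [hI] with s hs using (hh s hs).deriv.symm
  have hNc : ContinuousAt (rotNormal τ r h) 0 := continuousAt_rotNormal_zero hr0 hdr hdh
  have hpath : Tendsto (fun s : ℝ => (s : ℂ) * 1) (𝓝[>] 0) (𝓝 0) := by
    have : Continuous fun s : ℝ => (s : ℂ) * 1 := by fun_prop
    have h1 := this.tendsto 0
    simp only [Complex.ofReal_zero, zero_mul] at h1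
    exact h1.mono_left nhdsWithin_le_nhds
  have hd1 : ContDiffAt ℝ 1 (fderiv ℝ (rotMap r h)) 0 := hX0.fderiv_right (by norm_cast)
  have hd2 : ContDiffAt ℝ 0 (fderiv ℝ (fderiv ℝ (rotMap r h))) 0 := hd1.fderiv_right (by norm_cast)
  have hD1 : ∀ v : ℂ, Tendsto (fun s : ℝ => fderiv ℝ (rotMap r h) ((s : ℂ) * 1) v) (𝓝[>] 0)
      (𝓝 (fderiv ℝ (rotMap r h) 0 v)) := fun v =>
    ((hd1.continuousAt.clm_apply continuousAt_const).tendsto).comp hpath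
  have hD2 : ∀ v v' : ℂ, Tendsto (fun s : ℝ => fderiv ℝ (fderiv ℝ (rotMap r h)) ((s : ℂ) * 1) v v')
      (𝓝[>] 0) (𝓝 (fderiv ℝ (fderiv ℝ (rotMap r h)) 0 v v')) := fun v v' =>
    (((hd2.continuousAt.clm_apply continuousAt_const).clm_apply continuousAt_const).tendsto).comp
      hpath
  have hI1 : ∀ v v' : ℂ, Tendsto (fun s : ℝ => firstForm (rotMap r h) ((s : ℂ) * 1) v v')
      (𝓝[>] 0) (𝓝 (firstForm (rotMap r h) 0 v v')) := fun v v' =>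
    (continuous_mink.tendsto (_, _)).comp ((hD1 v).prodMk_nhds (hD1 v'))
  have hF := fun (s : ℝ) (hs : s ∈ Set.Ioo 0 L) =>
    P.formsAt hτ hh hrs hhs hs (u := 1) (by simp)
  have hII : ∀ v v' : ℂ, Tendsto (fun s : ℝ =>
      secondForm (rotMap r h) (rotNormal τ r h ((s : ℂ) * 1)) ((s : ℂ) * 1) v v')
      (𝓝[>] 0) (𝓝 (secondForm (rotMap r h) (rotNormal τ r h 0) 0 v v')) := by
    intro v v'
    rw [secondForm_eq hX0]
    refine Tendsto.congr' ?_ ((continuous_mink.tendsto (_, _)).comp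
      ((hD2 v v').prodMk_nhds (hNc.tendsto.comp hpath)))
    filter_upwards [hI] with s hs
    rw [secondForm_eq (hF s hs).2.2.2]; rfl
  have hφ1 : Tendsto (fun s => φ (1 - w s ^ 2)) (𝓝[>] 0) (𝓝 (φ 1)) := by
    have h1 : ContinuousWithinAt φ (Set.Icc 0 1) 1 := hφ 1 ⟨zero_le_one, le_rfl⟩
    refine Tendsto.comp (f := fun s => 1 - w s ^ 2) h1 (tendsto_nhdsWithin_iff.2 ⟨hw2, ?_⟩)
    filter_upwards [hI] with s hs
    exact ⟨(P.one_sub_pos hs).le, sub_le_self _ (sq_nonneg _)⟩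
  have hoc : Tendsto (fun s => otherCurvature φ (parallelCurvature (r s) (w s)) (1 - w s ^ 2))
      (𝓝[>] 0) (𝓝 (φ 1 + 1)) := by
    have h1 := hφ1.add ((tendsto_const_nhds (x := (1:ℝ))).div (Q.curvature.sub hφ1) (by simp))
    have h2 : φ 1 + 1 / (φ 1 + 1 - φ 1) = φ 1 + 1 := by simp
    rw [h2] at h1
    exact h1
  have hE : Tendsto (fun s => (Real.sinh (r s) / s) ^ 2) (𝓝[>] 0) (𝓝 1) := by
    simpa using Q.sinh_div.pow 2
  -- Each coefficient of the forms at the pole is the limit of its value along the positive real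
  -- axis, where the formulas for s > 0 apply. Both curvatures tend to φ 1 + 1, so the pole is
  -- umbilic.
  have lim : ∀ {f g : ℝ → ℝ} {a b : ℝ}, Tendsto f (𝓝[>] 0) (𝓝 a) → Tendsto g (𝓝[>] 0) (𝓝 b) →
      (∀ s ∈ Set.Ioo 0 L, f s = g s) → a = b := by
    intro f g a b hf hg he
    refine tendsto_nhds_unique (hf.congr' ?_) hg
    filter_upwards [hI] with s hs using he s hs
  refine ⟨hNc, ?_, by simp, one_pos, ?_, ?_, ?_, ?_, ?_, ?_⟩
  · have h3 : ∀ v : ℂ, Tendsto (fun s : ℝ => fderiv ℝ (rotMap r h) ((s : ℂ) * 1) v 3) (𝓝[>] 0)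
        (𝓝 (fderiv ℝ (rotMap r h) 0 v 3)) := fun v => (tendsto_pi_nhds.1 (hD1 v)) 3
    have g1 : fderiv ℝ (rotMap r h) 0 1 3 = 0 := by
      refine lim (h3 1) hdh fun s hs => ?_
      rw [fderiv_rotMap_radial (by simp) hs.1 ((hF s hs).2.2.2.differentiableAt (by simp))
        (P.dr s hs) (hh s hs), (hh s hs).deriv]
      simp [eRad, eVert]
    have g2 : fderiv ℝ (rotMap r h) 0 (Complex.I * 1) 3 = 0 := by
      refine lim (h3 _) (tendsto_const_nhds (x := (0:ℝ))) fun s hs => ?_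
      rw [fderiv_rotMap_angular (by simp) hs.1 ((hF s hs).2.2.2.differentiableAt (by simp))]
      simp [eAng]
    intro v
    obtain ⟨a, b, rfl⟩ := exists_decomp (u := 1) (by simp) v
    rw [map_add, map_smul, map_smul, Pi.add_apply, Pi.smul_apply, Pi.smul_apply, g1, g2]
    simp
  · exact lim (hI1 _ _) tendsto_const_nhds fun s hs => (hF s hs).1.I11
  · exact lim (hI1 _ _) tendsto_const_nhds fun s hs => (hF s hs).1.I12
  · exact lim (hI1 _ _) hE fun s hs => (hF s hs).1.I22
  · exact lim (hII _ _) hoc fun s hs => (hF s hs).1.II11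
  · exact lim (hII _ _) tendsto_const_nhds fun s hs => (hF s hs).1.II12
  · exact lim (hII _ _) (Q.curvature.mul hE) fun s hs => (hF s hs).1.II22

/-- A solution of the profile equation generates a surface of the class. -/
theorem exists_rotSurface (hL : 0 < L) (hφ : ContinuousOn φ (Set.Icc 0 1)) (hr0 : r 0 = 0)
    (P : ProfileSol φ L r w) (Q : PoleLimits φ r w) (hτ : τ ^ 2 = 1)
    (hh : ∀ s ∈ Set.Ioo 0 L, HasDerivAt h (τ * w s) s)
    (hrs : ∀ s ∈ Set.Ioo 0 L, ContDiffAt ℝ ∞ r s) (hhs : ∀ s ∈ Set.Ioo 0 L, ContDiffAt ℝ ∞ h s)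
    (hX0 : ContDiffAt ℝ ∞ (rotMap r h) 0) :
    ∃ S : RotSurface, S.ℓ = ENNReal.ofReal L ∧ S.r = r ∧ S.h = h ∧ S.N = rotNormal τ r h ∧
      InClass φ S := by
  obtain ⟨hNc, h3, hF0⟩ := Q.formsAt_zero hL hφ P hτ hh hrs hhs hX0
  have pol : ∀ z ∈ disk (ENNReal.ofReal L), z ≠ 0 → ∃ s ∈ Set.Ioo 0 L, ∃ u : ℂ, ‖u‖ = 1 ∧
      z = (s : ℂ) * u := by
    intro z hz h0
    rw [mem_disk_ofReal] at hz
    exact ⟨‖z‖, ⟨norm_pos_iff.2 h0, hz⟩, _, norm_div_norm h0, (norm_mul_div_norm h0).symm⟩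
  have hXd : ∀ z ∈ disk (ENNReal.ofReal L), ContDiffAt ℝ ∞ (rotMap r h) z := by
    intro z hz
    by_cases h0 : z = 0
    · rw [h0]; exact hX0
    · obtain ⟨s, hs, u, hu, rfl⟩ := pol z hz h0
      exact (P.formsAt hτ hh hrs hhs hs hu).2.2.2
  let S : RotSurface :=
    { ℓ := ENNReal.ofReal L
      r := r
      h := h
      N := rotNormal τ r h
      ℓ_pos := ENNReal.ofReal_pos.2 hL
      r_zero := hr0
      r_pos := fun s h0 hs => P.r_pos s ⟨h0, (ENNReal.ofReal_lt_ofReal_iff'.1 hs).1⟩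
      smooth := fun z hz => (hXd z hz).contDiffWithinAt
      immersed := by
        intro z hz
        by_cases h0 : z = 0
        · rw [h0]; exact hF0.injective
        · obtain ⟨s, hs, u, hu, rfl⟩ := pol z hz h0
          exact (P.formsAt hτ hh hrs hhs hs hu).1.injective
      unit_speed := by
        intro z hz u hu hzu
        by_cases h0 : z = 0
        · rw [h0]
          obtain ⟨a, b, rfl⟩ := exists_decomp (u := 1) (by simp) u
          rw [hF0.firstForm_apply]
          have h1 : ‖a • (1:ℂ) + b • (Complex.I * 1)‖ ^ 2 = a * a + b * b * 1 := by
            rw [← Complex.normSq_eq_norm_sq, Complex.normSq_apply]; simp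
          rw [← h1, hu, one_pow]
        · have hz' := (mem_disk_ofReal z).1 hz
          have h1 := (P.formsAt hτ hh hrs hhs (s := ‖z‖) ⟨norm_pos_iff.2 h0, hz'⟩ hu).1.I11
          rwa [← hzu] at h1
      orthogonal := h3
      normal_cont := by
        intro z hz
        by_cases h0 : z = 0
        · rw [h0]; exact hNc.continuousWithinAt
        · have hs : ‖z‖ ∈ Set.Ioo 0 L := ⟨norm_pos_iff.2 h0, (mem_disk_ofReal z).1 hz⟩
          exact (continuousAt_rotNormal h0 (hrs _ hs) (hhs _ hs)).continuousWithinAt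
      normal := by
        intro z hz
        by_cases h0 : z = 0
        · rw [h0]
          refine ⟨?_, ?_, fun v => ?_⟩
          · simp [rotNormal, ambientNormal, mink, eVert]
          · simp [rotNormal, mink, eVert]; linear_combination hτ
          · have := h3 v
            simp [rotNormal, mink, eVert, this]
        · obtain ⟨s, hs, u, hu, rfl⟩ := pol z hz h0
          exact (P.formsAt hτ hh hrs hhs hs hu).2.1 }
  refine ⟨S, rfl, rfl, rfl, rfl, ?_⟩
  intro z hz
  by_cases h0 : z = 0
  · refine ⟨φ 1 + 1, φ 1 + 1, ?_, ?_⟩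
    · rw [h0]; exact hF0.principal hX0
    · have : S.angle z ^ 2 = 1 := by
        rw [h0]
        simp [RotSurface.angle, S, rotNormal, mink, eVert]
        simpa using hτ
      rw [this]
      refine ⟨by simp [weingartenFn], by linarith, by linarith⟩
  · obtain ⟨s, hs, u, hu, rfl⟩ := pol z hz h0
    obtain ⟨F, -, hang, hX⟩ := P.formsAt hτ hh hrs hhs hs hu
    refine ⟨_, _, F.principal hX, ?_⟩
    have : S.angle ((s : ℂ) * u) ^ 2 = 1 - w s ^ 2 := hang
    rw [this]
    obtain ⟨h1, h2⟩ := weingartenFn_otherCurvature (P.gap s hs)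
    exact ⟨h1, h2, P.gap s hs⟩

end

/-! ## The profile equation of a surface of the class -/

theorem ray_mem_disk {ℓ : ℝ≥0∞} {u : ℂ} (hu : ‖u‖ = 1) {s : ℝ} (hs : 0 ≤ s) :
    (s : ℂ) * u ∈ disk ℓ ↔ ENNReal.ofReal s < ℓ := by
  rw [disk, Set.mem_ofPred_eq, ← ofReal_norm, norm_real_mul hu hs]

theorem mem_disk_iff {ℓ : ℝ≥0∞} (z : ℂ) : z ∈ disk ℓ ↔ ENNReal.ofReal ‖z‖ < ℓ := by
  rw [disk, Set.mem_ofPred_eq, ← ofReal_norm]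

/-- The interior parameters of the profile curve. -/
def RotSurface.params (S : RotSurface) : Set ℝ := {s | 0 < s ∧ ENNReal.ofReal s < S.ℓ}

theorem RotSurface.isOpen_params (S : RotSurface) : IsOpen S.params :=
  (isOpen_lt continuous_const continuous_id).inter
    (isOpen_lt ENNReal.continuous_ofReal continuous_const)

theorem RotSurface.ordConnected_params (S : RotSurface) : S.params.OrdConnected :=
  ⟨fun _ hx _ hy _ hz => ⟨hx.1.trans_le hz.1,
    (ENNReal.ofReal_le_ofReal hz.2).trans_lt hy.2⟩⟩

theorem RotSurface.exists_Ioo_subset_params (S : RotSurface) :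
    ∃ L : ℝ, 0 < L ∧ ENNReal.ofReal L ≤ S.ℓ ∧ Set.Ioo 0 L ⊆ S.params := by
  obtain ⟨x, h1, h2⟩ := ENNReal.lt_iff_exists_nnreal_btwn.1 S.ℓ_pos
  refine ⟨x, by exact_mod_cast h1, by rw [ENNReal.ofReal_coe_nnreal]; exact h2.le,
    fun s hs => ⟨hs.1, ?_⟩⟩
  refine lt_of_le_of_lt (ENNReal.ofReal_le_ofReal hs.2.le) ?_
  rwa [ENNReal.ofReal_coe_nnreal]

theorem RotSurface.contDiffAt (S : RotSurface) {z : ℂ} (hz : z ∈ disk S.ℓ) :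
    ContDiffAt ℝ ∞ (rotMap S.r S.h) z := S.smooth.contDiffAt ((isOpen_disk _).mem_nhds hz)

theorem RotSurface.ray_mem (S : RotSurface) {s : ℝ} (hs : s ∈ S.params) {u : ℂ} (hu : ‖u‖ = 1) :
    (s : ℂ) * u ∈ disk S.ℓ := (ray_mem_disk hu hs.1.le).2 hs.2

theorem RotSurface.real_mem (S : RotSurface) {s : ℝ} (hs : s ∈ S.params) :
    (s : ℂ) ∈ disk S.ℓ := by simpa using S.ray_mem hs (u := 1) (by simp)

theorem RotSurface.contDiffAt_profile (S : RotSurface) {s : ℝ} (hs : s ∈ S.params) :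
    ContDiffAt ℝ ∞ S.r s ∧ ContDiffAt ℝ ∞ S.h s :=
  HypProd.contDiffAt_profile hs.1 (S.contDiffAt (S.real_mem hs))

theorem contDiffAt_deriv {f : ℝ → ℝ} {s : ℝ} (hf : ContDiffAt ℝ ∞ f s) :
    ContDiffAt ℝ ∞ (deriv f) s :=
  (hf.fderiv_right (m := ∞) (by simp)).clm_apply contDiffAt_const

theorem RotSurface.unit (S : RotSurface) {s : ℝ} (hs : s ∈ S.params) :
    deriv S.r s ^ 2 + deriv S.h s ^ 2 = 1 := by
  have h1 := S.unit_speed ((s : ℂ) * 1) (S.ray_mem hs (by simp)) 1 (by simp)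
    (by rw [norm_real_mul (by simp) hs.1.le])
  obtain ⟨hr, hh⟩ := S.contDiffAt_profile hs
  rw [firstForm, fderiv_rotMap_radial (by simp) hs.1
    ((S.contDiffAt (S.ray_mem hs (by simp))).differentiableAt (by simp))
    (hr.differentiableAt (by simp)).hasDerivAt (hh.differentiableAt (by simp)).hasDerivAt] at h1
  simp [mink, eRad, eVert] at h1
  linear_combination h1 - (deriv S.r s) ^ 2 * Real.cosh_sq (S.r s)

/-- The profile curve of a surface of the class; `τ` is the sign of `h'`. -/
structure ClassProfile (φ : ℝ → ℝ) (S : RotSurface) (τ : ℝ) : Prop where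
  sq_sign : τ ^ 2 = 1
  w_pos : ∀ s ∈ S.params, 0 < τ * deriv S.h s
  gap : ∀ s ∈ S.params, φ (deriv S.r s ^ 2) < parallelCurvature (S.r s) (τ * deriv S.h s)
  dr : ∀ s ∈ S.params, HasDerivAt (deriv S.r) (-(τ * deriv S.h s *
    otherCurvature φ (parallelCurvature (S.r s) (τ * deriv S.h s)) (deriv S.r s ^ 2))) s
  dw : ∀ s ∈ S.params, HasDerivAt (fun s => τ * deriv S.h s) (deriv S.r s *
    otherCurvature φ (parallelCurvature (S.r s) (τ * deriv S.h s)) (deriv S.r s ^ 2)) s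
  normal_eq : ∀ s ∈ S.params, ∀ u : ℂ, ‖u‖ = 1 →
    S.N ((s : ℂ) * u) = τ • profileNormal (S.r s) (deriv S.r s) (deriv S.h s) u
  principal : ∀ s ∈ S.params, ∀ u : ℂ, ‖u‖ = 1 → S.Principal ((s : ℂ) * u)
    (otherCurvature φ (parallelCurvature (S.r s) (τ * deriv S.h s)) (deriv S.r s ^ 2))
    (parallelCurvature (S.r s) (τ * deriv S.h s))

/-- The relation orders neither the principal curvatures nor the normal. Symmetry of the relation
takes care of the first; the second is settled by l = σ h' coth r > φ > 0, which forces h' ≠ 0 and σ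
= sign h'. -/
theorem InClass.local_profile {φ : ℝ → ℝ} (hφ : ∀ v ∈ Set.Icc (0:ℝ) 1, 0 < φ v) {S : RotSurface}
    (hS : InClass φ S) {s : ℝ} (hs : s ∈ S.params) {u : ℂ} (hu : ‖u‖ = 1) :
    ∃ σ : ℝ, σ ^ 2 = 1 ∧ 0 < σ * deriv S.h s ∧
      S.N ((s : ℂ) * u) = σ • profileNormal (S.r s) (deriv S.r s) (deriv S.h s) u ∧
      φ (deriv S.r s ^ 2) < parallelCurvature (S.r s) (σ * deriv S.h s) ∧
      σ * (deriv S.r s * deriv (deriv S.h) s - deriv S.h s * deriv (deriv S.r) s) =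
        otherCurvature φ (parallelCurvature (S.r s) (σ * deriv S.h s)) (deriv S.r s ^ 2) ∧
      S.Principal ((s : ℂ) * u)
        (otherCurvature φ (parallelCurvature (S.r s) (σ * deriv S.h s)) (deriv S.r s ^ 2))
        (parallelCurvature (S.r s) (σ * deriv S.h s)) := by
  have hz := S.ray_mem hs hu
  have hX := S.contDiffAt hz
  have hX1 := S.contDiffAt (S.real_mem hs)
  have hunit := S.unit hs
  have hr0 := S.r_pos s hs.1 hs.2
  obtain ⟨σ, hσ, hN⟩ := eq_profileNormal_of_isUnitNormal hu hs.1 hr0 hX hX1 hunit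
    (S.normal _ hz)
  have F := formsAt_rotMap hu hs.1 hr0 hX hX1 σ hunit
  obtain ⟨k₁, k₂, hP, hW, h1, h2⟩ := hS _ hz
  have hang : S.angle ((s : ℂ) * u) ^ 2 = deriv S.r s ^ 2 := by
    rw [RotSurface.angle, hN, angle_sq_profileNormal, mul_pow, hσ, one_mul]
  rw [hang] at hW h1 h2
  have hpos : 0 < φ (deriv S.r s ^ 2) :=
    hφ _ ⟨sq_nonneg _, by nlinarith [sq_nonneg (deriv S.h s)]⟩
  have hP' := hP
  rw [RotSurface.Principal, RotSurface.X, hN] at hP'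
  have hpc : σ * deriv S.h s * (Real.cosh (S.r s) / Real.sinh (S.r s)) =
    parallelCurvature (S.r s) (σ * deriv S.h s) := rfl
  have hWl : weingartenFn φ (σ * (deriv S.r s * deriv (deriv S.h) s -
      deriv S.h s * deriv (deriv S.r) s)) (parallelCurvature (S.r s) (σ * deriv S.h s))
      (deriv S.r s ^ 2) = 0 ∧
      φ (deriv S.r s ^ 2) < parallelCurvature (S.r s) (σ * deriv S.h s) := by
    rw [← hpc]
    rcases F.eq_of_principal hX hP' with ⟨e1, e2⟩ | ⟨e1, e2⟩
    · rw [← e1, ← e2]; exact ⟨hW, h2⟩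
    · rw [← e1, ← e2]
      exact ⟨by rw [← hW, weingartenFn, weingartenFn]; ring, h1⟩
  have hk := eq_otherCurvature hWl.2 hWl.1
  have hp := F.principal hX
  rw [← hN, hk, hpc] at hp
  refine ⟨σ, hσ, ?_, hN, hWl.2, hk, hp⟩
  have h3 : 0 < σ * deriv S.h s * (Real.cosh (S.r s) / Real.sinh (S.r s)) := hpos.trans hWl.2
  have h4 : 0 < Real.cosh (S.r s) / Real.sinh (S.r s) :=
    div_pos (Real.cosh_pos _) (Real.sinh_pos_iff.2 hr0)
  exact pos_of_mul_pos_left h3 h4.le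

/-- Since h' never vanishes on the interval of parameters, it has one sign τ there, and the
pointwise signs of the normal all coincide with it. -/
theorem InClass.exists_profile {φ : ℝ → ℝ} (hφ : ∀ v ∈ Set.Icc (0:ℝ) 1, 0 < φ v) {S : RotSurface}
    (hS : InClass φ S) : ∃ τ, ClassProfile φ S τ := by
  obtain ⟨L, hL, -, hLp⟩ := S.exists_Ioo_subset_params
  have hL2 : L / 2 ∈ S.params := hLp ⟨by linarith, by linarith⟩
  have one : ‖(1:ℂ)‖ = 1 := by simp
  obtain ⟨τ, hτ, hτp, -⟩ := hS.local_profile hφ hL2 one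
  have hcont : ContinuousOn (fun s => τ * deriv S.h s) S.params := fun s hs =>
    (continuousAt_const.mul (contDiffAt_deriv (S.contDiffAt_profile hs).2).continuousAt)
      |>.continuousWithinAt
  have hne : ∀ s ∈ S.params, τ * deriv S.h s ≠ 0 := by
    intro s hs h0
    obtain ⟨σ, hσ, hσp, -⟩ := hS.local_profile hφ hs one
    have : τ ≠ 0 := by rintro rfl; simp at hτ
    rw [(mul_eq_zero.1 h0).resolve_left this] at hσp
    simp at hσp
  have hpos : ∀ s ∈ S.params, 0 < τ * deriv S.h s := by
    intro s hs
    by_contra hlt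
    have hpre := S.ordConnected_params.isPreconnected
    have := hpre.intermediate_value hs hL2 hcont
    obtain ⟨t, ht, h0⟩ := this ⟨not_lt.1 hlt, hτp.le⟩
    exact hne t ht h0
  have hloc : ∀ s ∈ S.params, ∀ u : ℂ, ‖u‖ = 1 →
      S.N ((s : ℂ) * u) = τ • profileNormal (S.r s) (deriv S.r s) (deriv S.h s) u ∧
      φ (deriv S.r s ^ 2) < parallelCurvature (S.r s) (τ * deriv S.h s) ∧
      τ * (deriv S.r s * deriv (deriv S.h) s - deriv S.h s * deriv (deriv S.r) s) =
        otherCurvature φ (parallelCurvature (S.r s) (τ * deriv S.h s)) (deriv S.r s ^ 2) ∧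
      S.Principal ((s : ℂ) * u)
        (otherCurvature φ (parallelCurvature (S.r s) (τ * deriv S.h s)) (deriv S.r s ^ 2))
        (parallelCurvature (S.r s) (τ * deriv S.h s)) := by
    intro s hs u hu
    obtain ⟨σ, hσ, hσp, h1, h2, h3, h4⟩ := hS.local_profile hφ hs hu
    have e : σ = τ := by
      have h5 := hpos s hs
      have h6 : (σ - τ) * (σ + τ) = 0 := by linear_combination hσ - hτ
      rcases mul_eq_zero.1 h6 with h7 | h7
      · linarith
      · have : σ = -τ := by linarith
        rw [this] at hσp; linarith
    rw [e] at h1 h2 h3 h4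
    exact ⟨h1, h2, h3, h4⟩
  have hder : ∀ s ∈ S.params, HasDerivAt (deriv S.r) (deriv (deriv S.r) s) s ∧
      HasDerivAt (deriv S.h) (deriv (deriv S.h) s) s := fun s hs =>
    ⟨((contDiffAt_deriv (S.contDiffAt_profile hs).1).differentiableAt (by simp)).hasDerivAt,
      ((contDiffAt_deriv (S.contDiffAt_profile hs).2).differentiableAt (by simp)).hasDerivAt⟩
  -- Derivative of r'² + h'² = 1. Together with the formula for r' h'' - h' r'' it determines r''
  -- and h'' separately.
  have hrel : ∀ s ∈ S.params, deriv S.r s * deriv (deriv S.r) s +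
      deriv S.h s * deriv (deriv S.h) s = 0 := by
    intro s hs
    have h1 := ((hder s hs).1.fun_pow 2).fun_add ((hder s hs).2.fun_pow 2)
    have h2 : (fun s => deriv S.r s ^ 2 + deriv S.h s ^ 2) =ᶠ[𝓝 s] fun _ => 1 := by
      filter_upwards [S.isOpen_params.mem_nhds hs] with t ht using S.unit ht
    have h3 := h1.unique ((hasDerivAt_const s (1:ℝ)).congr_of_eventuallyEq h2)
    norm_num at h3
    linear_combination h3 / 2
  refine ⟨τ, hτ, hpos, fun s hs => (hloc s hs 1 one).2.1, ?_, ?_,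
    fun s hs u hu => (hloc s hs u hu).1, fun s hs u hu => (hloc s hs u hu).2.2.2⟩
  · intro s hs
    refine (hder s hs).1.congr_deriv ?_
    rw [← (hloc s hs 1 one).2.2.1]
    linear_combination (-deriv (deriv S.r) s) * S.unit hs + deriv S.r s * hrel s hs
      + deriv S.h s * (deriv S.r s * deriv (deriv S.h) s - deriv S.h s * deriv (deriv S.r) s) * hτ
  · intro s hs
    refine ((hder s hs).2.const_mul τ).congr_deriv ?_
    rw [← (hloc s hs 1 one).2.2.1]
    linear_combination (-τ * deriv (deriv S.h) s) * S.unit hs + τ * deriv S.h s * hrel s hs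

/-- The limits of the profile curve at the pole. -/
theorem ClassProfile.poleLimits {φ : ℝ → ℝ} (hφ : ContinuousOn φ (Set.Icc 0 1)) {S : RotSurface}
    {τ : ℝ} (C : ClassProfile φ S τ) :
    Tendsto (deriv S.r) (𝓝[>] 0) (𝓝 1) ∧ PoleLimits φ S.r fun s => τ * deriv S.h s := by
  obtain ⟨L, hL, -, hLp⟩ := S.exists_Ioo_subset_params
  have hI := Ioo_mem_nhdsGT hL
  have h0 : (0:ℂ) ∈ disk S.ℓ := by
    rw [mem_disk_iff]; simpa using S.ℓ_pos
  have hX0 := S.contDiffAt h0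
  have hof : ContDiffAt ℝ ∞ (fun s : ℝ => (s : ℂ)) 0 := Complex.ofRealCLM.contDiff.contDiffAt
  have hX0' : ContDiffAt ℝ ∞ (rotMap S.r S.h) ((0:ℝ) : ℂ) := by simpa only [Complex.ofReal_zero] using hX0
  have hDc : ContDiffAt ℝ ∞ (fun s : ℝ => fderiv ℝ (rotMap S.r S.h) (s : ℂ) 1) 0 :=
    ((ContDiffAt.comp (0:ℝ) (hX0'.fderiv_right (m := ∞) (by simp)) hof)).clm_apply
      contDiffAt_const
  set D : ℝ → L4 := fun s => fderiv ℝ (rotMap S.r S.h) (s : ℂ) 1 with hD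
  have hDi := contDiffAt_pi.1 hDc
  have hDs : ∀ s ∈ S.params, D s = deriv S.r s • eRad (S.r s) 1 + deriv S.h s • eVert := by
    intro s hs
    obtain ⟨hr, hh⟩ := S.contDiffAt_profile hs
    have := fderiv_rotMap_radial (u := 1) (by simp) hs.1
      ((S.contDiffAt (S.ray_mem hs (by simp))).differentiableAt (by simp))
      (hr.differentiableAt (by simp)).hasDerivAt (hh.differentiableAt (by simp)).hasDerivAt
    rw [mul_one] at this
    exact this
  have hD1 : ∀ s ∈ S.params, D s 1 = deriv S.r s * Real.cosh (S.r s) := fun s hs => by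
    rw [hDs s hs]; simp [eRad, eVert]
  have hD3 : ∀ s ∈ S.params, D s 3 = deriv S.h s := fun s hs => by
    rw [hDs s hs]; simp [eRad, eVert]
  have hD30 : D 0 3 = 0 := by
    have := S.orthogonal 1
    simpa [hD] using this
  have hlim : ∀ i, Tendsto (fun s => D s i) (𝓝[>] 0) (𝓝 (D 0 i)) := fun i =>
    (hDi i).continuousAt.tendsto.mono_left nhdsWithin_le_nhds
  have hdh : Tendsto (deriv S.h) (𝓝[>] 0) (𝓝 0) := by
    have := hlim 3
    rw [hD30] at this
    refine this.congr' ?_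
    filter_upwards [hI] with s hs using hD3 s (hLp hs)
  have hsd : Tendsto (fun s => Real.sinh (S.r s) / s) (𝓝[>] 0) (𝓝 (D 0 1)) := by
    have h1 : HasDerivAt (fun s : ℝ => rotMap S.r S.h (s : ℂ)) (D 0) 0 := by
      have h2 : HasDerivAt (fun s : ℝ => (s : ℂ)) 1 0 := Complex.ofRealCLM.hasDerivAt
      exact hasDerivAt_comp_path (hX0'.differentiableAt (by simp)).hasFDerivAt h2
    have h2 := (hasDerivAt_pi.1 h1 1).tendsto_slope_zero_right
    refine h2.congr' ?_
    filter_upwards [hI] with s hs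
    have h3 : rotMap S.r S.h ((s : ℝ) : ℂ) 1 = Real.sinh (S.r s) := by
      have := rotMap_ray (r := S.r) (h := S.h) (u := 1) (by simp) hs.1
      rw [mul_one] at this
      rw [this]; simp
    have h4 : rotMap S.r S.h ((0 : ℝ) : ℂ) 1 = 0 := by simp [rotMap]
    rw [zero_add, h3, h4, smul_eq_mul, sub_zero, div_eq_inv_mul]
  have hsinh0 : Tendsto (fun s => Real.sinh (S.r s)) (𝓝[>] 0) (𝓝 0) := by
    have h2 := hsd.mul tendsto_id_nhdsGT_zero
    rw [mul_zero] at h2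
    refine h2.congr' ?_
    filter_upwards [self_mem_nhdsWithin] with s hs
    exact div_mul_cancel₀ _ (ne_of_gt hs)
  have hr0 : Tendsto S.r (𝓝[>] 0) (𝓝 0) := by
    simpa [Function.comp_def] using (Real.continuous_arsinh.tendsto 0).comp hsinh0
  have hcosh : Tendsto (fun s => Real.cosh (S.r s)) (𝓝[>] 0) (𝓝 1) := by
    simpa [Function.comp_def] using (Real.continuous_cosh.tendsto 0).comp hr0
  have hdr' : Tendsto (deriv S.r) (𝓝[>] 0) (𝓝 (D 0 1)) := by
    have h1 := (hlim 1).div hcosh one_ne_zero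
    rw [div_one] at h1
    refine h1.congr' ?_
    filter_upwards [hI] with s hs
    simp only [Pi.div_apply]
    rw [hD1 s (hLp hs), mul_div_cancel_right₀ _ (Real.cosh_pos _).ne']
  -- Unit speed in the limit, with h' → 0, gives the square; the sign comes from sinh r / s ≥ 0.
  have hD01 : D 0 1 = 1 := by
    have h1 : D 0 1 ^ 2 + 0 ^ 2 = 1 := by
      refine tendsto_nhds_unique ((hdr'.pow 2).add (hdh.pow 2))
        ((tendsto_const_nhds (x := (1:ℝ))).congr' ?_)
      filter_upwards [hI] with s hs using (S.unit (hLp hs)).symm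
    have h2 : 0 ≤ D 0 1 := by
      refine ge_of_tendsto hsd ?_
      filter_upwards [hI] with s hs
      exact div_nonneg (Real.sinh_nonneg_iff.2 (S.r_pos s hs.1 (hLp hs).2).le) hs.1.le
    nlinarith
  rw [hD01] at hsd hdr'
  set e := deriv (fun s => D s 3) 0 with he
  have hslope : Tendsto (fun s => deriv S.h s / s) (𝓝[>] 0) (𝓝 e) := by
    have h1 := ((hDi 3).differentiableAt (by simp)).hasDerivAt.tendsto_slope_zero_right
    refine h1.congr' ?_
    filter_upwards [hI] with s hs
    rw [zero_add, hD30, hD3 s (hLp hs), smul_eq_mul, sub_zero, div_eq_inv_mul]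
  have hpc : Tendsto (fun s => parallelCurvature (S.r s) (τ * deriv S.h s)) (𝓝[>] 0)
      (𝓝 (τ * e)) := by
    have h1 := (hslope.const_mul τ).mul (hcosh.div hsd one_ne_zero)
    rw [div_one, mul_one] at h1
    refine h1.congr' ?_
    filter_upwards [hI] with s hs
    have hs0 := hs.1.ne'
    have := (Real.sinh_pos_iff.2 (S.r_pos s hs.1 (hLp hs).2)).ne'
    simp only [Pi.div_apply]
    rw [parallelCurvature]
    field_simp
  set κ : ℝ → ℝ := fun s =>
    otherCurvature φ (parallelCurvature (S.r s) (τ * deriv S.h s)) (deriv S.r s ^ 2) with hκ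
  -- The meridian curvature is w'/r', and h' coincides for s > 0 with a function smooth across 0, so
  -- κ has the limit τ h''(0), the same as the curvature of the parallels.
  have hκlim : Tendsto κ (𝓝[>] 0) (𝓝 (τ * e)) := by
    have h1 : Tendsto (deriv fun s => D s 3) (𝓝[>] 0) (𝓝 e) :=
      (contDiffAt_deriv (hDi 3)).continuousAt.tendsto.mono_left nhdsWithin_le_nhds
    have h2 := (h1.const_mul τ).div hdr' one_ne_zero
    rw [div_one] at h2
    refine h2.congr' ?_
    have hrne : ∀ᶠ s in 𝓝[>] 0, 0 < deriv S.r s := hdr'.eventually_const_lt one_pos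
    filter_upwards [hI, hrne] with s hs hrs
    have h3 : (fun s => D s 3) =ᶠ[𝓝 s] deriv S.h := by
      filter_upwards [S.isOpen_params.mem_nhds (hLp hs)] with t ht using hD3 t ht
    simp only [Pi.div_apply]
    rw [h3.deriv_eq]
    have h4 := (C.dw s (hLp hs)).unique
      ((((contDiffAt_deriv (S.contDiffAt_profile (hLp hs)).2).differentiableAt
        (by simp)).hasDerivAt).const_mul τ)
    rw [← h4, mul_div_cancel_left₀ _ hrs.ne']
  have hφ1 : Tendsto (fun s => φ (deriv S.r s ^ 2)) (𝓝[>] 0) (𝓝 (φ 1)) := by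
    have h1 : ContinuousWithinAt φ (Set.Icc 0 1) 1 := hφ 1 ⟨zero_le_one, le_rfl⟩
    refine Tendsto.comp (f := fun s => deriv S.r s ^ 2) h1 (tendsto_nhdsWithin_iff.2 ⟨?_, ?_⟩)
    · simpa using hdr'.pow 2
    · filter_upwards [hI] with s hs
      have := S.unit (hLp hs)
      exact ⟨sq_nonneg _, by nlinarith [sq_nonneg (deriv S.h s)]⟩
  -- In the limit both factors of the Weingarten relation coincide, so the common curvature is φ 1 ±
  -- 1; the side condition l > φ selects the plus sign.
  have hprod : (τ * e - φ 1) * (τ * e - φ 1) = 1 := by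
    refine tendsto_nhds_unique ((hκlim.sub hφ1).mul (hpc.sub hφ1))
      ((tendsto_const_nhds (x := (1:ℝ))).congr' ?_)
    filter_upwards [hI] with s hs
    have := (weingartenFn_otherCurvature (C.gap s (hLp hs))).1
    rw [weingartenFn] at this
    simp only [hκ]
    linarith
  have hge : φ 1 ≤ τ * e := by
    refine le_of_tendsto_of_tendsto hφ1 hpc ?_
    filter_upwards [hI] with s hs using (C.gap s (hLp hs)).le
  have hte : τ * e = φ 1 + 1 := by nlinarith
  refine ⟨hdr', hsd, by simpa using hdh.const_mul τ, ?_⟩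
  rw [← hte]; exact hpc

theorem ClassProfile.deriv_sq {φ : ℝ → ℝ} {S : RotSurface} {τ : ℝ} (C : ClassProfile φ S τ)
    {s : ℝ} (hs : s ∈ S.params) : deriv S.r s ^ 2 = 1 - (τ * deriv S.h s) ^ 2 := by
  rw [mul_pow, C.sq_sign]; linarith [S.unit hs]

/-- Where `r' > 0`, the profile curve solves the equation of any class function that agrees with
the given one on the range of the squared angle. -/
theorem ClassProfile.profileSol {φ ψ : ℝ → ℝ} {S : RotSurface} {τ : ℝ} (C : ClassProfile φ S τ)
    {L : ℝ} (hL : ENNReal.ofReal L ≤ S.ℓ) (hpos : ∀ s ∈ Set.Ioo 0 L, 0 < deriv S.r s)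
    (hψ : ∀ s ∈ Set.Ioo 0 L, ψ (deriv S.r s ^ 2) = φ (deriv S.r s ^ 2)) :
    ProfileSol ψ L S.r fun s => τ * deriv S.h s := by
  have hm : ∀ s ∈ Set.Ioo 0 L, s ∈ S.params := fun s hs =>
    ⟨hs.1, ((ENNReal.ofReal_lt_ofReal_iff (hs.1.trans hs.2)).2 hs.2).trans_le hL⟩
  have hsq : ∀ s ∈ Set.Ioo 0 L, √(1 - (τ * deriv S.h s) ^ 2) = deriv S.r s := fun s hs => by
    rw [← C.deriv_sq (hm s hs), Real.sqrt_sq (hpos s hs).le]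
  refine ⟨fun s hs => S.r_pos s (hm s hs).1 (hm s hs).2, fun s hs => C.w_pos s (hm s hs),
    ?_, ?_, ?_, ?_⟩
  · intro s hs
    have h1 := C.deriv_sq (hm s hs)
    have h2 := C.w_pos s (hm s hs)
    have h3 := hpos s hs
    have h4 : 0 < deriv S.r s ^ 2 := by positivity
    nlinarith
  · intro s hs
    rw [← C.deriv_sq (hm s hs), hψ s hs]
    exact C.gap s (hm s hs)
  · intro s hs
    rw [hsq s hs]
    exact ((S.contDiffAt_profile (hm s hs)).1.differentiableAt (by simp)).hasDerivAt
  · intro s hs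
    rw [hsq s hs, ← C.deriv_sq (hm s hs), otherCurvature, hψ s hs]
    exact C.dw s (hm s hs)

/-! ## The profile equation at the pole -/

/-- With `T = tanh² r`, the curvature `K` of the parallels solves `T K' = curvatureField (T, K)`. -/
def curvatureField (φ : ℝ → ℝ) (p : ℝ × ℝ) : ℝ :=
  (otherCurvature φ p.2 (1 - p.2 ^ 2 * p.1) / (1 - p.1) - p.2) / 2

/-- The solution of the curvature equation near the pole. -/
structure PoleCurvature (φ K : ℝ → ℝ) (δ η : ℝ) : Prop where
  δ_pos : 0 < δ
  δ_lt : δ < 1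
  η_pos : 0 < η
  K_zero : K 0 = φ 1 + 1
  mem_ball : ∀ T ∈ Set.Ico 0 δ, K T ∈ Metric.closedBall (φ 1 + 1) η
  pos : ∀ T ∈ Set.Ico 0 δ, 0 < K T
  lt_one : ∀ T ∈ Set.Ico 0 δ, 0 < 1 - K T ^ 2 * T
  gap : ∀ T ∈ Set.Ico 0 δ, φ (1 - K T ^ 2 * T) < K T
  smooth : ContDiffOn ℝ ∞ K (Set.Ico 0 δ)
  ode : ∀ T ∈ Set.Ioo 0 δ, HasDerivAt K (curvatureField φ (T, K T) / T) T
  mono : ∀ T ∈ Set.Icc 0 δ, ∀ a ∈ Metric.closedBall (φ 1 + 1) η,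
    ∀ b ∈ Metric.closedBall (φ 1 + 1) η,
    (a - b) * (curvatureField φ (T, a) - curvatureField φ (T, b)) ≤ 0

/-- At T = 0 the field is z ↦ (φ 1 + 1/(z - φ 1) - z)/2. It vanishes at z = φ 1 + 1 with derivative
-1, well inside the range (-2, 0) required by `singular_exists`. -/
theorem exists_poleCurvature {φ : ℝ → ℝ} (hφ : SmoothPos φ) :
    ∃ K δ η, PoleCurvature φ K δ η := by
  have hφ1 : 0 < φ 1 := hφ.2 1 ⟨zero_le_one, le_rfl⟩
  set V : Set ℝ := Set.Ioo (φ 1 + 3 / 4) (φ 1 + 5 / 4) with hV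
  have hc : ContinuousWithinAt φ (Set.Icc 0 1) 1 := hφ.1.continuousOn 1 ⟨zero_le_one, le_rfl⟩
  have hev : ∀ᶠ v in 𝓝[Set.Icc 0 1] 1, φ v < φ 1 + 3 / 4 :=
    hc.eventually_lt_const (by linarith)
  obtain ⟨ε, hε, hB⟩ := Metric.nhdsWithin_basis_ball.eventually_iff.1 hev
  -- M bounds K² on V. The choice δ M < min ε (1/2) keeps w² = K² T below 1/2 and φ(1 - K² T) below
  -- φ 1 + 3/4, hence below K; since M > 4 it also gives δ < 1.
  set M := (φ 1 + 2) ^ 2 with hM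
  have hMpos : 0 < M := by positivity
  obtain ⟨δ, hδ, hδ2⟩ := exists_between (show 0 < min ε (1 / 2) / M by positivity)
  rw [lt_div_iff₀ hMpos] at hδ2
  have hM4 : 4 < M := by rw [hM]; nlinarith
  have hδ1 : δ < 1 := by
    have := hδ2.trans_le (min_le_right _ _)
    nlinarith
  have dom : ∀ T ∈ Set.Ico 0 δ, ∀ K ∈ V, 0 < 1 - K ^ 2 * T ∧ 1 - K ^ 2 * T ∈ Set.Icc (0:ℝ) 1 ∧
      φ (1 - K ^ 2 * T) < K := by
    intro T hT K hK
    have h1 : K ^ 2 ≤ M := by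
      rw [hM]
      have := hK.1; have := hK.2
      nlinarith
    have h2 : K ^ 2 * T ≤ δ * M := by
      rw [mul_comm δ]; exact mul_le_mul h1 hT.2.le hT.1 hMpos.le
    have h3 : 0 ≤ K ^ 2 * T := mul_nonneg (sq_nonneg _) hT.1
    have h4 : K ^ 2 * T < ε := h2.trans_lt (hδ2.trans_le (min_le_left _ _))
    have h5 : K ^ 2 * T < 1 / 2 := h2.trans_lt (hδ2.trans_le (min_le_right _ _))
    have h6 : 1 - K ^ 2 * T ∈ Set.Icc (0:ℝ) 1 := ⟨by linarith, by linarith⟩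
    refine ⟨by linarith, h6, ?_⟩
    have h7 := hB ⟨by
      rw [Metric.mem_ball, Real.dist_eq, show 1 - K ^ 2 * T - 1 = -(K ^ 2 * T) by ring, abs_neg,
        abs_of_nonneg h3]; exact h4, h6⟩
    exact h7.trans hK.1
  have hk0 : φ 1 + 1 ∈ V := ⟨by linarith, by linarith⟩
  have hG : ContDiffOn ℝ ∞ (curvatureField φ) (Set.Ico 0 δ ×ˢ V) := by
    have h1 : ContDiffOn ℝ ∞ (fun p : ℝ × ℝ => φ (1 - p.2 ^ 2 * p.1)) (Set.Ico 0 δ ×ˢ V) :=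
      hφ.1.comp (t := Set.Icc 0 1) (by fun_prop) fun p hp => (dom p.1 hp.1 p.2 hp.2).2.1
    have h2 : ContDiffOn ℝ ∞ (fun p : ℝ × ℝ => p.2) (Set.Ico 0 δ ×ˢ V) := contDiffOn_snd
    have h3 : ContDiffOn ℝ ∞ (fun p : ℝ × ℝ => 1 - p.1) (Set.Ico 0 δ ×ˢ V) :=
      contDiffOn_const.sub contDiffOn_fst
    refine ((((h1.add (contDiffOn_const.div (h2.sub h1) ?_)).div h3 ?_).sub h2).div_const 2)
    · intro p hp
      have := (dom p.1 hp.1 p.2 hp.2).2.2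
      exact (sub_pos.2 this).ne'
    · intro p hp
      have := hp.1.2
      linarith
  have h0 : curvatureField φ (0, φ 1 + 1) = 0 := by
    simp [curvatureField, otherCurvature]
  have hg : HasDerivAt (fun z => curvatureField φ (0, z)) (-1) (φ 1 + 1) := by
    have e : (fun z => curvatureField φ (0, z)) = fun z => (φ 1 + (z - φ 1)⁻¹ - z) / 2 := by
      funext z; simp [curvatureField, otherCurvature]
    rw [e]
    have h1 := ((((hasDerivAt_id (φ 1 + 1)).sub_const (φ 1)).fun_inv (by simp)).const_add (φ 1)
      |>.fun_sub (hasDerivAt_id (φ 1 + 1))).div_const 2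
    exact h1.congr_deriv (by norm_num)
  obtain ⟨δ₁, hδ₁, hδ₁δ, η, hη, hηV, c, hc0, hc1, hL⟩ :=
    singular_contraction hδ isOpen_Ioo hG hk0 hg (by norm_num) (by norm_num)
  obtain ⟨δ₂, hδ₂, hδ₂δ, K, hK0, hKV, hKs, hKo⟩ :=
    singular_exists hδ isOpen_Ioo hG hk0 h0 hg (by norm_num) (by norm_num)
  have hKc : ContinuousWithinAt K (Set.Ico 0 δ₂) 0 := hKs.continuousOn 0 ⟨le_rfl, hδ₂⟩
  have hev2 : ∀ᶠ T in 𝓝[Set.Ico 0 δ₂] 0, K T ∈ Metric.closedBall (φ 1 + 1) η := by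
    refine hKc.eventually_mem ?_
    rw [hK0]; exact Metric.closedBall_mem_nhds _ hη
  obtain ⟨ε₂, hε₂, hB₂⟩ := Metric.nhdsWithin_basis_ball.eventually_iff.1 hev2
  have hm : ∀ T ∈ Set.Ico 0 (min ε₂ (min δ₁ δ₂)), T ∈ Set.Ico 0 δ₂ := fun T hT =>
    ⟨hT.1, hT.2.trans_le ((min_le_right _ _).trans (min_le_right _ _))⟩
  have hm' : ∀ T ∈ Set.Ico 0 (min ε₂ (min δ₁ δ₂)), T ∈ Set.Ico 0 δ := fun T hT =>
    ⟨hT.1, (hm T hT).2.trans_le hδ₂δ⟩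
  refine ⟨K, min ε₂ (min δ₁ δ₂), η, by positivity,
    ((min_le_right _ _).trans ((min_le_right _ _).trans hδ₂δ)).trans_lt hδ1, hη, hK0, ?_, ?_, ?_,
    ?_, hKs.mono hm, fun T hT => hKo T ⟨hT.1, (hm T ⟨hT.1.le, hT.2⟩).2⟩, ?_⟩
  · intro T hT
    refine hB₂ ⟨?_, hm T hT⟩
    rw [Metric.mem_ball, Real.dist_eq, sub_zero, abs_of_nonneg hT.1]
    exact hT.2.trans_le (min_le_left _ _)
  · intro T hT
    have := (hKV T (hm T hT)).1
    linarith
  · exact fun T hT => (dom T (hm' T hT) _ (hKV T (hm T hT))).1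
  · exact fun T hT => (dom T (hm' T hT) _ (hKV T (hm T hT))).2.2
  · intro T hT a ha b hb
    exact contraction_monotone hc1
      (hL T ⟨hT.1, hT.2.trans ((min_le_right _ _).trans (min_le_left _ _))⟩ a ha b hb)

/-- `(tanh r)'`, where `r' = √(1 - w²)`, `w = K(T) tanh r` and `T = tanh² r`. -/
def tanhSpeed (K : ℝ → ℝ) (T : ℝ) : ℝ := (1 - T) * √(1 - K T ^ 2 * T)

/-- With `t = s²`, the function `m = tanh r / s` solves `t m' = ratioField (t, m)`. -/
def ratioField (K : ℝ → ℝ) (p : ℝ × ℝ) : ℝ := (tanhSpeed K (p.1 * p.2 ^ 2) - p.2) / 2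

/-- The ratio `m = tanh r / s` near the pole. -/
structure PoleRatio (K m : ℝ → ℝ) (δ ε η : ℝ) : Prop where
  ε_pos : 0 < ε
  η_pos : 0 < η
  m_zero : m 0 = 1
  mem_ball : ∀ t ∈ Set.Ico 0 ε, m t ∈ Metric.closedBall 1 η
  pos : ∀ t ∈ Set.Ico 0 ε, 0 < m t
  maps : ∀ t ∈ Set.Ico 0 ε, t * m t ^ 2 ∈ Set.Ico 0 δ
  smooth : ContDiffOn ℝ ∞ m (Set.Ico 0 ε)
  ode : ∀ t ∈ Set.Ioo 0 ε, HasDerivAt m (ratioField K (t, m t) / t) t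
  mono : ∀ t ∈ Set.Icc 0 ε, ∀ a ∈ Metric.closedBall 1 η, ∀ b ∈ Metric.closedBall 1 η,
    (a - b) * (ratioField K (t, a) - ratioField K (t, b)) ≤ 0

theorem PoleCurvature.smooth_tanhSpeed {φ K : ℝ → ℝ} {δ η : ℝ} (C : PoleCurvature φ K δ η) :
    ContDiffOn ℝ ∞ (tanhSpeed K) (Set.Ico 0 δ) := by
  have h1 : ContDiffOn ℝ ∞ (fun T => 1 - K T ^ 2 * T) (Set.Ico 0 δ) :=
    contDiffOn_const.sub ((C.smooth.pow 2).mul contDiffOn_id)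
  exact (contDiffOn_const.sub contDiffOn_id).mul (h1.sqrt fun T hT => (C.lt_one T hT).ne')

/-- Once K is known, the arc-length equation for tanh r is autonomous. In terms of m and t its
linearization at (0, 1) has the coefficient -1/2. -/
theorem PoleCurvature.exists_ratio {φ K : ℝ → ℝ} {δ η' : ℝ} (C : PoleCurvature φ K δ η') :
    ∃ m ε η, PoleRatio K m δ ε η := by
  have hδ := C.δ_pos
  set V : Set ℝ := Set.Ioo (1 / 2) (3 / 2) with hV
  have hδ4 : 0 < δ / 4 := by linarith
  have dom : ∀ t ∈ Set.Ico 0 (δ / 4), ∀ m ∈ V, t * m ^ 2 ∈ Set.Ico 0 δ := by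
    intro t ht m hm
    refine ⟨mul_nonneg ht.1 (sq_nonneg _), ?_⟩
    have h1 : m ^ 2 ≤ 4 := by have := hm.1; have := hm.2; nlinarith
    have := mul_le_mul_of_nonneg_left h1 ht.1
    have := ht.2
    linarith
  have h1V : (1:ℝ) ∈ V := ⟨by norm_num, by norm_num⟩
  have hG : ContDiffOn ℝ ∞ (ratioField K) (Set.Ico 0 (δ / 4) ×ˢ V) := by
    have h1 : ContDiffOn ℝ ∞ (fun p : ℝ × ℝ => tanhSpeed K (p.1 * p.2 ^ 2))
        (Set.Ico 0 (δ / 4) ×ˢ V) :=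
      C.smooth_tanhSpeed.comp (by fun_prop) fun p hp => dom p.1 hp.1 p.2 hp.2
    exact (h1.sub contDiffOn_snd).div_const 2
  have hH0 : tanhSpeed K 0 = 1 := by simp [tanhSpeed]
  have h0 : ratioField K (0, 1) = 0 := by simp [ratioField, hH0]
  have hg : HasDerivAt (fun z => ratioField K (0, z)) (-1 / 2) 1 := by
    have e : (fun z => ratioField K (0, z)) = fun z => (1 - z) / 2 := by
      funext z; simp [ratioField, hH0]
    rw [e]
    exact ((hasDerivAt_id (1:ℝ)).const_sub 1).div_const 2
  obtain ⟨δ₁, hδ₁, hδ₁δ, η, hη, hηV, c, hc0, hc1, hL⟩ :=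
    singular_contraction hδ4 isOpen_Ioo hG h1V hg (by norm_num) (by norm_num)
  obtain ⟨δ₂, hδ₂, hδ₂δ, m, hm0, hmV, hms, hmo⟩ :=
    singular_exists hδ4 isOpen_Ioo hG h1V h0 hg (by norm_num) (by norm_num)
  have hmc : ContinuousWithinAt m (Set.Ico 0 δ₂) 0 := hms.continuousOn 0 ⟨le_rfl, hδ₂⟩
  have hev2 : ∀ᶠ T in 𝓝[Set.Ico 0 δ₂] 0, m T ∈ Metric.closedBall 1 η := by
    refine hmc.eventually_mem ?_
    rw [hm0]; exact Metric.closedBall_mem_nhds _ hη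
  obtain ⟨ε₂, hε₂, hB₂⟩ := Metric.nhdsWithin_basis_ball.eventually_iff.1 hev2
  have hm : ∀ T ∈ Set.Ico 0 (min ε₂ (min δ₁ δ₂)), T ∈ Set.Ico 0 δ₂ := fun T hT =>
    ⟨hT.1, hT.2.trans_le ((min_le_right _ _).trans (min_le_right _ _))⟩
  refine ⟨m, min ε₂ (min δ₁ δ₂), η, by positivity, hη, hm0, ?_, ?_, ?_, hms.mono hm,
    fun T hT => hmo T ⟨hT.1, (hm T ⟨hT.1.le, hT.2⟩).2⟩, ?_⟩
  · intro T hT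
    refine hB₂ ⟨?_, hm T hT⟩
    rw [Metric.mem_ball, Real.dist_eq, sub_zero, abs_of_nonneg hT.1]
    exact hT.2.trans_le (min_le_left _ _)
  · intro T hT
    have := (hmV T (hm T hT)).1
    linarith
  · exact fun T hT => dom T ⟨hT.1, (hm T hT).2.trans_le hδ₂δ⟩ _ (hmV T (hm T hT))
  · intro T hT a ha b hb
    exact contraction_monotone hc1
      (hL T ⟨hT.1, hT.2.trans ((min_le_right _ _).trans (min_le_left _ _))⟩ a ha b hb)

/-! ### Uniqueness at the pole -/

section Unique

variable {φ K m r w : ℝ → ℝ} {L : ℝ}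

theorem hasDerivAt_tanh {r' s : ℝ} (hr : HasDerivAt r r' s) :
    HasDerivAt (fun s => Real.sinh (r s) / Real.cosh (r s))
      ((1 - (Real.sinh (r s) / Real.cosh (r s)) ^ 2) * r') s := by
  refine (hr.sinh.fun_div hr.cosh (Real.cosh_pos _).ne').congr_deriv ?_
  have := (Real.cosh_pos (r s)).ne'
  field_simp

/-- Along any solution with the right limits at the pole, the curvature of the parallels as a
function of tanh² r satisfies the same singular equation as K; monotonicity of the field forces the
two to be equal. -/
theorem ProfileSol.eventually_curvature_eq {δ η : ℝ} (C : PoleCurvature φ K δ η)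
    (hL : 0 < L) (P : ProfileSol φ L r w) (Q : PoleLimits φ r w) :
    ∀ᶠ s in 𝓝[>] 0, parallelCurvature (r s) (w s) =
      K ((Real.sinh (r s) / Real.cosh (r s)) ^ 2) := by
  have hr0 := tendsto_zero_of_sinh_div Q.sinh_div
  have hx0 : Tendsto (fun s => Real.sinh (r s) / Real.cosh (r s)) (𝓝[>] 0) (𝓝 0) := by
    have : Continuous fun x : ℝ => Real.sinh x / Real.cosh x :=
      Real.continuous_sinh.div Real.continuous_cosh fun x => (Real.cosh_pos x).ne'
    simpa [Function.comp_def] using (this.tendsto 0).comp hr0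
  have hT0 : Tendsto (fun s => (Real.sinh (r s) / Real.cosh (r s)) ^ 2) (𝓝[>] 0) (𝓝 0) := by
    simpa using hx0.pow 2
  have hI := Ioo_mem_nhdsGT hL
  have e1 : ∀ᶠ s in 𝓝[>] 0, (Real.sinh (r s) / Real.cosh (r s)) ^ 2 < δ :=
    hT0.eventually_lt_const C.δ_pos
  have e2 : ∀ᶠ s in 𝓝[>] 0, parallelCurvature (r s) (w s) ∈ Metric.closedBall (φ 1 + 1) η :=
    Q.curvature.eventually_mem (Metric.closedBall_mem_nhds _ C.η_pos)
  obtain ⟨ε, hε, hE⟩ := (nhdsGT_basis (0:ℝ)).eventually_iff.1 (e1.and (e2.and hI))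
  set x : ℝ → ℝ := fun s => Real.sinh (r s) / Real.cosh (r s) with hx
  have hxpos : ∀ s ∈ Set.Ioo 0 ε, 0 < x s := fun s hs =>
    div_pos (Real.sinh_pos_iff.2 (P.r_pos s (hE hs).2.2)) (Real.cosh_pos _)
  have hTm : ∀ s ∈ Set.Ioo 0 ε, x s ^ 2 ∈ Set.Ioo 0 δ := fun s hs =>
    ⟨by have := hxpos s hs; positivity, (hE hs).1⟩
  -- The factor in front of the difference of fields is T'/T with T = tanh² r, which is nonnegative.
  -- Hence d d' ≤ 0 by `C.mono`.
  have hd := eq_zero_of_mul_deriv_nonpos (δ := ε)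
    (d := fun s => parallelCurvature (r s) (w s) - K (x s ^ 2))
    (d' := fun s => 2 * √(1 - w s ^ 2) * (1 / x s) * (1 - x s ^ 2) *
      (curvatureField φ (x s ^ 2, parallelCurvature (r s) (w s)) -
        curvatureField φ (x s ^ 2, K (x s ^ 2)))) ?_ ?_ ?_
  · filter_upwards [Ioo_mem_nhdsGT hε] with s hs
    have := hd s hs
    linarith
  · intro s hs
    obtain ⟨h1, h2, h3⟩ := hE hs
    have hS := (Real.sinh_pos_iff.2 (P.r_pos s h3)).ne'
    have hC := (Real.cosh_pos (r s)).ne'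
    have d1 : HasDerivAt (fun s => parallelCurvature (r s) (w s)) _ s :=
      (P.dw s h3).fun_mul ((P.dr s h3).cosh.fun_div (P.dr s h3).sinh hS)
    have d2 := hasDerivAt_tanh (P.dr s h3)
    have d3 : HasDerivAt (fun s => K (x s ^ 2)) _ s :=
      (C.ode _ (hTm s hs)).comp s (d2.fun_pow 2)
    refine (d1.fun_sub d3).congr_deriv ?_
    have hw : parallelCurvature (r s) (w s) ^ 2 * x s ^ 2 = w s ^ 2 := by
      simp only [parallelCurvature, hx]; field_simp
    have hx1 : 1 - x s ^ 2 ≠ 0 := by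
      have := (hTm s hs).2; have := C.δ_lt; linarith
    have hx2 : 1 - x s ^ 2 = 1 / Real.cosh (r s) ^ 2 := by
      simp only [hx]; field_simp; linarith [Real.cosh_sq (r s)]
    have hxx : x s = Real.sinh (r s) / Real.cosh (r s) := rfl
    have hxn := (hxpos s hs).ne'
    have e1 : curvatureField φ (x s ^ 2, parallelCurvature (r s) (w s)) =
      (otherCurvature φ (parallelCurvature (r s) (w s)) (1 - w s ^ 2) / (1 - x s ^ 2) -
        parallelCurvature (r s) (w s)) / 2 := by rw [curvatureField, hw]
    rw [e1]
    generalize curvatureField φ (x s ^ 2, K (x s ^ 2)) = g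
    generalize otherCurvature φ (parallelCurvature (r s) (w s)) (1 - w s ^ 2) = κ
    rw [← hxx]
    have e2 : 2 * √(1 - w s ^ 2) * (1 / x s) * (1 - x s ^ 2) *
        ((κ / (1 - x s ^ 2) - parallelCurvature (r s) (w s)) / 2 - g) =
        √(1 - w s ^ 2) * (1 / x s) * (κ - (1 - x s ^ 2) * parallelCurvature (r s) (w s)
          - 2 * (1 - x s ^ 2) * g) := by field_simp
    rw [e2]
    have e3 : g / x s ^ 2 * (((2 : ℕ) : ℝ) * x s ^ (2 - 1) * ((1 - x s ^ 2) * √(1 - w s ^ 2))) =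
      √(1 - w s ^ 2) * (1 / x s) * (2 * (1 - x s ^ 2) * g) := by
      norm_num; field_simp
    rw [e3, hx2, hxx, parallelCurvature]
    have := Real.cosh_sq (r s)
    field_simp
    linear_combination (-√(1 - w s ^ 2) * Real.cosh (r s) * w s) * this
  · intro s hs
    obtain ⟨h1, h2, h3⟩ := hE hs
    have h4 := hTm s hs
    have h5 := C.mono _ ⟨h4.1.le, h4.2.le⟩ _ h2 _ (C.mem_ball _ ⟨h4.1.le, h4.2⟩)
    have h6 : 0 ≤ 2 * √(1 - w s ^ 2) * (1 / x s) * (1 - x s ^ 2) := by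
      have := hxpos s hs
      have h7 : 0 ≤ 1 - x s ^ 2 := by have := h4.2; have := C.δ_lt; linarith
      positivity
    nlinarith
  · have h1 : ContinuousWithinAt K (Set.Ico 0 δ) 0 := C.smooth.continuousOn 0 ⟨le_rfl, C.δ_pos⟩
    have h2 : Tendsto (fun s => K (x s ^ 2)) (𝓝[>] 0) (𝓝 (K 0)) := by
      refine Tendsto.comp (f := fun s => x s ^ 2) h1 (tendsto_nhdsWithin_iff.2 ⟨hT0, ?_⟩)
      filter_upwards [Ioo_mem_nhdsGT hε] with s hs using ⟨(hTm s hs).1.le, (hTm s hs).2⟩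
    have := Q.curvature.sub h2
    rwa [C.K_zero, sub_self] at this

/-- Solutions of the profile equation are explicit near the pole. -/
theorem ProfileSol.eventually_eq {δ η ε η' : ℝ} (C : PoleCurvature φ K δ η)
    (R : PoleRatio K m δ ε η') (hL : 0 < L) (P : ProfileSol φ L r w) (Q : PoleLimits φ r w) :
    ∀ᶠ s in 𝓝[>] 0, Real.sinh (r s) / Real.cosh (r s) = s * m (s ^ 2) ∧
      w s = K ((s * m (s ^ 2)) ^ 2) * (s * m (s ^ 2)) := by
  have hr0 := tendsto_zero_of_sinh_div Q.sinh_div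
  have hcosh : Tendsto (fun s => Real.cosh (r s)) (𝓝[>] 0) (𝓝 1) := by
    simpa [Function.comp_def] using (Real.continuous_cosh.tendsto 0).comp hr0
  set x : ℝ → ℝ := fun s => Real.sinh (r s) / Real.cosh (r s) with hx
  have hxs : Tendsto (fun s => x s / s) (𝓝[>] 0) (𝓝 1) := by
    have h1 := Q.sinh_div.div hcosh one_ne_zero
    rw [div_one] at h1
    refine h1.congr fun s => ?_
    simp only [Pi.div_apply, hx]
    ring
  have hx0 : Tendsto x (𝓝[>] 0) (𝓝 0) := by
    have h2 := hxs.mul tendsto_id_nhdsGT_zero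
    rw [mul_zero] at h2
    refine h2.congr' ?_
    filter_upwards [self_mem_nhdsWithin] with s hs
    exact div_mul_cancel₀ _ (ne_of_gt hs)
  have hs0 : Tendsto (fun s : ℝ => s ^ 2) (𝓝[>] 0) (𝓝 0) := by
    simpa using tendsto_id_nhdsGT_zero.pow 2
  have hI := Ioo_mem_nhdsGT hL
  have e0 := P.eventually_curvature_eq C hL Q
  have e1 : ∀ᶠ s in 𝓝[>] 0, s ^ 2 < ε := hs0.eventually_lt_const R.ε_pos
  have e2 : ∀ᶠ s in 𝓝[>] 0, x s / s ∈ Metric.closedBall 1 η' :=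
    hxs.eventually_mem (Metric.closedBall_mem_nhds _ R.η_pos)
  obtain ⟨ε', hε', hE⟩ := (nhdsGT_basis (0:ℝ)).eventually_iff.1 (e0.and (e1.and (e2.and hI)))
  have hw : ∀ s ∈ Set.Ioo 0 ε', w s = K (x s ^ 2) * x s := by
    intro s hs
    obtain ⟨h0, -, -, h3⟩ := hE hs
    rw [← h0]
    have hS := (Real.sinh_pos_iff.2 (P.r_pos s h3)).ne'
    have hC := (Real.cosh_pos (r s)).ne'
    simp only [parallelCurvature, hx]
    field_simp
  have hsm : ∀ s ∈ Set.Ioo 0 ε', s ^ 2 ∈ Set.Ioo 0 ε := fun s hs =>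
    ⟨by have := hs.1; positivity, (hE hs).2.1⟩
  -- The same argument for the ratio, with t = s²: the factor t'/t is 2/s.
  have hd := eq_zero_of_mul_deriv_nonpos (δ := ε') (d := fun s => x s / s - m (s ^ 2))
    (d' := fun s => 2 / s * (ratioField K (s ^ 2, x s / s) - ratioField K (s ^ 2, m (s ^ 2))))
    ?_ ?_ ?_
  · filter_upwards [Ioo_mem_nhdsGT hε'] with s hs
    have h1 : x s = s * m (s ^ 2) := by
      have h2 := hd s hs
      have := hs.1.ne'
      field_simp at h2
      linarith
    exact ⟨h1, by rw [← h1]; exact hw s hs⟩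
  · intro s hs
    obtain ⟨h0, h1, h2, h3⟩ := hE hs
    have hsn := hs.1.ne'
    have d2 : HasDerivAt x _ s := hasDerivAt_tanh (P.dr s h3)
    have d3 : HasDerivAt (fun s => m (s ^ 2)) _ s := 
      HasDerivAt.comp (h₂ := m) (h := fun s : ℝ => s ^ 2) s (R.ode _ (hsm s hs))
        ((hasDerivAt_id s).fun_pow 2)
    refine ((d2.fun_div (hasDerivAt_id s) hsn).fun_sub d3).congr_deriv ?_
    have e : ratioField K (s ^ 2, x s / s) = ((1 - x s ^ 2) * √(1 - w s ^ 2) - x s / s) / 2 := by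
      have e2 : s ^ 2 * (x s / s) ^ 2 = x s ^ 2 := by field_simp
      simp only [ratioField, tanhSpeed]
      rw [e2, hw s hs, mul_pow]
    rw [e]
    have hxx : Real.sinh (r s) / Real.cosh (r s) = x s := rfl
    rw [hxx]
    simp only [id]
    norm_num
    field_simp
  · intro s hs
    obtain ⟨h0, h1, h2, h3⟩ := hE hs
    have h4 := hsm s hs
    have h5 := R.mono _ ⟨h4.1.le, h4.2.le⟩ _ h2 _ (R.mem_ball _ ⟨h4.1.le, h4.2⟩)
    have h6 : 0 ≤ 2 / s := by have := hs.1; positivity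
    nlinarith
  · have h1 : ContinuousWithinAt m (Set.Ico 0 ε) 0 := R.smooth.continuousOn 0 ⟨le_rfl, R.ε_pos⟩
    have h2 : Tendsto (fun s => m (s ^ 2)) (𝓝[>] 0) (𝓝 (m 0)) := by
      refine Tendsto.comp (f := fun s => s ^ 2) h1 (tendsto_nhdsWithin_iff.2 ⟨hs0, ?_⟩)
      filter_upwards [Ioo_mem_nhdsGT hε'] with s hs using ⟨(hsm s hs).1.le, (hsm s hs).2⟩
    have := hxs.sub h2
    rwa [R.m_zero, sub_self] at this

theorem tanh_injective {a b : ℝ} (h : Real.sinh a / Real.cosh a = Real.sinh b / Real.cosh b) :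
    a = b := by
  rw [div_eq_div_iff (Real.cosh_pos _).ne' (Real.cosh_pos _).ne'] at h
  have : Real.sinh (a - b) = 0 := by rw [Real.sinh_sub]; linarith
  linarith [Real.sinh_eq_zero.1 this]

/-- Near the pole both solutions are given by the same formulas in K and m. Standard uniqueness does
not apply here because the system is singular at r = 0. -/
theorem ProfileSol.eventually_unique (hφ : SmoothPos φ) {r₁ w₁ r₂ w₂ : ℝ → ℝ} {L₁ L₂ : ℝ}
    (h₁ : 0 < L₁) (h₂ : 0 < L₂) (P₁ : ProfileSol φ L₁ r₁ w₁) (Q₁ : PoleLimits φ r₁ w₁)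
    (P₂ : ProfileSol φ L₂ r₂ w₂) (Q₂ : PoleLimits φ r₂ w₂) :
    ∀ᶠ s in 𝓝[>] 0, r₁ s = r₂ s ∧ w₁ s = w₂ s := by
  obtain ⟨K, δ, η, C⟩ := exists_poleCurvature hφ
  obtain ⟨m, ε, η', R⟩ := C.exists_ratio
  filter_upwards [P₁.eventually_eq C R h₁ Q₁, P₂.eventually_eq C R h₂ Q₂] with s e1 e2
  exact ⟨tanh_injective (e1.1.trans e2.1.symm), e1.2.trans e2.2.symm⟩

end Unique

/-! ## Existence of surfaces of the class near the axis -/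

/-- With `t = s²`, the function `b = h / s²` solves `t b' = heightField (t, b)`. -/
def heightField (K m : ℝ → ℝ) (p : ℝ × ℝ) : ℝ := K (p.1 * m p.1 ^ 2) * m p.1 / 2 - p.2

theorem PoleRatio.exists_height {φ K m : ℝ → ℝ} {δ ε η η' : ℝ} (C : PoleCurvature φ K δ η)
    (R : PoleRatio K m δ ε η') : ∃ b : ℝ → ℝ, ∃ ε' > 0, ε' ≤ ε ∧
      ContDiffOn ℝ ∞ b (Set.Ico 0 ε') ∧
      ∀ t ∈ Set.Ioo 0 ε', HasDerivAt b (heightField K m (t, b t) / t) t := by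
  have h1 : ContDiffOn ℝ ∞ (fun t => K (t * m t ^ 2)) (Set.Ico 0 ε) :=
    C.smooth.comp (contDiffOn_id.mul (R.smooth.pow 2)) R.maps
  have h2 : ContDiffOn ℝ ∞ (fun t => K (t * m t ^ 2) * m t / 2) (Set.Ico 0 ε) :=
    (h1.mul R.smooth).div_const 2
  have hG : ContDiffOn ℝ ∞ (heightField K m) (Set.Ico 0 ε ×ˢ Set.univ) :=
    (h2.comp contDiffOn_fst fun p hp => hp.1).sub contDiffOn_snd
  have hg : HasDerivAt (fun z => heightField K m (0, z)) (-1) (K (0 * m 0 ^ 2) * m 0 / 2) :=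
    HasDerivAt.const_sub (K (0 * m 0 ^ 2) * m 0 / 2) (hasDerivAt_id' _)
  obtain ⟨ε', hε', hle, b, -, -, hb, hbo⟩ := singular_exists R.ε_pos isOpen_univ hG
    (y₀ := K (0 * m 0 ^ 2) * m 0 / 2) (g := -1) (Set.mem_univ _) (by simp [heightField])
    hg (by norm_num) (by norm_num)
  exact ⟨b, ε', hε', hle, hb, hbo⟩

/-- The three singular solutions K, m, b are assembled through tanh r = s m(s²), w = K tanh r and h
= s² b(s²). All of them are smooth functions of s² up to trivial factors, and ‖z‖² is smooth on the
plane, whence smoothness of the surface at the pole. -/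
theorem exists_profile_at_pole {φ : ℝ → ℝ} (hφ : SmoothPos φ) :
    ∃ L > 0, ∃ r h w : ℝ → ℝ, r 0 = 0 ∧ ProfileSol φ L r w ∧ PoleLimits φ r w ∧
      (∀ s ∈ Set.Ioo 0 L, HasDerivAt h (w s) s) ∧
      ContDiffOn ℝ ∞ (rotMap r h) (Metric.ball 0 L) := by
  obtain ⟨K, δ, η, C⟩ := exists_poleCurvature hφ
  obtain ⟨m, ε₀, η', R⟩ := C.exists_ratio
  obtain ⟨b, ε, hε, hεle, hb, hbo⟩ := R.exists_height C
  have hsub : Set.Ico 0 ε ⊆ Set.Ico 0 ε₀ := Set.Ico_subset_Ico_right hεle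
  have hms := R.smooth.mono hsub
  have hT : ∀ t ∈ Set.Ico 0 ε, t * m t ^ 2 ∈ Set.Ico 0 δ := fun t ht => R.maps t (hsub ht)
  have hT1 : ∀ t ∈ Set.Ico 0 ε, 0 < 1 - t * m t ^ 2 := fun t ht => by
    have := (hT t ht).2; have := C.δ_lt; linarith
  have h1T : ContDiffOn ℝ ∞ (fun t => √(1 - t * m t ^ 2)) (Set.Ico 0 ε) :=
    (contDiffOn_const.sub (contDiffOn_id.mul (hms.pow 2))).sqrt fun t ht => (hT1 t ht).ne'
  have h1Tn : ∀ t ∈ Set.Ico 0 ε, √(1 - t * m t ^ 2) ≠ 0 := fun t ht =>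
    (Real.sqrt_pos.2 (hT1 t ht)).ne'
  -- q(s²) = sinh r / s, by sinh = tanh / √(1 - tanh²).
  set q : ℝ → ℝ := fun t => m t / √(1 - t * m t ^ 2) with hq
  have hqs : ContDiffOn ℝ ∞ q (Set.Ico 0 ε) := hms.div h1T h1Tn
  set r : ℝ → ℝ := fun s => Real.arsinh (s * q (s ^ 2)) with hr
  set h : ℝ → ℝ := fun s => s ^ 2 * b (s ^ 2) with hh
  set μ : ℝ → ℝ := fun s => s * m (s ^ 2) with hμ
  set w : ℝ → ℝ := fun s => K (μ s ^ 2) * μ s with hw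
  set L := √ε with hL
  have hLpos : 0 < L := Real.sqrt_pos.2 hε
  have hLsq : L ^ 2 = ε := Real.sq_sqrt hε.le
  have hsm : ∀ s ∈ Set.Ico 0 L, s ^ 2 ∈ Set.Ico 0 ε := fun s hs =>
    ⟨sq_nonneg s, by rw [← hLsq]; exact pow_lt_pow_left₀ hs.2 hs.1 two_ne_zero⟩
  have hsm' : ∀ s ∈ Set.Ioo 0 L, s ^ 2 ∈ Set.Ioo 0 ε := fun s hs =>
    ⟨by have := hs.1; positivity, (hsm s ⟨hs.1.le, hs.2⟩).2⟩
  have hμT : ∀ s, s ^ 2 * m (s ^ 2) ^ 2 = μ s ^ 2 := fun s => by rw [hμ]; ring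
  have hμm : ∀ s ∈ Set.Ico 0 L, μ s ^ 2 ∈ Set.Ico 0 δ := fun s hs => by
    rw [← hμT]; exact hT _ (hsm s hs)
  have hμpos : ∀ s ∈ Set.Ioo 0 L, 0 < μ s := fun s hs =>
    mul_pos hs.1 (R.pos _ (hsub (hsm s ⟨hs.1.le, hs.2⟩)))
  have hμ1 : ∀ s ∈ Set.Ico 0 L, 0 < 1 - μ s ^ 2 := fun s hs => by
    rw [← hμT]; exact hT1 _ (hsm s hs)
  have hsinh : ∀ s, Real.sinh (r s) = s * q (s ^ 2) := fun s => Real.sinh_arsinh _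
  have hsinh' : ∀ s, Real.sinh (r s) = μ s / √(1 - μ s ^ 2) := fun s => by
    rw [hsinh, hq, ← hμT, hμ]; ring
  have hcosh : ∀ s ∈ Set.Ico 0 L, Real.cosh (r s) = 1 / √(1 - μ s ^ 2) := by
    intro s hs
    have hp := hμ1 s hs
    have h0 := (Real.sqrt_pos.2 hp).ne'
    have h2 : Real.cosh (r s) ^ 2 = (1 / √(1 - μ s ^ 2)) ^ 2 := by
      rw [Real.cosh_sq, hsinh', div_pow, div_pow, Real.sq_sqrt hp.le]
      field_simp
      ring
    exact (pow_left_inj₀ (Real.cosh_pos _).le (by positivity) two_ne_zero).1 h2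
  have hcoth : ∀ s ∈ Set.Ioo 0 L, parallelCurvature (r s) (w s) = K (μ s ^ 2) := by
    intro s hs
    have hp := hμ1 s ⟨hs.1.le, hs.2⟩
    have h0 := (Real.sqrt_pos.2 hp).ne'
    have h1 := (hμpos s hs).ne'
    rw [parallelCurvature, hcosh s ⟨hs.1.le, hs.2⟩, hsinh', hw]
    field_simp
  have hwsq : ∀ s, 1 - w s ^ 2 = 1 - K (μ s ^ 2) ^ 2 * μ s ^ 2 := fun s => by rw [hw]; ring
  have dμ : ∀ s ∈ Set.Ioo 0 L, HasDerivAt μ ((1 - μ s ^ 2) * √(1 - w s ^ 2)) s := by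
    intro s hs
    have h1 : HasDerivAt (fun s => m (s ^ 2)) _ s :=
      HasDerivAt.comp (h₂ := m) (h := fun s : ℝ => s ^ 2) s
        (R.ode _ ⟨(hsm' s hs).1, (hsm' s hs).2.trans_le hεle⟩) ((hasDerivAt_id s).fun_pow 2)
    refine ((hasDerivAt_id s).fun_mul h1).congr_deriv ?_
    simp only [ratioField, tanhSpeed, id]
    rw [hμT, hwsq]
    have := hs.1.ne'
    norm_num
    field_simp
    ring
  have hX : ContDiffOn ℝ ∞ (rotMap r h) (Metric.ball 0 L) := by
    have hn : ContDiffOn ℝ ∞ (fun z : ℂ => ‖z‖ ^ 2) (Metric.ball 0 L) :=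
      (contDiff_norm_sq ℝ).contDiffOn
    have hmap : Set.MapsTo (fun z : ℂ => ‖z‖ ^ 2) (Metric.ball 0 L) (Set.Ico 0 ε) := fun z hz =>
      hsm _ ⟨norm_nonneg z, by simpa using hz⟩
    have hre : ContDiffOn ℝ ∞ (fun z : ℂ => z.re) (Metric.ball 0 L) :=
      Complex.reCLM.contDiff.contDiffOn
    have him : ContDiffOn ℝ ∞ (fun z : ℂ => z.im) (Metric.ball 0 L) :=
      Complex.imCLM.contDiff.contDiffOn
    -- The singular factor 1/‖z‖ in the parametrization cancels against sinh r = ‖z‖ q(‖z‖²).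
    have hray : ∀ z : ℂ, ∀ x : ℝ, (x ≠ 0 → z ≠ 0) →
        Real.sinh (r ‖z‖) * (x / ‖z‖) = q (‖z‖ ^ 2) * x := by
      intro z x hx
      by_cases h0 : x = 0
      · simp [h0]
      · have := norm_ne_zero_iff.2 (hx h0)
        rw [hsinh]; field_simp
    rw [contDiffOn_pi]
    intro i
    fin_cases i
    · have h2 : ContDiffOn ℝ ∞ (fun t => 1 / √(1 - t * m t ^ 2)) (Set.Ico 0 ε) :=
        contDiffOn_const.div h1T h1Tn
      refine (h2.comp hn hmap).congr fun z hz => ?_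
      have := hcosh ‖z‖ ⟨norm_nonneg z, by simpa using hz⟩
      simp [rotMap, this, hμT]
    · refine ((hqs.comp hn hmap).mul hre).congr fun z hz => ?_
      exact hray z z.re (by rintro h1 rfl; simp at h1)
    · refine ((hqs.comp hn hmap).mul him).congr fun z hz => ?_
      exact hray z z.im (by rintro h1 rfl; simp at h1)
    · exact hn.mul (hb.comp hn hmap)
  have hlim : ∀ {f : ℝ → ℝ} {ε' : ℝ}, 0 < ε' → ContDiffOn ℝ ∞ f (Set.Ico 0 ε') → ∀ {g : ℝ → ℝ},
      Tendsto g (𝓝[>] 0) (𝓝 0) → (∀ᶠ s in 𝓝[>] 0, g s ∈ Set.Ico 0 ε') →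
      Tendsto (fun s => f (g s)) (𝓝[>] 0) (𝓝 (f 0)) := by
    intro f ε' hε' hf g hg hm
    have h1 : ContinuousWithinAt f (Set.Ico 0 ε') 0 := hf.continuousOn 0 ⟨le_rfl, hε'⟩
    exact Tendsto.comp (f := g) h1 (tendsto_nhdsWithin_iff.2 ⟨hg, hm⟩)
  have hs0 : Tendsto (fun s : ℝ => s ^ 2) (𝓝[>] 0) (𝓝 0) := by
    simpa using tendsto_id_nhdsGT_zero.pow 2
  have hsev : ∀ᶠ s : ℝ in 𝓝[>] 0, s ^ 2 ∈ Set.Ico 0 ε := by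
    filter_upwards [Ioo_mem_nhdsGT hLpos] with s hs using hsm s ⟨hs.1.le, hs.2⟩
  have hμ0 : Tendsto μ (𝓝[>] 0) (𝓝 0) := by
    have := tendsto_id_nhdsGT_zero.mul (hlim hε hms hs0 hsev)
    rwa [zero_mul] at this
  have hK0 : Tendsto (fun s => K (μ s ^ 2)) (𝓝[>] 0) (𝓝 (φ 1 + 1)) := by
    rw [← C.K_zero]
    refine hlim C.δ_pos C.smooth (by simpa using hμ0.pow 2) ?_
    filter_upwards [Ioo_mem_nhdsGT hLpos] with s hs using hμm s ⟨hs.1.le, hs.2⟩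
  refine ⟨L, hLpos, r, h, w, by simp [hr], ?_, ?_, ?_, hX⟩
  · have hK : ∀ s ∈ Set.Ioo 0 L, μ s ^ 2 ∈ Set.Ioo 0 δ := fun s hs =>
      ⟨by have := hμpos s hs; positivity, (hμm s ⟨hs.1.le, hs.2⟩).2⟩
    have hwp : ∀ s ∈ Set.Ioo 0 L, 0 < w s := fun s hs =>
      mul_pos (C.pos _ (Set.Ioo_subset_Ico_self (hK s hs))) (hμpos s hs)
    have hlt : ∀ s ∈ Set.Ioo 0 L, 0 < 1 - w s ^ 2 := fun s hs => by
      rw [hwsq]; exact C.lt_one _ (Set.Ioo_subset_Ico_self (hK s hs))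
    refine ⟨?_, hwp, ?_, ?_, ?_, ?_⟩
    · intro s hs
      rw [← Real.sinh_pos_iff, hsinh']
      exact div_pos (hμpos s hs) (Real.sqrt_pos.2 (hμ1 s ⟨hs.1.le, hs.2⟩))
    · intro s hs
      have := hlt s hs
      have := hwp s hs
      nlinarith
    · intro s hs
      rw [hcoth s hs, hwsq]
      exact C.gap _ (Set.Ioo_subset_Ico_self (hK s hs))
    · intro s hs
      have hp := hμ1 s ⟨hs.1.le, hs.2⟩
      have hrt := (Real.sqrt_pos.2 hp).ne'
      have h1 : HasDerivAt (fun s => μ s / √(1 - μ s ^ 2)) _ s :=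
        (dμ s hs).fun_div ((((dμ s hs).fun_pow 2).const_sub 1).sqrt hp.ne') hrt
      have h2 : r = fun s => Real.arsinh (μ s / √(1 - μ s ^ 2)) := by
        funext s; rw [← hsinh', Real.arsinh_sinh]
      rw [h2]
      refine h1.arsinh.congr_deriv ?_
      have h3 : √(1 + (μ s / √(1 - μ s ^ 2)) ^ 2) = 1 / √(1 - μ s ^ 2) := by
        rw [← hcosh s ⟨hs.1.le, hs.2⟩, ← hsinh', ← Real.cosh_arsinh, Real.arsinh_sinh]
      rw [h3]
      have h4 : √(1 - μ s ^ 2) ^ 2 = 1 - μ s ^ 2 := Real.sq_sqrt hp.le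
      rw [smul_eq_mul]
      norm_num
      rw [← h4]
      field_simp
      rw [h4]
      linear_combination (-(μ s ^ 2 * √(1 - w s ^ 2))) * h4
    · intro s hs
      have h1 : HasDerivAt (fun s => K (μ s ^ 2)) _ s :=
        HasDerivAt.comp (h₂ := K) (h := fun s : ℝ => μ s ^ 2) s
          (C.ode _ (hK s hs)) ((dμ s hs).fun_pow 2)
      refine (h1.fun_mul (dμ s hs)).congr_deriv ?_
      rw [hcoth s hs]
      have hp := (hμ1 s ⟨hs.1.le, hs.2⟩).ne'
      have h2 := (hμpos s hs).ne'
      simp only [curvatureField]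
      rw [← hwsq]
      generalize otherCurvature φ (K (μ s ^ 2)) (1 - w s ^ 2) = κ
      norm_num
      field_simp
      ring
  · refine ⟨?_, ?_, ?_⟩
    · have h1 := hlim hε hqs hs0 hsev
      have h2 : q 0 = 1 := by simp [hq, R.m_zero]
      rw [h2] at h1
      refine h1.congr' ?_
      filter_upwards [self_mem_nhdsWithin] with s hs
      have : s ≠ 0 := ne_of_gt hs
      rw [hsinh]; field_simp
    · have := hK0.mul hμ0
      rwa [mul_zero] at this
    · refine hK0.congr' ?_
      filter_upwards [Ioo_mem_nhdsGT hLpos] with s hs using (hcoth s hs).symm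
  · intro s hs
    have h1 : HasDerivAt (fun s => b (s ^ 2)) _ s :=
      HasDerivAt.comp (h₂ := b) (h := fun s : ℝ => s ^ 2) s
        (hbo _ (hsm' s hs)) ((hasDerivAt_id s).fun_pow 2)
    refine (((hasDerivAt_id s).fun_pow 2).fun_mul h1).congr_deriv ?_
    simp only [heightField, id]
    rw [hμT]
    have := hs.1.ne'
    simp only [hw, hμ]
    norm_num
    field_simp
    ring

theorem exists_inClass {φ : ℝ → ℝ} (hφ : SmoothPos φ) : ∃ S, InClass φ S := by
  obtain ⟨L, hL, r, h, w, hr0, P, Q, hh, hX⟩ := exists_profile_at_pole hφ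
  have hp : ∀ s ∈ Set.Ioo 0 L, ContDiffAt ℝ ∞ r s ∧ ContDiffAt ℝ ∞ h s := fun s hs =>
    contDiffAt_profile hs.1 (hX.contDiffAt (Metric.isOpen_ball.mem_nhds (by
      simp [abs_of_pos hs.1, hs.2])))
  obtain ⟨S, -, -, -, -, hS⟩ := exists_rotSurface hL hφ.1.continuousOn hr0 P Q (τ := 1)
    (one_pow 2) (fun s hs => by rw [one_mul]; exact hh s hs) (fun s hs => (hp s hs).1)
    (fun s hs => (hp s hs).2) (hX.contDiffAt (Metric.ball_mem_nhds _ hL))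
  exact ⟨S, hS⟩

/-! ## Inextendible surfaces -/

section Congr

variable {X Y : ℂ → L4} {z : ℂ}

theorem firstForm_congr (h : X =ᶠ[𝓝 z] Y) (v w : ℂ) : firstForm X z v w = firstForm Y z v w := by
  rw [firstForm, firstForm, h.fderiv_eq]

theorem secondForm_congr (h : X =ᶠ[𝓝 z] Y) (N : L4) (v w : ℂ) :
    secondForm X N z v w = secondForm Y N z v w := by
  have h1 : (fun y => fderiv ℝ X y w) =ᶠ[𝓝 z] fun y => fderiv ℝ Y y w := by
    filter_upwards [h.fderiv (𝕜 := ℝ)] with y hy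
    rw [hy]
  rw [secondForm, secondForm, h1.fderiv_eq]

theorem isUnitNormal_congr (h : X =ᶠ[𝓝 z] Y) {N : L4} (hN : IsUnitNormal X z N) :
    IsUnitNormal Y z N := by
  rw [IsUnitNormal, ← h.fderiv_eq, ← h.eq_of_nhds]
  exact hN

theorem arePrincipalCurvatures_congr (h : X =ᶠ[𝓝 z] Y) {N : L4} {k₁ k₂ : ℝ}
    (hP : ArePrincipalCurvatures X N z k₁ k₂) : ArePrincipalCurvatures Y N z k₁ k₂ := by
  obtain ⟨v₁, v₂, h1, h2, h3⟩ := hP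
  refine ⟨v₁, v₂, h1, fun w => ?_, fun w => ?_⟩
  · rw [← secondForm_congr h, ← firstForm_congr h]; exact h2 w
  · rw [← secondForm_congr h, ← firstForm_congr h]; exact h3 w

end Congr

/-! ### Unions of chains of surfaces -/

namespace RotSurface

theorem Extends.trans {S T U : RotSurface} (h1 : U.Extends T) (h2 : T.Extends S) :
    U.Extends S := by
  refine ⟨h2.1.trans h1.1, fun s hs hl => ?_, fun z hz => ?_⟩
  · obtain ⟨a, b⟩ := h1.2.1 s hs (hl.trans_le h2.1)
    obtain ⟨a', b'⟩ := h2.2.1 s hs hl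
    exact ⟨a.trans a', b.trans b'⟩
  · have hz' : z ∈ T.dom := lt_of_lt_of_le hz h2.1
    exact (h1.2.2 z hz').trans (h2.2.2 z hz)

theorem Extends.refl (S : RotSurface) : S.Extends S :=
  ⟨le_rfl, fun _ _ _ => ⟨rfl, rfl⟩, fun _ _ => rfl⟩

/-- A surface that locally coincides with surfaces of a family. -/
theorem exists_union {φ : ℝ → ℝ} {c : Set RotSurface} (hc : c.Nonempty)
    (hchain : ∀ S ∈ c, ∀ T ∈ c, S.Extends T ∨ T.Extends S) (hφ : ∀ S ∈ c, InClass φ S) :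
    ∃ U, InClass φ U ∧ ∀ S ∈ c, U.Extends S := by
  classical
  set ℓ : ℝ≥0∞ := ⨆ S ∈ c, S.ℓ with hℓ
  have hlt : ∀ x : ℝ≥0∞, x < ℓ ↔ ∃ S ∈ c, x < S.ℓ := fun x => by simp [hℓ, lt_iSup_iff]
  have hle : ∀ S ∈ c, S.ℓ ≤ ℓ := fun S hS => le_iSup₂_of_le S hS le_rfl
  have hprof : ∀ S ∈ c, ∀ T ∈ c, ∀ s : ℝ, 0 ≤ s → ENNReal.ofReal s < S.ℓ → ENNReal.ofReal s < T.ℓ →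
      S.r s = T.r s ∧ S.h s = T.h s := by
    intro S hS T hT s hs h1 h2
    rcases hchain S hS T hT with h | h
    · exact h.2.1 s hs h2
    · obtain ⟨a, b⟩ := h.2.1 s hs h1
      exact ⟨a.symm, b.symm⟩
  have hnorm : ∀ S ∈ c, ∀ T ∈ c, ∀ z ∈ S.dom, z ∈ T.dom → S.N z = T.N z := by
    intro S hS T hT z h1 h2
    rcases hchain S hS T hT with h | h
    · exact h.2.2 z h2
    · exact (h.2.2 z h1).symm
  -- A member of the chain that reaches beyond the radius x. By the chain condition the choice does
  -- not affect the values; beyond the union's radius the default is arbitrary.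
  let pick : ℝ≥0∞ → RotSurface := fun x => if h : ∃ S ∈ c, x < S.ℓ then h.choose else hc.some
  have hpick : ∀ x, x < ℓ → pick x ∈ c ∧ x < (pick x).ℓ := by
    intro x hx
    have h := (hlt x).1 hx
    simp only [pick, dif_pos h]
    exact h.choose_spec
  let r : ℝ → ℝ := fun s => (pick (ENNReal.ofReal s)).r s
  let h : ℝ → ℝ := fun s => (pick (ENNReal.ofReal s)).h s
  let N : ℂ → L4 := fun z => (pick ‖z‖ₑ).N z
  have hrh : ∀ S ∈ c, ∀ s : ℝ, 0 ≤ s → ENNReal.ofReal s < S.ℓ → r s = S.r s ∧ h s = S.h s := by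
    intro S hS s hs hl
    obtain ⟨h1, h2⟩ := hpick _ (hl.trans_le (hle S hS))
    exact hprof _ h1 S hS s hs h2 hl
  have hN : ∀ S ∈ c, ∀ z ∈ S.dom, N z = S.N z := by
    intro S hS z hz
    obtain ⟨h1, h2⟩ := hpick ‖z‖ₑ (lt_of_lt_of_le hz (hle S hS))
    exact hnorm _ h1 S hS z h2 hz
  have hXe : ∀ S ∈ c, ∀ z ∈ S.dom, rotMap S.r S.h =ᶠ[𝓝 z] rotMap r h := by
    intro S hS z hz
    filter_upwards [(isOpen_disk S.ℓ).mem_nhds hz] with y hy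
    obtain ⟨a, b⟩ := hrh S hS ‖y‖ (norm_nonneg y) ((mem_disk_iff y).1 hy)
    rw [rotMap, rotMap, a, b]
  have hdisk : ∀ z ∈ disk ℓ, ∃ S ∈ c, z ∈ S.dom := fun z hz => (hlt _).1 hz
  have hNe : ∀ S ∈ c, ∀ z ∈ S.dom, S.N =ᶠ[𝓝 z] N := by
    intro S hS z hz
    filter_upwards [(isOpen_disk S.ℓ).mem_nhds hz] with y hy using (hN S hS y hy).symm
  have h0 : (0 : ℝ≥0∞) < ℓ := hc.some.ℓ_pos.trans_le (hle _ hc.some_mem)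
  have hzero : (0:ℂ) ∈ disk ℓ := by rw [mem_disk_iff]; simpa using h0
  let U : RotSurface :=
    { ℓ := ℓ
      r := r
      h := h
      N := N
      ℓ_pos := h0
      r_zero := by
        obtain ⟨S, hS, hz⟩ := hdisk 0 hzero
        rw [(hrh S hS 0 le_rfl (by simpa using S.ℓ_pos)).1, S.r_zero]
      r_pos := by
        intro s hs hl
        obtain ⟨S, hS, hl'⟩ := (hlt _).1 hl
        rw [(hrh S hS s hs.le hl').1]
        exact S.r_pos s hs hl'
      smooth := by
        intro z hz
        obtain ⟨S, hS, hz'⟩ := hdisk z hz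
        exact ((S.contDiffAt hz').congr_of_eventuallyEq (hXe S hS z hz').symm).contDiffWithinAt
      immersed := by
        intro z hz
        obtain ⟨S, hS, hz'⟩ := hdisk z hz
        rw [← (hXe S hS z hz').fderiv_eq]
        exact S.immersed z hz'
      unit_speed := by
        intro z hz u hu hzu
        obtain ⟨S, hS, hz'⟩ := hdisk z hz
        rw [← firstForm_congr (hXe S hS z hz')]
        exact S.unit_speed z hz' u hu hzu
      orthogonal := by
        intro v
        obtain ⟨S, hS, hz'⟩ := hdisk 0 hzero
        rw [← (hXe S hS 0 hz').fderiv_eq]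
        exact S.orthogonal v
      normal_cont := by
        intro z hz
        obtain ⟨S, hS, hz'⟩ := hdisk z hz
        exact ((S.normal_cont.continuousAt ((isOpen_disk _).mem_nhds hz')).congr
          (hNe S hS z hz')).continuousWithinAt
      normal := by
        intro z hz
        obtain ⟨S, hS, hz'⟩ := hdisk z hz
        rw [hN S hS z hz']
        exact isUnitNormal_congr (hXe S hS z hz') (S.normal z hz') }
  refine ⟨U, ?_, fun S hS => ⟨hle S hS, hrh S hS, hN S hS⟩⟩
  intro z hz
  obtain ⟨S, hS, hz'⟩ := hdisk z hz
  obtain ⟨k₁, k₂, hP, hW⟩ := hφ S hS z hz'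
  have hang : U.angle z = S.angle z := by
    rw [RotSurface.angle, RotSurface.angle]
    exact congrArg (fun n => mink n ![0, 0, 0, 1]) (hN S hS z hz')
  refine ⟨k₁, k₂, ?_, by rw [hang]; exact hW⟩
  have := arePrincipalCurvatures_congr (hXe S hS z hz') hP
  rw [← hN S hS z hz'] at this
  exact this

end RotSurface

/-- Zorn's lemma for the extension order on the surfaces of the class: a local surface at the pole
makes it nonempty, and unions bound chains. -/
theorem exists_canonicalExample {φ : ℝ → ℝ} (hφ : SmoothPos φ) :
    ∃ S, IsCanonicalExample φ S := by
  obtain ⟨S₀, hS₀⟩ := exists_inClass hφ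
  let rel : {S // InClass φ S} → {S // InClass φ S} → Prop := fun a b => b.1.Extends a.1
  have : Nonempty {S // InClass φ S} := ⟨⟨S₀, hS₀⟩⟩
  obtain ⟨M, hM⟩ := exists_maximal_of_nonempty_chains_bounded (r := rel) (fun c hc hne => by
    obtain ⟨U, hU, hUe⟩ := RotSurface.exists_union (φ := φ) (c := Subtype.val '' c)
      (hne.image _) (by
        rintro _ ⟨a, ha, rfl⟩ _ ⟨b, hb, rfl⟩
        by_cases hab : a = b
        · rw [hab]; exact Or.inl (RotSurface.Extends.refl _)
        · exact (hc ha hb hab).symm) (by rintro _ ⟨a, -, rfl⟩; exact a.2)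
    exact ⟨⟨U, hU⟩, fun a ha => hUe _ ⟨a, ha, rfl⟩⟩) (fun h1 h2 => h2.trans h1)
  refine ⟨M.1, M.2, fun T hT hTM => ?_⟩
  exact le_antisymm (hM ⟨T, hT⟩ hTM).1 hTM.1

/-! ## Continuation of solutions of the profile equation -/

/-- The profile equation as an autonomous system for `(r, w)`. -/
def profileField (φ : ℝ → ℝ) (p : ℝ × ℝ) : ℝ × ℝ :=
  (√(1 - p.2 ^ 2), √(1 - p.2 ^ 2) * otherCurvature φ (parallelCurvature p.1 p.2) (1 - p.2 ^ 2))

/-- The domain of the profile equation. -/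
def profileDomain (φ : ℝ → ℝ) : Set (ℝ × ℝ) :=
  {p | 0 < p.1 ∧ 0 < p.2 ∧ p.2 < 1 ∧ φ (1 - p.2 ^ 2) < parallelCurvature p.1 p.2}

variable {φ : ℝ → ℝ}

theorem contDiffAt_class_slope (hφ : ContDiffOn ℝ ∞ φ (Set.Icc 0 1)) {p : ℝ × ℝ} (h0 : 0 < p.2)
    (h1 : p.2 < 1) : ContDiffAt ℝ ∞ (fun p : ℝ × ℝ => φ (1 - p.2 ^ 2)) p := by
  have h2 : ContDiffAt ℝ ∞ φ (1 - p.2 ^ 2) :=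
    hφ.contDiffAt (Icc_mem_nhds (by nlinarith) (by nlinarith))
  exact ContDiffAt.comp (f := fun p : ℝ × ℝ => 1 - p.2 ^ 2) p h2 (by fun_prop)

theorem contDiffAt_parallelCurvature {p : ℝ × ℝ} (h0 : 0 < p.1) :
    ContDiffAt ℝ ∞ (fun p : ℝ × ℝ => parallelCurvature p.1 p.2) p := by
  have h1 : ContDiffAt ℝ ∞ (fun p : ℝ × ℝ => p.1) p := contDiffAt_fst
  exact contDiffAt_snd.mul (h1.cosh.div h1.sinh (Real.sinh_pos_iff.2 h0).ne')

theorem contDiffAt_profileField (hφ : ContDiffOn ℝ ∞ φ (Set.Icc 0 1)) {p : ℝ × ℝ}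
    (hp : p ∈ profileDomain φ) : ContDiffAt ℝ ∞ (profileField φ) p := by
  obtain ⟨h1, h2, h3, h4⟩ := hp
  have c1 := contDiffAt_class_slope hφ h2 h3
  have c2 := contDiffAt_parallelCurvature h1 (p := p)
  have c3 : ContDiffAt ℝ ∞ (fun p : ℝ × ℝ => √(1 - p.2 ^ 2)) p :=
    ContDiffAt.sqrt (by fun_prop) (by nlinarith)
  exact c3.prodMk (c3.mul (c1.add (contDiffAt_const.div (c2.sub c1) (sub_pos.2 h4).ne')))

theorem eventually_profileDomain (hφ : ContDiffOn ℝ ∞ φ (Set.Icc 0 1)) {p : ℝ × ℝ}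
    (hp : p ∈ profileDomain φ) : ∀ᶠ q in 𝓝 p, q ∈ profileDomain φ := by
  obtain ⟨h1, h2, h3, h4⟩ := hp
  have c1 := (contDiffAt_class_slope hφ h2 h3).continuousAt
  have c2 := (contDiffAt_parallelCurvature h1 (p := p)).continuousAt
  filter_upwards [continuousAt_fst.eventually (lt_mem_nhds h1),
    continuousAt_snd.eventually (lt_mem_nhds h2), continuousAt_snd.eventually (gt_mem_nhds h3),
    c1.eventually_lt c2 h4] with q q1 q2 q3 q4 using ⟨q1, q2, q3, q4⟩

/-! ### Uniqueness of the solution leaving the pole -/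

section Solutions

variable {L : ℝ} {r w : ℝ → ℝ}

theorem ProfileSol.mem_domain (P : ProfileSol φ L r w) {s : ℝ} (hs : s ∈ Set.Ioo 0 L) :
    (r s, w s) ∈ profileDomain φ := ⟨P.r_pos s hs, P.w_pos s hs, P.w_lt s hs, P.gap s hs⟩

theorem ProfileSol.hasDerivAt (P : ProfileSol φ L r w) {s : ℝ} (hs : s ∈ Set.Ioo 0 L) :
    HasDerivAt (fun s => (r s, w s)) (profileField φ (r s, w s)) s :=
  (P.dr s hs).prodMk (P.dw s hs)

/-- The set of local agreement is open, nonempty by uniqueness at the pole, and relatively closed in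
(0, L) because the field is locally Lipschitz in the domain of the equation; (0, L) is connected. -/
theorem ProfileSol.unique (hφ : SmoothPos φ) {r₁ w₁ r₂ w₂ : ℝ → ℝ} (hL : 0 < L)
    (P₁ : ProfileSol φ L r₁ w₁) (Q₁ : PoleLimits φ r₁ w₁)
    (P₂ : ProfileSol φ L r₂ w₂) (Q₂ : PoleLimits φ r₂ w₂) :
    ∀ s ∈ Set.Ioo 0 L, r₁ s = r₂ s ∧ w₁ s = w₂ s := by
  set Z₁ : ℝ → ℝ × ℝ := fun s => (r₁ s, w₁ s) with hZ₁
  set Z₂ : ℝ → ℝ × ℝ := fun s => (r₂ s, w₂ s) with hZ₂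
  set A : Set ℝ := {s | Z₁ =ᶠ[𝓝 s] Z₂} with hA
  have hAo : IsOpen A := isOpen_setOfPred_eventually_nhds
  have hne : (Set.Ioo 0 L ∩ A).Nonempty := by
    obtain ⟨ε, hε, hE⟩ := (nhdsGT_basis (0:ℝ)).eventually_iff.1
      (P₁.eventually_unique hφ hL hL Q₁ P₂ Q₂)
    have hm : min ε L / 2 ∈ Set.Ioo 0 (min ε L) :=
      ⟨by positivity, by have : 0 < min ε L := by positivity
                         linarith⟩
    refine ⟨min ε L / 2, ⟨hm.1, hm.2.trans_le (min_le_right _ _)⟩, ?_⟩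
    filter_upwards [isOpen_Ioo.mem_nhds hm] with s hs
    obtain ⟨a, b⟩ := hE ⟨hs.1, hs.2.trans_le (min_le_left _ _)⟩
    simp only [hZ₁, hZ₂, a, b]
  have hcl : closure A ∩ Set.Ioo 0 L ⊆ A := by
    rintro s ⟨hsA, hs⟩
    have hc₁ : ContinuousAt Z₁ s := (P₁.hasDerivAt hs).continuousAt
    have hc₂ : ContinuousAt Z₂ s := (P₂.hasDerivAt hs).continuousAt
    have heq : Z₁ s = Z₂ s := by
      have h1 : ∃ᶠ t in 𝓝 s, Z₁ t = Z₂ t :=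
        (mem_closure_iff_frequently.1 hsA).mono fun t ht => ht.self_of_nhds
      by_contra hne
      have h2 : ∀ᶠ t in 𝓝 s, Z₁ t ≠ Z₂ t := by
        have := (hc₁.prodMk hc₂).eventually (isClosed_diagonal.isOpen_compl.mem_nhds
          (show (Z₁ s, Z₂ s) ∈ (Set.diagonal (ℝ × ℝ))ᶜ from hne))
        filter_upwards [this] with t ht using ht
      exact h1 h2
    have hcd : ContDiffAt ℝ 1 (profileField φ) (Z₁ s) :=
      (contDiffAt_profileField hφ.1 (P₁.mem_domain hs)).of_le (by norm_cast)
    obtain ⟨k, U, hU, hLip⟩ := hcd.exists_lipschitzOnWith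
    have hU₂ : U ∈ 𝓝 (Z₂ s) := heq ▸ hU
    have hIo := isOpen_Ioo.mem_nhds hs
    refine ODE_solution_unique_of_eventually (v := fun _ => profileField φ) (s := fun _ => U)
      (K := k) (Eventually.of_forall fun _ => hLip) ?_ ?_ heq
    · filter_upwards [hIo, hc₁ hU] with t ht hu using ⟨P₁.hasDerivAt ht, hu⟩
    · filter_upwards [hIo, hc₂ hU₂] with t ht hu using ⟨P₂.hasDerivAt ht, hu⟩
  intro s hs
  have h1 : s ∈ A := isPreconnected_Ioo.subset_of_closure_inter_subset hAo hne hcl hs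
  have h2 := h1.self_of_nhds
  exact ⟨congrArg Prod.fst h2, congrArg Prod.snd h2⟩

end Solutions

/-- A function with bounded derivative has a limit at the right end. -/
theorem exists_tendsto_of_bounded_deriv {f f' : ℝ → ℝ} {L B : ℝ}
    (hf : ∀ s ∈ Set.Ioo 0 L, HasDerivAt f (f' s) s) (hB : ∀ s ∈ Set.Ioo 0 L, |f' s| ≤ B) :
    Tendsto f (𝓝[<] L) (𝓝 (limUnder (𝓝[<] L) f)) ∨ L ≤ 0 := by
  by_cases hL : 0 < L
  swap
  · exact Or.inr (not_lt.1 hL)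
  left
  apply tendsto_nhds_limUnder
  have hlip : LipschitzOnWith (B.toNNReal) f (Set.Ioo 0 L) := by
    refine (convex_Ioo 0 L).lipschitzOnWith_of_nnnorm_hasDerivWithin_le
      (fun s hs => (hf s hs).hasDerivWithinAt) fun s hs => ?_
    rw [← NNReal.coe_le_coe, coe_nnnorm, Real.norm_eq_abs]
    exact (hB s hs).trans (Real.le_coe_toNNReal B)
  obtain ⟨g, hg, hfg⟩ := hlip.extend_real
  refine ⟨g L, (hg.continuous.continuousAt.tendsto.mono_left nhdsWithin_le_nhds).congr' ?_⟩
  filter_upwards [Ioo_mem_nhdsLT hL] with s hs using (hfg hs).symm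

/-- Gluing two integral curves. -/
theorem hasDerivAt_glue {E : Type*} [NormedAddCommGroup E] [NormedSpace ℝ E] {f : E → E}
    {Z α : ℝ → E} {a L ε : ℝ} {p : E} (haL : a < L) (hε : 0 < ε)
    (hZ : ∀ s ∈ Set.Ioo a L, HasDerivAt Z (f (Z s)) s) (hlim : Tendsto Z (𝓝[<] L) (𝓝 p))
    (hfp : ContinuousAt f p) (hα0 : α L = p)
    (hα : ∀ s ∈ Set.Ioo (L - ε) (L + ε), HasDerivAt α (f (α s)) s) :
    ∀ s ∈ Set.Ioo a (L + ε), HasDerivAt (fun s => if s < L then Z s else α s)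
      (f (if s < L then Z s else α s)) s := by
  intro s hs
  rcases lt_trichotomy s L with h | rfl | h
  · rw [if_pos h]
    refine (hZ s ⟨hs.1, h⟩).congr_of_eventuallyEq ?_
    filter_upwards [gt_mem_nhds h] with t ht using if_pos ht
  · rw [if_neg (lt_irrefl s), hα0]
    -- At the junction the left derivative exists because the derivatives on the left converge to f
    -- p; it equals the derivative of α from the right.
    have hleft : HasDerivWithinAt (fun t => if t < s then Z t else α t) (f p) (Set.Iic s) s := by
      have hd : ∀ t ∈ Set.Ioo a s, HasDerivAt (fun t => if t < s then Z t else α t) (f (Z t)) t :=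
        fun t ht => (hZ t ht).congr_of_eventuallyEq (by
          filter_upwards [gt_mem_nhds ht.2] with x hx using if_pos hx)
      refine hasDerivWithinAt_Iic_of_tendsto_deriv (s := Set.Ioo a s)
        (fun t ht => (hd t ht).differentiableAt.differentiableWithinAt) ?_ (Ioo_mem_nhdsLT haL) ?_
      · have h1 : Tendsto (fun t => if t < s then Z t else α t) (𝓝[<] s) (𝓝 p) := by
          refine hlim.congr' ?_
          filter_upwards [self_mem_nhdsWithin] with t ht using (if_pos ht).symm
        have h2 : (if s < s then Z s else α s) = p := by rw [if_neg (lt_irrefl s), hα0]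
        rw [ContinuousWithinAt, h2]
        exact h1.mono_left (nhdsWithin_mono _ fun t ht => ht.2)
      · refine (hfp.tendsto.comp hlim).congr' ?_
        filter_upwards [Ioo_mem_nhdsLT haL] with t ht using (hd t ht).deriv.symm
    have hright : HasDerivWithinAt (fun t => if t < s then Z t else α t) (f p) (Set.Ici s) s := by
      have h1 := (hα s ⟨by linarith, by linarith⟩).hasDerivWithinAt (s := Set.Ici s)
      rw [hα0] at h1
      refine h1.congr (fun t ht => if_neg (not_lt.2 ht)) (if_neg (lt_irrefl s))
    have := hleft.union hright
    rwa [Set.Iic_union_Ici, hasDerivWithinAt_univ] at this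
  · rw [if_neg (not_lt.2 h.le)]
    refine (hα s ⟨by linarith, hs.2⟩).congr_of_eventuallyEq ?_
    filter_upwards [lt_mem_nhds h] with t ht using if_neg (not_lt.2 ht.le)

/-- The profile equation with the height. -/
def heightedField (φ : ℝ → ℝ) (τ : ℝ) (p : ℝ × ℝ × ℝ) : ℝ × ℝ × ℝ :=
  ((profileField φ (p.1, p.2.1)).1, (profileField φ (p.1, p.2.1)).2, τ * p.2.1)

theorem contDiffAt_heightedField (hφ : ContDiffOn ℝ ∞ φ (Set.Icc 0 1)) (τ : ℝ) {p : ℝ × ℝ × ℝ}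
    (hp : (p.1, p.2.1) ∈ profileDomain φ) : ContDiffAt ℝ ∞ (heightedField φ τ) p := by
  have h1 : ContDiffAt ℝ ∞ (fun p : ℝ × ℝ × ℝ => profileField φ (p.1, p.2.1)) p :=
    ContDiffAt.comp (f := fun p : ℝ × ℝ × ℝ => (p.1, p.2.1)) p (contDiffAt_profileField hφ hp)
      (by fun_prop)
  exact h1.fst.prodMk (h1.snd.prodMk (by fun_prop))

/-- Solutions of the profile equation are smooth. -/
theorem ProfileSol.contDiffAt (hφ : ContDiffOn ℝ ∞ φ (Set.Icc 0 1)) {L : ℝ} {r w h : ℝ → ℝ} {τ : ℝ}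
    (P : ProfileSol φ L r w) (hh : ∀ s ∈ Set.Ioo 0 L, HasDerivAt h (τ * w s) s) {s : ℝ}
    (hs : s ∈ Set.Ioo 0 L) : ContDiffAt ℝ ∞ r s ∧ ContDiffAt ℝ ∞ h s := by
  set u : Set (ℝ × ℝ × ℝ) := {p | (p.1, p.2.1) ∈ profileDomain φ} with hu
  have hsub : Set.Icc (s / 2) ((s + L) / 2) ⊆ Set.Ioo 0 L := fun t ht =>
    ⟨by have := hs.1; linarith [ht.1], by have := hs.2; linarith [ht.2]⟩
  have hF : ContDiffOn ℝ ((⊤ : ℕ∞) : WithTop ℕ∞)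
      (Function.uncurry fun _ : ℝ => heightedField φ τ)
      (Set.Icc (s / 2) ((s + L) / 2) ×ˢ u) := fun p hp =>
    (ContDiffAt.comp (f := fun p : ℝ × ℝ × ℝ × ℝ => p.2) p (contDiffAt_heightedField hφ τ hp.2)
      contDiffAt_snd).contDiffWithinAt
  have hZ := ODE.contDiffOn_enat_Icc_of_hasDerivWithinAt (α := fun s => (r s, w s, h s)) hF
    (fun t ht => ((P.dr t (hsub ht)).prodMk ((P.dw t (hsub ht)).prodMk
      (hh t (hsub ht)))).hasDerivWithinAt) (fun t ht => P.mem_domain (hsub ht))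
  have hat : ContDiffAt ℝ ∞ (fun s => (r s, w s, h s)) s :=
    hZ.contDiffAt (Icc_mem_nhds (by linarith [hs.1]) (by linarith [hs.2]))
  exact ⟨hat.fst, hat.snd.snd⟩

/-- A solution with bounded curvature can be continued as long as the profile curve is not
vertical. -/
theorem ProfileSol.exists_extension (hφ : SmoothPos φ) {L : ℝ} {r w h : ℝ → ℝ} {τ : ℝ}
    (hτ : τ ^ 2 = 1) (hL : 0 < L) (P : ProfileSol φ L r w)
    (hh : ∀ s ∈ Set.Ioo 0 L, HasDerivAt h (τ * w s) s) {w₁ B : ℝ} (hw₁ : w₁ < 1)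
    (hw : ∀ s ∈ Set.Ioo 0 L, w s ≤ w₁) (hB : ∀ s ∈ Set.Ioo 0 L,
      otherCurvature φ (parallelCurvature (r s) (w s)) (1 - w s ^ 2) ≤ B) :
    ∃ L' > L, ∃ r' w' h' : ℝ → ℝ, (∀ s < L, r' s = r s ∧ w' s = w s ∧ h' s = h s) ∧
      ProfileSol φ L' r' w' ∧ ∀ s ∈ Set.Ioo 0 L', HasDerivAt h' (τ * w' s) s := by
  have hφpos : ∀ s ∈ Set.Ioo 0 L, 0 < φ (1 - w s ^ 2) := fun s hs =>
    hφ.2 _ ⟨(P.one_sub_pos hs).le, sub_le_self _ (sq_nonneg _)⟩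
  have hsq1 : ∀ s ∈ Set.Ioo 0 L, √(1 - w s ^ 2) ≤ 1 := fun s hs =>
    Real.sqrt_le_one.2 (sub_le_self _ (sq_nonneg _))
  have hκ : ∀ s ∈ Set.Ioo 0 L, 0 < otherCurvature φ (parallelCurvature (r s) (w s)) (1 - w s ^ 2) :=
    fun s hs => (hφpos s hs).trans (weingartenFn_otherCurvature (P.gap s hs)).2
  have hL2 : L / 2 ∈ Set.Ioo 0 L := ⟨by linarith, by linarith⟩
  have hBpos : 0 < B := (hκ _ hL2).trans_le (hB _ hL2)
  -- Since φ > 0, the bound B on φ + 1/(l - φ) bounds l - φ from below by 1/B. This survives the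
  -- limit and keeps the endpoint inside the domain.
  have hgap : ∀ s ∈ Set.Ioo 0 L,
      1 / B ≤ parallelCurvature (r s) (w s) - φ (1 - w s ^ 2) := by
    intro s hs
    have h1 := hB s hs
    have h2 := sub_pos.2 (P.gap s hs)
    rw [otherCurvature] at h1
    have h3 : 1 / (parallelCurvature (r s) (w s) - φ (1 - w s ^ 2)) ≤ B := by
      linarith [hφpos s hs]
    rw [div_le_iff₀ h2] at h3
    rw [div_le_iff₀ hBpos]
    linarith
  have l1 := (exists_tendsto_of_bounded_deriv (B := 1) P.dr fun s hs => by
    rw [abs_of_nonneg (Real.sqrt_nonneg _)]; exact hsq1 s hs).resolve_right (not_le.2 hL)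
  have l2 := (exists_tendsto_of_bounded_deriv (B := B) P.dw fun s hs => by
    rw [abs_of_nonneg (mul_nonneg (Real.sqrt_nonneg _) (hκ s hs).le)]
    calc _ ≤ 1 * B := mul_le_mul (hsq1 s hs) (hB s hs) (hκ s hs).le zero_le_one
      _ = B := one_mul B).resolve_right (not_le.2 hL)
  have l3 := (exists_tendsto_of_bounded_deriv (B := 1) hh fun s hs => by
    have h1 : |τ| = 1 := by rw [← sq_eq_sq₀ (abs_nonneg _) zero_le_one, sq_abs, hτ, one_pow]
    rw [abs_mul, h1, one_mul, abs_of_pos (P.w_pos s hs)]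
    exact (P.w_lt s hs).le).resolve_right (not_le.2 hL)
  set r₀ := limUnder (𝓝[<] L) r
  set w₀ := limUnder (𝓝[<] L) w
  set h₀ := limUnder (𝓝[<] L) h
  -- Both r and w are nondecreasing, so their limits are at least their positive values at L / 2.
  have hmono : ∀ {f f' : ℝ → ℝ} {f₀ : ℝ}, (∀ s ∈ Set.Ioo 0 L, HasDerivAt f (f' s) s) →
      (∀ s ∈ Set.Ioo 0 L, 0 ≤ f' s) → Tendsto f (𝓝[<] L) (𝓝 f₀) → f (L / 2) ≤ f₀ := by
    intro f f' f₀ hd hp hl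
    have hanti := antitoneOn_Ioo_of_hasDerivAt (f := fun s => -f s) (fun s hs => (hd s hs).neg)
      (fun s hs => neg_nonpos.2 (hp s hs))
    refine ge_of_tendsto hl ?_
    filter_upwards [Ioo_mem_nhdsLT hL2.2] with s hs
    have := hanti hL2 ⟨hL2.1.trans hs.1, hs.2⟩ hs.1.le
    simpa using this
  have hI := Ioo_mem_nhdsLT hL
  have hr₀ : 0 < r₀ := (P.r_pos _ hL2).trans_le
    (hmono P.dr (fun s _ => Real.sqrt_nonneg _) l1)
  have hw₀ : 0 < w₀ := (P.w_pos _ hL2).trans_le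
    (hmono P.dw (fun s hs => mul_nonneg (Real.sqrt_nonneg _) (hκ s hs).le) l2)
  have hw₀' : w₀ < 1 := by
    refine lt_of_le_of_lt (le_of_tendsto l2 ?_) hw₁
    filter_upwards [hI] with s hs using hw s hs
  have hdom : (r₀, w₀) ∈ profileDomain φ := by
    refine ⟨hr₀, hw₀, hw₀', ?_⟩
    have l12 := l1.prodMk_nhds l2
    have t1 := (contDiffAt_parallelCurvature (p := (r₀, w₀)) hr₀).continuousAt.tendsto.comp l12
    have t2 := (contDiffAt_class_slope (p := (r₀, w₀)) hφ.1 hw₀ hw₀').continuousAt.tendsto.comp l12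
    have h1 : 1 / B ≤ parallelCurvature r₀ w₀ - φ (1 - w₀ ^ 2) := by
      refine ge_of_tendsto (t1.sub t2) ?_
      filter_upwards [hI] with s hs using hgap s hs
    have : 0 < 1 / B := by positivity
    simp only
    linarith
  have hcd := contDiffAt_heightedField hφ.1 τ (p := (r₀, w₀, h₀)) hdom
  obtain ⟨α, hα0, ε, hε, hα⟩ :=
    (hcd.of_le (m := 1) (by norm_cast)).exists_forall_mem_closedBall_exists_eq_forall_mem_Ioo_hasDerivAt₀ L
  have hαc : ContinuousAt α L := (hα L ⟨by linarith, by linarith⟩).continuousAt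
  have hev : ∀ᶠ s in 𝓝 L, ((α s).1, (α s).2.1) ∈ profileDomain φ := by
    have h1 : ContinuousAt (fun s => ((α s).1, (α s).2.1)) L :=
      hαc.fst.prodMk hαc.snd.fst
    refine h1.eventually (eventually_profileDomain hφ.1 ?_)
    simp only [hα0]; exact hdom
  obtain ⟨ε', hε', hE⟩ := Metric.eventually_nhds_iff.1 hev
  set e := min ε ε' with he
  have hepos : 0 < e := by positivity
  set Z : ℝ → ℝ × ℝ × ℝ := fun s => if s < L then (r s, w s, h s) else α s with hZ
  have hglue := hasDerivAt_glue (f := heightedField φ τ) (Z := fun s => (r s, w s, h s)) (α := α)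
    (p := (r₀, w₀, h₀)) hL hepos
    (fun s hs => (P.dr s hs).prodMk ((P.dw s hs).prodMk (hh s hs)))
    (l1.prodMk_nhds (l2.prodMk_nhds l3)) hcd.continuousAt hα0
    (fun s hs => hα s ⟨by linarith [hs.1, min_le_left ε ε'], by linarith [hs.2, min_le_left ε ε']⟩)
  have hZd : ∀ s ∈ Set.Ioo 0 (L + e), ((Z s).1, (Z s).2.1) ∈ profileDomain φ := by
    intro s hs
    by_cases h : s < L
    · simp only [hZ, if_pos h]
      exact P.mem_domain ⟨hs.1, h⟩
    · simp only [hZ, if_neg h]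
      refine hE ?_
      rw [Real.dist_eq, abs_of_nonneg (by linarith)]
      linarith [hs.2, min_le_right ε ε']
  refine ⟨L + e, by linarith, fun s => (Z s).1, fun s => (Z s).2.1, fun s => (Z s).2.2, ?_, ?_, ?_⟩
  · intro s hs
    simp [hZ, if_pos hs]
  · exact ⟨fun s hs => (hZd s hs).1, fun s hs => (hZd s hs).2.1, fun s hs => (hZd s hs).2.2.1,
      fun s hs => (hZd s hs).2.2.2, fun s hs => (hglue s hs).fst,
      fun s hs => (hglue s hs).snd.fst⟩
  · exact fun s hs => (hglue s hs).snd.snd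

/-- A surface of the class of finite length, with bounded curvature and nowhere vertical up to the
boundary, is extendible. -/
theorem ClassProfile.exists_extension (hφ : SmoothPos φ) {S : RotSurface} {τ L c B : ℝ}
    (C : ClassProfile φ S τ) (hL : 0 < L) (hℓ : S.ℓ = ENNReal.ofReal L) (hc : 0 < c)
    (hr : ∀ s ∈ Set.Ioo 0 L, c ≤ deriv S.r s)
    (hB : ∀ s ∈ Set.Ioo 0 L, otherCurvature φ (parallelCurvature (S.r s) (τ * deriv S.h s))
      (deriv S.r s ^ 2) ≤ B) :
    ∃ T, InClass φ T ∧ T.Extends S ∧ T.ℓ ≠ S.ℓ := by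
  have hpar : ∀ s ∈ Set.Ioo 0 L, s ∈ S.params := fun s hs =>
    ⟨hs.1, by rw [hℓ]; exact (ENNReal.ofReal_lt_ofReal_iff hL).2 hs.2⟩
  have P : ProfileSol φ L S.r fun s => τ * deriv S.h s :=
    C.profileSol hℓ.ge (fun s hs => hc.trans_le (hr s hs)) fun s hs => rfl
  obtain ⟨-, Q⟩ := C.poleLimits hφ.1.continuousOn
  have hh : ∀ s ∈ Set.Ioo 0 L, HasDerivAt S.h (τ * (τ * deriv S.h s)) s := fun s hs => by
    rw [← mul_assoc, ← sq, C.sq_sign, one_mul]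
    exact ((S.contDiffAt_profile (hpar s hs)).2.differentiableAt (by simp)).hasDerivAt
  -- The bound r' ≥ c reads w² = 1 - r'² ≤ 1 - c², so w stays below √(1 - c²) < 1.
  obtain ⟨L', hL', r, w, h, heq, P', hh'⟩ := P.exists_extension hφ C.sq_sign hL hh
    (w₁ := √(1 - c ^ 2)) (B := B)
    (by rw [Real.sqrt_lt' one_pos]; nlinarith)
    (fun s hs => by
      have h1 := C.deriv_sq (hpar s hs)
      have h2 := hr s hs
      refine Real.le_sqrt_of_sq_le ?_
      nlinarith)
    (fun s hs => by rw [← C.deriv_sq (hpar s hs)]; exact hB s hs)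
  have hL'0 : 0 < L' := hL.trans hL'
  have Q' : PoleLimits φ r w := by
    have hI := Ioo_mem_nhdsGT hL
    refine ⟨Q.sinh_div.congr' ?_, Q.slope.congr' ?_, Q.curvature.congr' ?_⟩
    · filter_upwards [hI] with s hs
      rw [(heq s hs.2).1]
    · filter_upwards [hI] with s hs using (heq s hs.2).2.1.symm
    · filter_upwards [hI] with s hs
      rw [(heq s hs.2).1, (heq s hs.2).2.1]
  have h0 : (0:ℂ) ∈ disk S.ℓ := by rw [mem_disk_iff]; simpa using S.ℓ_pos
  have hX0 : ContDiffAt ℝ ∞ (rotMap r h) 0 := by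
    refine (S.contDiffAt h0).congr_of_eventuallyEq ?_
    filter_upwards [(isOpen_disk S.ℓ).mem_nhds h0] with z hz
    rw [hℓ, mem_disk_ofReal] at hz
    rw [rotMap, rotMap, (heq _ hz).1, (heq _ hz).2.2]
  have hsm := fun (s : ℝ) (hs : s ∈ Set.Ioo 0 L') => P'.contDiffAt hφ.1 hh' hs
  obtain ⟨T, hTℓ, hTr, hTh, hTN, hT⟩ := exists_rotSurface hL'0 hφ.1.continuousOn
    (by rw [(heq 0 hL).1, S.r_zero]) P' Q' C.sq_sign hh' (fun s hs => (hsm s hs).1)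
    (fun s hs => (hsm s hs).2) hX0
  have hle : S.ℓ ≤ T.ℓ := by rw [hℓ, hTℓ]; exact ENNReal.ofReal_le_ofReal hL'.le
  have hNe : ∀ z ∈ S.dom, z ≠ 0 → T.N z = S.N z := by
    intro z hz hz0
    have hs : ‖z‖ ∈ Set.Ioo 0 L := ⟨norm_pos_iff.2 hz0, by
      rw [RotSurface.dom, hℓ, mem_disk_ofReal] at hz; exact hz⟩
    have h1 := C.normal_eq _ (hpar _ hs) _ (norm_div_norm hz0)
    have h2 := rotNormal_ray τ r h (norm_div_norm hz0) hs.1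
    rw [norm_mul_div_norm hz0] at h1 h2
    have er : r =ᶠ[𝓝 ‖z‖] S.r := by
      filter_upwards [gt_mem_nhds hs.2] with t ht using (heq t ht).1
    have eh : h =ᶠ[𝓝 ‖z‖] S.h := by
      filter_upwards [gt_mem_nhds hs.2] with t ht using (heq t ht).2.2
    rw [hTN, h1, h2, er.eq_of_nhds, er.deriv_eq, eh.deriv_eq]
  refine ⟨T, hT, ⟨hle, ?_, ?_⟩, ?_⟩
  · intro s hs hl
    rw [hℓ, ENNReal.ofReal_lt_ofReal_iff hL] at hl
    rw [hTr, hTh]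
    exact ⟨(heq s hl).1, (heq s hl).2.2⟩
  · intro z hz
    by_cases hz0 : z = 0
    · rw [hz0]
      -- At the pole the profile does not determine the normal; the two normals agree there by
      -- continuity.
      have t1 : Tendsto T.N (𝓝[≠] 0) (𝓝 (T.N 0)) :=
        ((T.normal_cont.continuousAt ((isOpen_disk _).mem_nhds (lt_of_lt_of_le h0 hle)))).tendsto
          |>.mono_left nhdsWithin_le_nhds
      have t2 : Tendsto S.N (𝓝[≠] 0) (𝓝 (S.N 0)) :=
        ((S.normal_cont.continuousAt ((isOpen_disk _).mem_nhds h0))).tendsto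
          |>.mono_left nhdsWithin_le_nhds
      refine tendsto_nhds_unique t1 (t2.congr' ?_)
      filter_upwards [self_mem_nhdsWithin,
        mem_nhdsWithin_of_mem_nhds ((isOpen_disk S.ℓ).mem_nhds h0)] with y hy hyd
      exact (hNe y hyd (by simpa using hy)).symm
    · exact hNe z hz hz0
  · rw [hTℓ, hℓ]
    exact ((ENNReal.ofReal_lt_ofReal_iff hL'0).2 hL').ne'

/-! ## Monotonicity of the slope of the profile curve -/

section

variable {φ : ℝ → ℝ} {S : RotSurface} {τ : ℝ}

theorem ClassProfile.deriv_sq_mem (C : ClassProfile φ S τ) {s : ℝ} (hs : s ∈ S.params) :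
    deriv S.r s ^ 2 ∈ Set.Ico (0:ℝ) 1 := by
  have h1 := C.deriv_sq hs
  have h2 := C.w_pos s hs
  exact ⟨sq_nonneg _, by rw [h1]; nlinarith⟩

theorem ClassProfile.lt_otherCurvature (C : ClassProfile φ S τ) {s : ℝ} (hs : s ∈ S.params) :
    φ (deriv S.r s ^ 2) < otherCurvature φ (parallelCurvature (S.r s) (τ * deriv S.h s))
      (deriv S.r s ^ 2) := (weingartenFn_otherCurvature (C.gap s hs)).2

theorem ClassProfile.otherCurvature_pos (hφ : ∀ v ∈ Set.Icc (0:ℝ) 1, 0 < φ v)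
    (C : ClassProfile φ S τ) {s : ℝ} (hs : s ∈ S.params) :
    0 < otherCurvature φ (parallelCurvature (S.r s) (τ * deriv S.h s)) (deriv S.r s ^ 2) :=
  (hφ _ (Set.Ico_subset_Icc_self (C.deriv_sq_mem hs))).trans (C.lt_otherCurvature hs)

/-- r'' = -w κ, with both factors positive. -/
theorem ClassProfile.strictAntiOn_deriv (hφ : ∀ v ∈ Set.Icc (0:ℝ) 1, 0 < φ v)
    (C : ClassProfile φ S τ) : StrictAntiOn (deriv S.r) S.params := by
  refine strictAntiOn_of_deriv_neg S.ordConnected_params.convex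
    (fun s hs => (C.dr s hs).continuousAt.continuousWithinAt) fun s hs => ?_
  have hs' := interior_subset hs
  rw [(C.dr s hs').deriv]
  have := mul_pos (C.w_pos s hs') (C.otherCurvature_pos hφ hs')
  linarith

theorem coth_anti {a b : ℝ} (hb : 0 < b) (hab : b ≤ a) :
    Real.cosh a / Real.sinh a ≤ Real.cosh b / Real.sinh b := by
  rw [div_le_div_iff₀ (Real.sinh_pos_iff.2 (hb.trans_le hab)) (Real.sinh_pos_iff.2 hb)]
  have h1 : 0 ≤ Real.sinh (a - b) := Real.sinh_nonneg_iff.2 (by linarith)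
  rw [Real.sinh_sub] at h1
  linarith

theorem eq_of_eqOn_Ioo {f g : ℝ → ℝ} {a b : ℝ} (hab : a < b) (h : Set.EqOn f g (Set.Ioo a b))
    (hf : ContinuousAt f b) (hg : ContinuousAt g b) : f b = g b := by
  refine tendsto_nhds_unique (hf.tendsto.mono_left (nhdsWithin_le_nhds (s := Set.Iio b)))
    ((hg.tendsto.mono_left (nhdsWithin_le_nhds (s := Set.Iio b))).congr' ?_)
  filter_upwards [Ioo_mem_nhdsLT hab] with s hs using (h hs).symm

theorem RotSurface.mem_params_of_le (S : RotSurface) {s t : ℝ} (ht : t ∈ S.params) (hs : 0 < s)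
    (hst : s ≤ t) : s ∈ S.params :=
  ⟨hs, (ENNReal.ofReal_le_ofReal hst).trans_lt ht.2⟩

/-! ## Modifications of the class function -/

/-- Add to φ₀ a multiple of a smooth function that is positive on v < y² and vanishes with all its
derivatives from y² on; the multiple is chosen to exceed the threshold at y²/4. -/
theorem exists_isModification {φ₀ : ℝ → ℝ} (h₀ : ContDiffOn ℝ ∞ φ₀ (Set.Icc 0 1)) (x : ℝ) {y : ℝ}
    (hy : 0 < y) : ∃ φ, IsModification φ₀ φ x y := by
  have hy2 : 0 < y ^ 2 := by positivity
  set M := √(1 - y ^ 2 / 4) * (Real.cosh x / Real.sinh x) - φ₀ (y ^ 2 / 4) with hM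
  have hb : 0 < expNegInvGlue (y ^ 2 - y ^ 2 / 4) := expNegInvGlue.pos_of_pos (by linarith)
  set c := (|M| + 1) / expNegInvGlue (y ^ 2 - y ^ 2 / 4) with hc
  have hcpos : 0 < c := by positivity
  refine ⟨fun v => φ₀ v + c * expNegInvGlue (y ^ 2 - v), ?_, ?_, ?_, ?_⟩
  · refine h₀.add (ContDiff.contDiffOn ?_)
    exact contDiff_const.mul ((expNegInvGlue.contDiff (n := (⊤ : ℕ∞))).comp
      (contDiff_const.sub contDiff_id))
  · intro v hv
    simp [expNegInvGlue.zero_of_nonpos (sub_nonpos.2 hv.1)]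
  · intro v hv
    have := mul_pos hcpos (expNegInvGlue.pos_of_pos (sub_pos.2 hv.2))
    linarith
  · have h1 : c * expNegInvGlue (y ^ 2 - y ^ 2 / 4) = |M| + 1 := div_mul_cancel₀ _ hb.ne'
    simp only [h1]
    linarith [le_abs_self M]

theorem IsModification.smoothPos {φ₀ φ : ℝ → ℝ} {x y : ℝ} (h₀ : SmoothPos φ₀)
    (hM : IsModification φ₀ φ x y) : SmoothPos φ := by
  refine ⟨hM.1, fun v hv => ?_⟩
  rcases le_or_gt (y ^ 2) v with h | h
  · rw [hM.2.1 v ⟨h, hv.2⟩]; exact h₀.2 v hv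
  · exact (h₀.2 v hv).trans (hM.2.2.1 v ⟨hv.1, h⟩)

theorem isGeneralWeingarten_weingartenFn (hφ : ContDiffOn ℝ ∞ φ (Set.Icc 0 1)) :
    IsGeneralWeingarten (weingartenFn φ) := by
  refine ⟨?_, fun k₁ k₂ v _ => by rw [weingartenFn, weingartenFn]; ring, ?_⟩
  · have h1 : ContDiffOn ℝ ∞ (fun p : ℝ × ℝ × ℝ => φ p.2.2)
        {p : ℝ × ℝ × ℝ | p.2.2 ∈ Set.Icc (0:ℝ) 1} :=
      hφ.comp (contDiff_snd.snd.contDiffOn) fun p hp => hp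
    exact ((contDiff_fst.contDiffOn.sub h1).mul (contDiff_snd.fst.contDiffOn.sub h1)).sub
      contDiffOn_const
  · intro k₁ k₂ v _ h
    have d1 : HasDerivAt (fun k => weingartenFn φ k k₂ v) (1 * (k₂ - φ v)) k₁ :=
      (((hasDerivAt_id k₁).sub_const (φ v)).mul_const (k₂ - φ v)).sub_const 1
    have d2 : HasDerivAt (fun k => weingartenFn φ k₁ k v) ((k₁ - φ v) * 1) k₂ :=
      (((hasDerivAt_id k₂).sub_const (φ v)).const_mul (k₁ - φ v)).sub_const 1
    rw [d1.deriv, d2.deriv]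
    rw [weingartenFn] at h
    nlinarith

/-- The profile curves of the modified class never become as steep as half the slope at the
parameter where the modification starts. -/
theorem IsModification.half_lt_deriv {φ₀ : ℝ → ℝ} {S₀ : RotSurface} {τ₀ ε : ℝ}
    (h₀ : SmoothPos φ₀) (C₀ : ClassProfile φ₀ S₀ τ₀) (hε : ε ∈ S₀.params)
    (hy : 0 < deriv S₀.r ε) (hM : IsModification φ₀ φ (S₀.r ε) (deriv S₀.r ε))
    (C : ClassProfile φ S τ) {s : ℝ} (hs : s ∈ S.params) : deriv S₀.r ε / 2 < deriv S.r s := by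
  have hφ := hM.smoothPos h₀
  set y := deriv S₀.r ε with hyd
  have hy1 : y < 1 := by have := (C₀.deriv_sq_mem hε).2; nlinarith
  have hA := C.strictAntiOn_deriv hφ.2
  have hA₀ := C₀.strictAntiOn_deriv h₀.2
  obtain ⟨hlim, Q⟩ := C.poleLimits hφ.1.continuousOn
  obtain ⟨-, Q₀⟩ := C₀.poleLimits h₀.1.continuousOn
  by_contra hle
  rw [not_lt] at hle
  -- If the slope drops to y/2 or lower, then it takes the value y/2, as it tends to 1 > y/2 at the
  -- pole.
  obtain ⟨s₁, hs₁, hd⟩ : ∃ s₁ ∈ S.params, deriv S.r s₁ = y / 2 := by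
    have h1 : ∀ᶠ t in 𝓝[>] 0, y / 2 < deriv S.r t := hlim.eventually_const_lt (by linarith)
    obtain ⟨t, h2, h3⟩ := (h1.and (Ioo_mem_nhdsGT hs.1)).exists
    have hsub : Set.Icc t s ⊆ S.params := fun a ha =>
      S.mem_params_of_le hs (h3.1.trans_le ha.1) ha.2
    obtain ⟨a, ha, h4⟩ := intermediate_value_Icc' h3.2.le
      (fun a ha => (C.dr a (hsub ha)).continuousAt.continuousWithinAt) ⟨hle, h2.le⟩
    exact ⟨a, hsub ha, h4⟩
  have hgt : ∀ t ∈ Set.Ioo 0 s₁, y / 2 < deriv S.r t := fun t ht => by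
    rw [← hd]
    exact hA (S.mem_params_of_le hs₁ ht.1 ht.2.le) hs₁ ht.2
  have hge₀ : ∀ t, 0 < t → t ≤ ε → y ≤ deriv S₀.r t := fun t h1 h2 =>
    hA₀.antitoneOn (S₀.mem_params_of_le hε h1 h2) hε h2
  set m := min s₁ ε with hm
  have hm0 : 0 < m := lt_min hs₁.1 hε.1
  have P : ProfileSol φ m S.r fun s => τ * deriv S.h s :=
    C.profileSol ((ENNReal.ofReal_le_ofReal (min_le_left _ _)).trans hs₁.2.le)
      (fun t ht => by linarith [hgt t ⟨ht.1, ht.2.trans_le (min_le_left _ _)⟩]) fun _ _ => rfl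
  -- Up to ε the squared slope of S₀ is at least y², where φ = φ₀; so S₀ solves the equation of φ
  -- too and can be compared with S.
  have P₀ : ProfileSol φ m S₀.r fun s => τ₀ * deriv S₀.h s := by
    refine C₀.profileSol ((ENNReal.ofReal_le_ofReal (min_le_right _ _)).trans hε.2.le)
      (fun t ht => by linarith [hge₀ t ht.1 (ht.2.le.trans (min_le_right _ _))])
      fun t ht => hM.2.1 _ ⟨?_, ?_⟩
    · exact pow_le_pow_left₀ hy.le (hge₀ t ht.1 (ht.2.le.trans (min_le_right _ _))) 2
    · exact (C₀.deriv_sq_mem (S₀.mem_params_of_le hε ht.1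
        (ht.2.le.trans (min_le_right _ _)))).2.le
  have Q₀' : PoleLimits φ S₀.r fun s => τ₀ * deriv S₀.h s :=
    ⟨Q₀.sinh_div, Q₀.slope, by
      rw [hM.2.1 1 ⟨by nlinarith, le_rfl⟩]; exact Q₀.curvature⟩
  have heq : Set.EqOn S.r S₀.r (Set.Ioo 0 m) := fun t ht =>
    (ProfileSol.unique hφ hm0 P Q P₀ Q₀' t ht).1
  -- If s₁ ≤ ε, then r' = r₀' ≥ y at s₁, contradicting r'(s₁) = y/2. If s₁ > ε, the radius has grown
  -- from x on, and the inequality φ < l at s₁ contradicts the value prescribed at y²/4.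
  rcases le_or_gt s₁ ε with hse | hse
  · have hmem := S₀.mem_params_of_le hε hs₁.1 hse
    rw [min_eq_left hse] at hm
    have h1 : deriv S.r s₁ = deriv S₀.r s₁ := by
      refine eq_of_eqOn_Ioo hs₁.1 (fun t ht => ?_) (C.dr s₁ hs₁).continuousAt
        (C₀.dr s₁ hmem).continuousAt
      refine (Filter.EventuallyEq.deriv_eq ?_)
      rw [← hm] at ht
      filter_upwards [isOpen_Ioo.mem_nhds ht] with a ha using heq ha
    have := hge₀ s₁ hs₁.1 hse
    linarith
  · rw [min_eq_right hse.le] at hm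
    have hmem := S.mem_params_of_le hs₁ hε.1 hse.le
    have h1 : S.r ε = S₀.r ε := eq_of_eqOn_Ioo hε.1 (hm ▸ heq)
      (S.contDiffAt_profile hmem).1.continuousAt (S₀.contDiffAt_profile hε).1.continuousAt
    have h2 : S.r ε ≤ S.r s₁ := by
      have hsub : Set.Icc ε s₁ ⊆ S.params := fun a ha =>
        S.mem_params_of_le hs₁ (hε.1.trans_le ha.1) ha.2
      refine (monotoneOn_of_deriv_nonneg (convex_Icc ε s₁) (fun a ha =>
        (S.contDiffAt_profile (hsub ha)).1.continuousAt.continuousWithinAt) (fun a ha =>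
        ((S.contDiffAt_profile (hsub (interior_subset ha))).1.differentiableAt
          (by simp)).differentiableWithinAt) fun a ha => ?_) ⟨le_rfl, hse.le⟩ ⟨hse.le, le_rfl⟩ hse.le
      rw [interior_Icc] at ha
      linarith [hgt a ⟨hε.1.trans ha.1, ha.2⟩]
    have hx : 0 < S₀.r ε := S₀.r_pos ε hε.1 hε.2
    have h3 := C.gap s₁ hs₁
    have h4 := C.deriv_sq hs₁
    have h5 : τ * deriv S.h s₁ = √(1 - y ^ 2 / 4) := by
      rw [← Real.sqrt_sq (C.w_pos s₁ hs₁).le]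
      congr 1
      rw [hd] at h4
      linarith
    rw [hd, h5, parallelCurvature, show (y / 2) ^ 2 = y ^ 2 / 4 by ring] at h3
    have h6 := mul_le_mul_of_nonneg_left (coth_anti hx (h1 ▸ h2)) (Real.sqrt_nonneg (1 - y ^ 2 / 4))
    exact absurd hM.2.2.2 (not_lt.2 (h3.le.trans h6))

/-- If the slope stays away from zero, then the profile curve has finite length. -/
theorem ClassProfile.exists_length (hφ : SmoothPos φ) (C : ClassProfile φ S τ) {c : ℝ} (hc : 0 < c)
    (hr : ∀ s ∈ S.params, c < deriv S.r s) : ∃ L : ℝ, 0 < L ∧ S.ℓ = ENNReal.ofReal L := by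
  obtain ⟨v₀, hv₀, hmin⟩ := isCompact_Icc.exists_isMinOn (Set.nonempty_Icc.2 zero_le_one)
    hφ.1.continuousOn
  have hb := hφ.2 v₀ hv₀
  have hne : S.ℓ ≠ ⊤ := by
    intro htop
    have hp : ∀ s : ℝ, 0 < s → s ∈ S.params := fun s hs => ⟨hs, by rw [htop]; simp⟩
    -- T is the time in which w, growing at rate at least c min φ, gains 1. Starting at T instead of
    -- the pole, w(2T) ≥ w(T) + 1 > 1, which is impossible.
    set T := 1 / (c * φ v₀) with hT
    have hTpos : 0 < T := by positivity
    have hmono : MonotoneOn (fun s => τ * deriv S.h s - c * φ v₀ * s) (Set.Ici T) := by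
      have hd : ∀ s, T ≤ s → HasDerivAt (fun s => τ * deriv S.h s - c * φ v₀ * s) _ s :=
        fun s hs => (C.dw s (hp s (hTpos.trans_le hs))).sub ((hasDerivAt_id s).const_mul (c * φ v₀))
      refine monotoneOn_of_deriv_nonneg (convex_Ici T)
        (fun s hs => (hd s hs).continuousAt.continuousWithinAt)
        (fun s hs => (hd s (interior_subset hs)).differentiableAt.differentiableWithinAt)
        fun s hs => ?_
      have hs' : T ≤ s := interior_subset hs
      have hsp := hp s (hTpos.trans_le hs')
      rw [(hd s hs').deriv, mul_one, sub_nonneg]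
      refine mul_le_mul (hr s hsp).le ?_ hb.le (hc.le.trans (hr s hsp).le)
      exact (hmin (Set.Ico_subset_Icc_self (C.deriv_sq_mem hsp))).trans (C.lt_otherCurvature hsp).le
    have h1 := hmono (Set.mem_Ici.2 le_rfl) (Set.mem_Ici.2 (by linarith : T ≤ T + T))
      (by linarith)
    simp only at h1
    have h2 : c * φ v₀ * T = 1 := by rw [hT]; field_simp
    have h3 := C.w_pos T (hp T hTpos)
    have h4 := C.deriv_sq (hp (T + T) (by linarith))
    have h5 := C.w_pos (T + T) (hp (T + T) (by linarith))
    nlinarith [sq_nonneg (deriv S.r (T + T))]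
  refine ⟨S.ℓ.toReal, ENNReal.toReal_pos S.ℓ_pos.ne' hne, (ENNReal.ofReal_toReal hne).symm⟩

/-- If the slope stays away from zero, then the surface is a vertical graph. -/
theorem ClassProfile.isGraph (hφ : ContinuousOn φ (Set.Icc 0 1)) (C : ClassProfile φ S τ)
    (hr : ∀ s ∈ S.params, 0 < deriv S.r s) : S.IsGraph := by
  have hmono : StrictMonoOn S.r S.params := by
    refine strictMonoOn_of_deriv_pos S.ordConnected_params.convex
      (fun s hs => (S.contDiffAt_profile hs).1.continuousAt.continuousWithinAt)
      fun s hs => hr s (interior_subset hs)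
  have hpar : ∀ z ∈ S.dom, z ≠ 0 → ‖z‖ ∈ S.params := fun z hz h0 =>
    ⟨norm_pos_iff.2 h0, (mem_disk_iff z).1 hz⟩
  have hr0 : ∀ z ∈ S.dom, 0 ≤ S.r ‖z‖ ∧ (S.r ‖z‖ = 0 → z = 0) := by
    intro z hz
    by_cases h0 : z = 0
    · simp [h0, S.r_zero]
    · have := S.r_pos _ (hpar z hz h0).1 (hpar z hz h0).2
      exact ⟨this.le, fun h => absurd h this.ne'⟩
  refine ⟨?_, ?_⟩
  · intro z hz z' hz' he
    simp only [RotSurface.X, rotMap, Matrix.cons_val, Prod.mk.injEq] at he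
    obtain ⟨e0, e1, e2⟩ := he
    -- Equal points of the hyperbolic plane have equal distance to the axis, since cosh is injective
    -- on nonnegative reals.
    have hre : S.r ‖z‖ = S.r ‖z'‖ :=
      Real.cosh_strictMonoOn.injOn (hr0 z hz).1 (hr0 z' hz').1 e0
    by_cases h0 : z = 0
    · rw [h0, norm_zero, S.r_zero] at hre
      rw [h0, (hr0 z' hz').2 hre.symm]
    · have h0' : z' ≠ 0 := by
        rintro rfl
        rw [norm_zero, S.r_zero] at hre
        exact h0 ((hr0 z hz).2 hre)
      have hn : ‖z‖ = ‖z'‖ := hmono.injOn (hpar z hz h0) (hpar z' hz' h0') hre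
      have hsh : Real.sinh (S.r ‖z'‖) ≠ 0 := by
        rw [Ne, Real.sinh_eq_zero]
        exact fun h => h0' ((hr0 z' hz').2 h)
      have hn0 : ‖z'‖ ≠ 0 := norm_ne_zero_iff.2 h0'
      rw [hn] at e1 e2
      apply Complex.ext
      · exact (div_left_inj' hn0).1 (mul_left_cancel₀ hsh e1)
      · exact (div_left_inj' hn0).1 (mul_left_cancel₀ hsh e2)
  · have hang : ∀ s ∈ S.params, ∀ u : ℂ, ‖u‖ = 1 → S.angle ((s : ℂ) * u) = τ * deriv S.r s :=
      fun s hs u hu => by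
        rw [RotSurface.angle, C.normal_eq s hs u hu, angle_sq_profileNormal]
    have hτ0 : τ ≠ 0 := by rintro rfl; simpa using C.sq_sign
    intro z hz
    by_cases h0 : z = 0
    · have hc : ContinuousAt S.N 0 :=
        S.normal_cont.continuousAt ((isOpen_disk _).mem_nhds (h0 ▸ hz))
      have hca : ContinuousAt S.angle 0 :=
        (continuous_mink.tendsto (_, _)).comp (hc.tendsto.prodMk_nhds tendsto_const_nhds)
      have h1 : Tendsto (fun s : ℝ => S.angle (s : ℂ)) (𝓝[>] 0) (𝓝 (S.angle 0)) := by
        have h2 : Tendsto (fun s : ℝ => (s : ℂ)) (𝓝[>] 0) (𝓝 0) := by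
          simpa using (Complex.continuous_ofReal.tendsto 0).mono_left nhdsWithin_le_nhds
        exact hca.tendsto.comp h2
      have h3 : S.angle 0 = τ * 1 := by
        refine tendsto_nhds_unique h1 (((C.poleLimits hφ).1.const_mul τ).congr' ?_)
        obtain ⟨L, hL, -, hLp⟩ := S.exists_Ioo_subset_params
        filter_upwards [Ioo_mem_nhdsGT hL] with s hs
        have := hang s (hLp hs) 1 (by simp)
        rw [mul_one] at this
        exact this.symm
      rw [h0, h3, mul_one]
      exact hτ0
    · rw [← norm_mul_div_norm h0, hang _ (hpar z hz h0) _ (norm_div_norm h0)]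
      exact mul_ne_zero hτ0 (hr _ (hpar z hz h0)).ne'

/-- An inextendible surface whose slope stays away from zero has unbounded curvature. -/
theorem ClassProfile.not_boundedSecondForm (hφ : SmoothPos φ) (C : ClassProfile φ S τ)
    (hS : ∀ T : RotSurface, InClass φ T → T.Extends S → T.ℓ = S.ℓ) {c : ℝ} (hc : 0 < c)
    (hr : ∀ s ∈ S.params, c < deriv S.r s) : ¬ S.BoundedSecondForm := by
  rintro ⟨B, hB⟩
  obtain ⟨L, hL, hℓ⟩ := C.exists_length hφ hc hr
  have hpar : ∀ s ∈ Set.Ioo 0 L, s ∈ S.params := fun s hs =>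
    ⟨hs.1, by rw [hℓ]; exact (ENNReal.ofReal_lt_ofReal_iff hL).2 hs.2⟩
  obtain ⟨T, hT, hTS, hne⟩ := C.exists_extension hφ hL hℓ hc
    (fun s hs => (hr s (hpar s hs)).le) (B := √B) (fun s hs => by
      have h1 := hB _ (S.ray_mem (hpar s hs) (u := 1) (by simp)) _ _
        (C.principal s (hpar s hs) 1 (by simp))
      refine Real.le_sqrt_of_sq_le ?_
      nlinarith [sq_nonneg (parallelCurvature (S.r s) (τ * deriv S.h s))])
  exact hne (hS T hT hTS)

end

/-! ## The induced distance -/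

/-- A path on the surface is at least as long as its vertical extent. -/
theorem RotSurface.sq_height_le_firstForm (S : RotSurface) {z : ℂ} (hz : z ∈ S.dom) (v : ℂ) :
    (fderiv ℝ S.X z v 3) ^ 2 ≤ firstForm S.X z v v := by
  have hd := hasFDerivAt_pi'.1 (((S.contDiffAt hz).differentiableAt (by simp)).hasFDerivAt)
  have hp : HasFDerivAt (fun y => -(rotMap S.r S.h y 0 * rotMap S.r S.h y 0) +
      rotMap S.r S.h y 1 * rotMap S.r S.h y 1 + rotMap S.r S.h y 2 * rotMap S.r S.h y 2) _ z :=
    (((hd 0).mul (hd 0)).neg.add ((hd 1).mul (hd 1))).add ((hd 2).mul (hd 2))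
  have hc : (fun y => -(rotMap S.r S.h y 0 * rotMap S.r S.h y 0) +
      rotMap S.r S.h y 1 * rotMap S.r S.h y 1 + rotMap S.r S.h y 2 * rotMap S.r S.h y 2) =
      fun _ => (-1 : ℝ) := by
    funext y
    linear_combination (rotMap_mem_space S.r S.h S.r_zero y).1
  rw [hc] at hp
  have h0 := congrArg (fun F : ℂ →L[ℝ] ℝ => F v) (hp.unique (hasFDerivAt_const (-1 : ℝ) z))
  have hX := (rotMap_mem_space S.r S.h S.r_zero z).1
  simp only [add_apply, neg_apply,
    smul_apply, ContinuousLinearMap.comp_apply, ContinuousLinearMap.proj_apply,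
    zero_apply, smul_eq_mul] at h0
  rw [firstForm, mink, RotSurface.X]
  generalize fderiv ℝ (rotMap S.r S.h) z v = V at h0 ⊢
  generalize rotMap S.r S.h z 0 = a at h0 hX
  generalize rotMap S.r S.h z 1 = b at h0 hX
  generalize rotMap S.r S.h z 2 = c at h0 hX
  have h1 : a * V 0 = b * V 1 + c * V 2 := by linarith
  -- The horizontal part of the tangent vector is Lorentz-orthogonal to the timelike position vector
  -- (a, b, c), so by Cauchy–Schwarz it has nonnegative square. Only the vertical part remains as a
  -- lower bound.
  have ha : 1 ≤ a ^ 2 := by nlinarith [sq_nonneg b, sq_nonneg c]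
  have h2 : a ^ 2 * V 0 ^ 2 ≤ a ^ 2 * (V 1 ^ 2 + V 2 ^ 2) := by
    have h3 : a ^ 2 * V 0 ^ 2 = (b * V 1 + c * V 2) ^ 2 := by rw [← h1]; ring
    rw [h3, show a ^ 2 = 1 + b ^ 2 + c ^ 2 by linarith]
    nlinarith [sq_nonneg (b * V 2 - c * V 1), sq_nonneg (V 1), sq_nonneg (V 2)]
  have h4 := le_of_mul_le_mul_left h2 (by linarith)
  nlinarith

/-- The height changes along a curve by the integral of its vertical velocity, which the speed
dominates pointwise. -/
theorem RotSurface.abs_height_sub_le (S : RotSurface) (z w : ℂ) :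
    ENNReal.ofReal |S.h ‖w‖ - S.h ‖z‖| ≤ inducedDist S.X S.dom z w := by
  refine le_iInf fun c => le_iInf fun hc => le_iInf fun hm => le_iInf fun h0 => le_iInf fun h1 => ?_
  have hsub : ∀ t ∈ Set.uIcc (0:ℝ) 1, c t ∈ S.dom := fun t ht => by
    rw [Set.uIcc_of_le zero_le_one] at ht; exact hm ht
  set g : ℝ → ℝ := fun t => fderiv ℝ S.X (c t) (deriv c t) 3 with hg
  have hd : ∀ t ∈ Set.uIcc (0:ℝ) 1, HasDerivAt (fun t => S.X (c t) 3) (g t) t := fun t ht =>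
    hasDerivAt_pi.1 (hasDerivAt_comp_path
      (((S.contDiffAt (hsub t ht)).differentiableAt (by simp)).hasFDerivAt)
      (hc.differentiable (by simp) t).hasDerivAt) 3
  have hgc : ContinuousOn g (Set.uIcc 0 1) := by
    have h2 : ContinuousOn (fderiv ℝ S.X) S.dom := fun y hy =>
      ((S.contDiffAt hy).fderiv_right (m := 0) (by norm_cast)).continuousAt.continuousWithinAt
    have h3 : ContinuousOn (fun t => fderiv ℝ S.X (c t) (deriv c t)) (Set.uIcc 0 1) :=
      (h2.comp hc.continuous.continuousOn hsub).clm_apply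
        (hc.continuous_deriv le_rfl).continuousOn
    exact (continuousOn_pi.1 h3) 3
  have hint := intervalIntegral.integral_eq_sub_of_hasDerivAt hd hgc.intervalIntegrable
  rw [h0, h1] at hint
  change _ = S.h ‖w‖ - S.h ‖z‖ at hint
  rw [← hint, intervalIntegral.integral_of_le zero_le_one, ← Real.norm_eq_abs, ofReal_norm]
  refine (MeasureTheory.enorm_integral_le_lintegral_enorm _).trans ?_
  refine (MeasureTheory.lintegral_mono_set Set.Ioc_subset_Icc_self).trans ?_
  refine MeasureTheory.setLIntegral_mono' measurableSet_Icc fun t ht => ?_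
  rw [← ofReal_norm, Real.norm_eq_abs]
  exact ENNReal.ofReal_le_ofReal (Real.abs_le_sqrt (S.sq_height_le_firstForm (hm ht) _))

/-- The segment between the two parameters runs along a meridian, which has unit speed. -/
theorem RotSurface.inducedDist_le (S : RotSurface) {a b : ℝ} (ha : a ∈ S.params)
    (hb : b ∈ S.params) : inducedDist S.X S.dom (a : ℂ) (b : ℂ) ≤ ENNReal.ofReal |b - a| := by
  set c : ℝ → ℂ := fun t => (a : ℂ) + (t : ℂ) * ((b - a : ℝ) : ℂ) with hc
  have hcr : ∀ t, c t = ((a + t * (b - a) : ℝ) : ℂ) := fun t => by simp [hc]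
  have hpar : ∀ t ∈ Set.Icc (0:ℝ) 1, a + t * (b - a) ∈ S.params := fun t ht =>
    S.ordConnected_params.convex.add_smul_sub_mem ha hb ht
  have hcd : ContDiff ℝ 1 c :=
    contDiff_const.add (Complex.ofRealCLM.contDiff.mul contDiff_const)
  have hm : Set.MapsTo c (Set.Icc 0 1) S.dom := fun t ht => by
    rw [hcr]; exact S.real_mem (hpar t ht)
  have hle : inducedDist S.X S.dom (a : ℂ) (b : ℂ) ≤ curveLength S.X c := by
    rw [inducedDist]
    exact iInf_le_of_le c (iInf_le_of_le hcd (iInf_le_of_le hm (iInf_le_of_le (by simp [hc])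
      (iInf_le_of_le (by simp [hc]) le_rfl))))
  refine hle.trans ?_
  have hderiv : ∀ t, deriv c t = ((b - a : ℝ) : ℂ) := fun t => by
    have h1 : HasDerivAt (fun t : ℝ => (t : ℂ)) 1 t := Complex.ofRealCLM.hasDerivAt
    have h2 := (h1.mul_const ((b - a : ℝ) : ℂ)).const_add (a : ℂ)
    rw [one_mul] at h2
    exact h2.deriv
  have hform : ∀ t ∈ Set.Icc (0:ℝ) 1,
      ENNReal.ofReal (√(firstForm S.X (c t) (deriv c t) (deriv c t))) = ENNReal.ofReal |b - a| := by
    intro t ht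
    have h1 := S.unit_speed _ (S.real_mem (hpar t ht)) 1 (by simp) (by
      rw [Complex.norm_real, Real.norm_of_nonneg (hpar t ht).1.le, mul_one])
    rw [← hcr] at h1
    rw [hderiv, show ((b - a : ℝ) : ℂ) = (b - a) • (1 : ℂ) by simp, firstForm, map_smul,
      mink_smul_left, mink_smul_right]
    rw [firstForm] at h1
    rw [RotSurface.X, h1, mul_one, Real.sqrt_mul_self_eq_abs]
  rw [curveLength, MeasureTheory.setLIntegral_congr_fun measurableSet_Icc hform]
  simp

/-! ## Incompleteness -/

section

variable {φ : ℝ → ℝ} {S : RotSurface} {τ : ℝ}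

/-- Points running along a meridian to its end form a Cauchy sequence. A limit point w would have
the limiting height, but τ h increases strictly and has already passed τ h(‖w‖) by a definite amount
before the end. -/
theorem ClassProfile.not_completeOn (C : ClassProfile φ S τ) {L : ℝ} (hL : 0 < L)
    (hℓ : S.ℓ = ENNReal.ofReal L) : ¬ CompleteOn S.X S.dom := by
  intro hcomp
  have hpar : ∀ s : ℝ, 0 < s → s < L → s ∈ S.params := fun s h1 h2 =>
    ⟨h1, by rw [hℓ]; exact (ENNReal.ofReal_lt_ofReal_iff hL).2 h2⟩
  set σ : ℕ → ℝ := fun n => L - L / 2 * (1 / ((n : ℝ) + 1)) with hσ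
  have hσlim : Tendsto σ atTop (𝓝 L) := by
    have := (tendsto_one_div_add_atTop_nhds_zero_nat.const_mul (L / 2)).const_sub L
    simpa [hσ] using this
  have hσp : ∀ n, σ n ∈ S.params := by
    intro n
    have h1 : 0 < 1 / ((n : ℝ) + 1) := by positivity
    have h2 : 1 / ((n : ℝ) + 1) ≤ 1 := by
      rw [div_le_one (by positivity)]; linarith [n.cast_nonneg (α := ℝ)]
    refine hpar _ ?_ ?_ <;> simp only [hσ] <;> nlinarith
  obtain ⟨w, hw, hlim⟩ := hcomp (fun n => (σ n : ℂ)) (fun n => S.real_mem (hσp n)) (by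
    intro δ hδ
    obtain ⟨N, hN⟩ := EMetric.cauchySeq_iff.1 hσlim.cauchySeq δ hδ
    refine ⟨N, fun m hm n hn => (S.inducedDist_le (hσp m) (hσp n)).trans_lt ?_⟩
    have := hN n hn m hm
    rwa [edist_dist, Real.dist_eq] at this)
  have hh : Tendsto (fun n => S.h (σ n)) atTop (𝓝 (S.h ‖w‖)) := by
    rw [tendsto_iff_edist_tendsto_0]
    refine tendsto_of_tendsto_of_tendsto_of_le_of_le tendsto_const_nhds hlim
      (fun _ => zero_le) fun n => ?_
    have := S.abs_height_sub_le (σ n : ℂ) w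
    rwa [Complex.norm_real, Real.norm_of_nonneg (hσp n).1.le, abs_sub_comm, ← Real.dist_eq,
      ← edist_dist] at this
  have hmono : StrictMonoOn (fun s => τ * S.h s) S.params := by
    have hd : ∀ s ∈ S.params, HasDerivAt (fun s => τ * S.h s) (τ * deriv S.h s) s := fun s hs =>
      ((S.contDiffAt_profile hs).2.differentiableAt (by simp)).hasDerivAt.const_mul τ
    refine strictMonoOn_of_deriv_pos S.ordConnected_params.convex
      (fun s hs => (hd s hs).continuousAt.continuousWithinAt) fun s hs => ?_
    have hs' := interior_subset hs
    rw [(hd s hs').deriv]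
    exact C.w_pos s hs'
  have hwL : ‖w‖ < L := by
    rw [RotSurface.dom, hℓ, mem_disk_ofReal] at hw; exact hw
  have hn := norm_nonneg w
  set b := (‖w‖ + L) / 2 with hb
  have hbp : b ∈ S.params := hpar _ (by linarith) (by linarith)
  have hb2p : (b + L) / 2 ∈ S.params := hpar _ (by linarith [hbp.1]) (by linarith)
  have h1 : τ * S.h ‖w‖ ≤ τ * S.h b := by
    -- The pole is not an interior parameter; there the monotonicity of the height is obtained by
    -- continuity.
    rcases hn.eq_or_lt with h0 | h0
    · rw [← h0]
      have hmem : (0 : ℂ) ∈ disk S.ℓ := by rw [mem_disk_iff]; simpa using S.ℓ_pos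
      have h2 : ContinuousAt (fun s : ℝ => rotMap S.r S.h (s : ℂ)) 0 :=
        ContinuousAt.comp (g := rotMap S.r S.h) (f := fun s : ℝ => (s : ℂ))
          (by simpa using (S.contDiffAt hmem).continuousAt) Complex.continuous_ofReal.continuousAt
      have h3 := (tendsto_pi_nhds.1 h2.tendsto 3).mono_left (nhdsWithin_le_nhds (s := Set.Ioi 0))
      have h4 : Tendsto (fun s => τ * S.h s) (𝓝[>] 0) (𝓝 (τ * S.h 0)) := by
        refine Tendsto.const_mul τ ?_
        have e0 : rotMap S.r S.h ((0 : ℝ) : ℂ) 3 = S.h 0 := by simp [rotMap]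
        rw [e0] at h3
        refine h3.congr' ?_
        filter_upwards [self_mem_nhdsWithin] with s hs
        simp [rotMap, abs_of_pos (Set.mem_Ioi.1 hs)]
      refine le_of_tendsto h4 ?_
      filter_upwards [Ioo_mem_nhdsGT hbp.1] with s hs
      exact (hmono (S.mem_params_of_le hbp hs.1 hs.2.le) hbp hs.2).le
    · exact (hmono (hpar _ h0 hwL) hbp (by linarith)).le
  have h2 : τ * S.h b < τ * S.h ((b + L) / 2) := hmono hbp hb2p (by linarith)
  have h3 : τ * S.h ((b + L) / 2) ≤ τ * S.h ‖w‖ := by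
    refine ge_of_tendsto (hh.const_mul τ) ?_
    filter_upwards [hσlim.eventually_const_lt (show (b + L) / 2 < L by linarith)] with n hn'
    exact (hmono hb2p (hσp n) hn').le
  linarith

/-- A second pole would make the radius tend to 0 at the end of the profile, but r increases and
stays above r(L / 2) > 0. -/
theorem RotSurface.not_closesUp (hr : ∀ s ∈ S.params, 0 < deriv S.r s) : ¬ S.ClosesUp := by
  rintro ⟨htop, T, hTℓ, hT⟩
  set L := S.ℓ.toReal with hLd
  have hL : 0 < L := ENNReal.toReal_pos S.ℓ_pos.ne' htop
  have hℓ : S.ℓ = ENNReal.ofReal L := (ENNReal.ofReal_toReal htop).symm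
  have hpar : ∀ s : ℝ, 0 < s → s < L → s ∈ S.params := fun s h1 h2 =>
    ⟨h1, by rw [hℓ]; exact (ENNReal.ofReal_lt_ofReal_iff hL).2 h2⟩
  have hmono : StrictMonoOn S.r S.params :=
    strictMonoOn_of_deriv_pos S.ordConnected_params.convex
      (fun s hs => (S.contDiffAt_profile hs).1.continuousAt.continuousWithinAt)
      fun s hs => hr s (interior_subset hs)
  have hmid := hpar (L / 2) (by linarith) (by linarith)
  have hmem : (0 : ℂ) ∈ disk T.ℓ := by rw [mem_disk_iff]; simpa using T.ℓ_pos
  have h2 : ContinuousAt (fun s : ℝ => rotMap T.r T.h (s : ℂ)) 0 :=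
    ContinuousAt.comp (g := rotMap T.r T.h) (f := fun s : ℝ => (s : ℂ))
      (by simpa using (T.contDiffAt hmem).continuousAt) Complex.continuous_ofReal.continuousAt
  have h3 := (tendsto_pi_nhds.1 h2.tendsto 0).mono_left (nhdsWithin_le_nhds (s := Set.Ioi 0))
  have e0 : rotMap T.r T.h ((0 : ℝ) : ℂ) 0 = 1 := by simp [rotMap, T.r_zero]
  rw [e0] at h3
  have h4 : Real.cosh (S.r (L / 2)) ≤ 1 := by
    refine ge_of_tendsto h3 ?_
    filter_upwards [Ioo_mem_nhdsGT (show (0:ℝ) < L / 2 by linarith)] with s hs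
    have hs1 := hpar s hs.1 (by linarith [hs.2])
    have hs2 := hpar (L - s) (by linarith [hs.2]) (by linarith [hs.1])
    have e1 : rotMap T.r T.h (s : ℂ) 0 = Real.cosh (T.r s) := by
      simp [rotMap, abs_of_pos hs.1]
    rw [e1, (hT s hs.1 hs1.2).1, Real.cosh_le_cosh, abs_of_pos (S.r_pos _ hmid.1 hmid.2),
      abs_of_pos (S.r_pos _ hs2.1 hs2.2)]
    exact (hmono hmid hs2 (by linarith [hs.2])).le
  have := Real.one_lt_cosh.2 (S.r_pos _ hmid.1 hmid.2).ne'
  linarith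

end

/-! ## The canonical examples of the modified classes -/

theorem IsCanonicalExample.eventually_deriv_pos {φ : ℝ → ℝ} (hφ : SmoothPos φ) {S : RotSurface}
    (hS : IsCanonicalExample φ S) :
    ∀ᶠ ε : ℝ in 𝓝[>] 0, ENNReal.ofReal ε < S.ℓ ∧ 0 < deriv S.r ε := by
  obtain ⟨τ, C⟩ := hS.1.exists_profile hφ.2
  obtain ⟨L, hL, -, hLp⟩ := S.exists_Ioo_subset_params
  filter_upwards [Ioo_mem_nhdsGT hL,
    (C.poleLimits hφ.1.continuousOn).1.eventually_const_lt one_pos] with s hs hr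
  exact ⟨(hLp hs).2, hr⟩

theorem IsModification.hasIncompleteUnboundedExample {φ₀ φ : ℝ → ℝ} {S₀ : RotSurface} {ε : ℝ}
    (h₀ : SmoothPos φ₀) (hS₀ : IsCanonicalExample φ₀ S₀) (hε : ε ∈ S₀.params)
    (hy : 0 < deriv S₀.r ε) (hM : IsModification φ₀ φ (S₀.r ε) (deriv S₀.r ε)) :
    HasIncompleteUnboundedExample φ := by
  have hφ := hM.smoothPos h₀
  obtain ⟨τ₀, C₀⟩ := hS₀.1.exists_profile h₀.2
  refine ⟨isGeneralWeingarten_weingartenFn hφ.1, exists_canonicalExample hφ, fun S hS => ?_⟩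
  obtain ⟨τ, C⟩ := hS.1.exists_profile hφ.2
  have hr : ∀ s ∈ S.params, deriv S₀.r ε / 2 < deriv S.r s := fun s hs =>
    hM.half_lt_deriv h₀ C₀ hε hy C hs
  have hr0 : ∀ s ∈ S.params, 0 < deriv S.r s := fun s hs => (half_pos hy).trans (hr s hs)
  obtain ⟨L, hL, hℓ⟩ := C.exists_length hφ (half_pos hy) hr
  exact ⟨C.isGraph hφ.1.continuousOn hr0,
    not_or.2 ⟨RotSurface.not_closesUp hr0, C.not_completeOn hL hℓ⟩,
    C.not_boundedSecondForm hφ hS.2 (half_pos hy) hr⟩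

end HypProd

end

open HypProd in
theorem proposition8p3 :
    (∀ φ₀ : ℝ → ℝ, SmoothPos φ₀ → (∀ v ∈ Set.Icc (0 : ℝ) 1, √(1 - v) < φ₀ v) →
      (∃ S₀, IsCanonicalExample φ₀ S₀) ∧
      ∀ S₀, IsCanonicalExample φ₀ S₀ →
        (∀ᶠ ε : ℝ in 𝓝[>] 0, ENNReal.ofReal ε < S₀.ℓ ∧ 0 < deriv S₀.r ε) ∧
        ∀ ε : ℝ, 0 < ε → ENNReal.ofReal ε < S₀.ℓ → 0 < deriv S₀.r ε →
          (∃ φ, IsModification φ₀ φ (S₀.r ε) (deriv S₀.r ε)) ∧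
          ∀ φ, IsModification φ₀ φ (S₀.r ε) (deriv S₀.r ε) →
            SmoothPos φ ∧ HasIncompleteUnboundedExample φ) ∧
    ∃ φ : ℝ → ℝ, SmoothPos φ ∧ HasIncompleteUnboundedExample φ := by
  refine ⟨fun φ₀ h₀ _ => ⟨exists_canonicalExample h₀, fun S₀ hS₀ =>
    ⟨hS₀.eventually_deriv_pos h₀, fun ε h1 h2 hy => ⟨exists_isModification h₀.1 _ hy,
      fun φ hM => ⟨hM.smoothPos h₀, hM.hasIncompleteUnboundedExample h₀ hS₀ ⟨h1, h2⟩ hy⟩⟩⟩⟩, ?_⟩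
  -- Any positive smooth φ₀ starts the construction; the constant 2 also lies above √(1 - v).
  have h₀ : SmoothPos fun _ => 2 := ⟨contDiffOn_const, fun _ _ => two_pos⟩
  obtain ⟨S₀, hS₀⟩ := exists_canonicalExample h₀
  obtain ⟨ε, ⟨h2, hy⟩, h1⟩ := ((hS₀.eventually_deriv_pos h₀).and self_mem_nhdsWithin).exists
  obtain ⟨φ, hM⟩ := exists_isModification h₀.1 (S₀.r ε) hy
  exact ⟨φ, hM.smoothPos h₀, hM.hasIncompleteUnboundedExample h₀ hS₀ ⟨h1, h2⟩ hy⟩
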